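/- **Conventions.** For a C\*-algebra $A$, $M(A)$ is its multiplier algebra. Hilbert C\*-modules are right modules, with inner product linear in the first variable, so $\langle vb,w\rangle=\langle v,w\rangle b$; $\mathcal L(E)$ is the C\*-algebra of adjointable operators on $E$ and $L(B,E)$ is the space of all linear maps $B\to E$. A completely positive linear map $\rho:A\to M(B)$ is *strict* if it is strictly continuous on bounded sets; it is then extended to the unique linear map $M(A)\to M(B)$ that is strictly continuous on bounded sets, again written $\rho$. **Setting.** Let $A,B$ be C\*-algebras, $E$ a Hilbert C\*-module over $B$, $N$ a dense left ideal of $A$ and $\Lambda:N\to L(B,E)$ a linear map which is closed for the norm topology on $A$ and the strong (pointwise) topology on $L(B,E)$, such that $\operatorname{span}\{\Lambda(a)b\mid a\in N,\ b\in B\}$ is dense in $E$. Let $(u_i)_{i\in I}$ be a net in $M(A)$ such that for every $i\in I$: 1. $Nu_i\subseteq N$; 2. there is a (necessarily unique) $S_i\in\mathcal L(E)$ with $S_i\Lambda(a)=\Lambda(au_i)$ for all $a\in N$; 3. $\|u_i\|\le 1$ and $\|S_i\|\le 1$; 4. there is a (necessarily unique) strict completely positive linear map $\rho_i:A\to M(B)$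 with $b_2^*\rho_i(a_2^*a_1)b_1=\langle S_i\Lambda(a_1)b_1,S_i\Lambda(a_2)b_2\rangle$ for all $a_1,a_2\in N$, $b_1,b_2\in B$; and such that $u_i\to1$ strictly and $S_i\to1$ strongly. Let $\mathcal H$ be the set of strict completely positive linear maps $\rho:A\to M(B)$ for which there is a positive $T\in\mathcal L(E)$ with $$b_2^*\rho(a_2^*a_1)b_1=\langle T\Lambda(a_1)b_1,\Lambda(a_2)b_2\rangle\qquad(a_1,a_2\in N,\ b_1,b_2\in B);$$ $T$ is then unique and is denoted $T_\rho$. Order $\mathcal H$ by: $\rho_1\le\rho_2$ iff $\rho_2-\rho_1$ is completely positive. Put $\mathcal F=\{\rho\in\mathcal H\mid T_\rho\le1\}$ and $\mathcal G=\{\lambda\rho\mid\lambda\in[0,1),\ \rho\in\mathcal F\}$, the latter used as the index set of nets $(\cdot)_{\rho\in\mathcal G}$. Let $D$ be a dense right ideal of $B$. Put $$\mathcal P=\{a\in M(A)^+\mid (d^*\rho(a)d)_{\rho\in\mathcal G}\text{ converges in }B\text{ for every }d\in D\},\qquad \mathcal N=\{a\in M(A)\mid a^*a\in\mathcal P\};$$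 $\mathcal N$ is a subspace of $M(A)$. The algebraic tensor product $\mathcal N\odot D$ is a right $B$-module with $(a\otimes d)b=a\otimes(db)$ and carries the $B$-valued semi-inner product given by $$\langle a_1\otimes b_1,a_2\otimes b_2\rangle=\lim_{\rho\in\mathcal G}b_2^*\rho(a_2^*a_1)b_1 .$$ Let $M(A)\dot\otimes D$ be the Hilbert C\*-module over $B$ obtained by dividing out the vectors $x$ with $\langle x,x\rangle=0$ and completing, and let $a\dot\otimes d$ be the class of $a\otimes d$. **Proposition.** We have $N\subseteq\mathcal N$; there is a unique linear isometry $U:E\to M(A)\dot\otimes D$ such that $U(\Lambda(a)b)=a\dot\otimes b$ for all $a\in N$ and $b\in D$; and $U$ is a unitary transformation from $E$ to $M(A)\dot\otimes D$, that is, $U$ is adjointable with $U^*U=1$ and $UU^*=1$. In particular, $U$ is surjective. -/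

import Mathlib

open Filter Topology MulOpposite
open scoped MultiplierAlgebra CStarAlgebra TensorProduct

/-! ### Hilbert C⋆-modules: completion of a semi-inner-product module -/

/-- A `C`-valued semi-inner product on a complex vector space `F` on which the C⋆-algebra `C` acts;
`form` is linear in its second argument. -/
structure SemiInnerModule (C F : Type*) [NonUnitalCStarAlgebra C] [PartialOrder C]
    [AddCommGroup F] [Module ℂ F] where
  /-- the semi-inner product -/
  form : F →ₗ⋆[ℂ] F →ₗ[ℂ] C
  /-- the action of the C⋆-algebra -/
  act : C → F →ₗ[ℂ] F
  star_form : ∀ x y, star (form x y) = form y x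
  form_nonneg : ∀ x, 0 ≤ form x x
  form_act : ∀ (c : C) (x y : F), form x (act c y) = c * form x y

namespace SemiInnerModule

variable {C F : Type*} [NonUnitalCStarAlgebra C] [PartialOrder C] [StarOrderedRing C]
  [AddCommGroup F] [Module ℂ F]

theorem form_act_left (S : SemiInnerModule C F) (c : C) (x y : F) :
    S.form (S.act c x) y = S.form x y * star c := by
  rw [← S.star_form, S.form_act, star_mul, S.star_form]

theorem form_mul_form_le (S : SemiInnerModule C F) (x y : F) (r : ℝ) (hr : 0 < r)
    (hx : ‖S.form x x‖ ≤ r) :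
    S.form x y * S.form y x ≤ r • S.form y y := by
  have h₁ : ∀ a : C, (0 : C) ≤ r • (a * star a) - r • (a * S.form y x)
      - r • (S.form x y * star a) + r • (r • S.form y y) := fun a => by
    have hsm : ∀ z w : F, S.form z ((r : ℂ) • w) = r • S.form z w := fun z w => by
      rw [map_smul]; exact (RCLike.real_smul_eq_coe_smul (K := ℂ) r _).symm
    have hsm' : ∀ z w : F, S.form ((r : ℂ) • z) w = r • S.form z w := fun z w => by
      rw [← S.star_form, hsm, star_smul, S.star_form]; simp
    calc (0 : C) ≤ S.form (S.act a x - (r : ℂ) • y) (S.act a x - (r : ℂ) • y) := S.form_nonneg _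
      _ = a * S.form x x * star a - r • (a * S.form y x)
            - r • (S.form x y * star a) + r • (r • S.form y y) := by
          simp only [map_sub, LinearMap.sub_apply, hsm, hsm', S.form_act, S.form_act_left,
            mul_assoc]
          abel
      _ ≤ _ := by
          gcongr
          calc _ ≤ ‖S.form x x‖ • (a * star a) :=
                CStarAlgebra.star_right_conjugate_le_norm_smul (hb := by
                  exact IsSelfAdjoint.of_nonneg (S.form_nonneg x))
            _ ≤ r • (a * star a) :=
                smul_le_smul_of_nonneg_right hx (mul_star_self_nonneg a)
  specialize h₁ (S.form x y)
  simp only [S.star_form, sub_self, zero_sub, le_neg_add_iff_add_le, add_zero] at h₁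
  rwa [smul_le_smul_iff_of_pos_left hr] at h₁

theorem norm_form_sq_le (S : SemiInnerModule C F) (x y : F) :
    ‖S.form x y‖ ^ 2 ≤ ‖S.form x x‖ * ‖S.form y y‖ := by
  have key : ∀ r : ℝ, ‖S.form x x‖ < r → ‖S.form x y‖ ^ 2 ≤ r * ‖S.form y y‖ := fun r hr => by
    have hr0 : 0 < r := (norm_nonneg _).trans_lt hr
    calc ‖S.form x y‖ ^ 2 = ‖S.form x y * S.form y x‖ := by
          rw [← S.star_form x, CStarRing.norm_self_mul_star, pow_two]
      _ ≤ ‖r • S.form y y‖ := by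
          refine CStarAlgebra.norm_le_norm_of_nonneg_of_le ?_
            (S.form_mul_form_le x y r hr0 hr.le)
          rw [← S.star_form x]
          exact mul_star_self_nonneg _
      _ = r * ‖S.form y y‖ := by rw [norm_smul, Real.norm_of_nonneg hr0.le]
  have h2 : Tendsto (fun r : ℝ => r * ‖S.form y y‖) (𝓝[>] ‖S.form x x‖)
      (𝓝 (‖S.form x x‖ * ‖S.form y y‖)) :=
    ((continuous_id.mul continuous_const).tendsto _).mono_left nhdsWithin_le_nhds
  exact ge_of_tendsto h2 (eventually_nhdsWithin_of_forall fun r hr => key r hr)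

theorem norm_form_le (S : SemiInnerModule C F) (x y : F) :
    ‖S.form x y‖ ≤ √‖S.form x x‖ * √‖S.form y y‖ := by
  rw [← Real.sqrt_mul (norm_nonneg _)]
  exact Real.le_sqrt_of_sq_le (S.norm_form_sq_le x y)

/-- The space `F`, seen as a seminormed space with `‖x‖ = ‖⟨x, x⟩‖^(1/2)`. -/
def Space (_S : SemiInnerModule C F) : Type _ := F

instance (S : SemiInnerModule C F) : AddCommGroup S.Space := inferInstanceAs (AddCommGroup F)

instance (S : SemiInnerModule C F) : Module ℂ S.Space := inferInstanceAs (Module ℂ F)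

noncomputable instance (S : SemiInnerModule C F) : Norm S.Space :=
  ⟨fun x => √‖S.form x x‖⟩

/-- The semi-inner product on `S.Space`. -/
def spaceForm (S : SemiInnerModule C F) : S.Space →ₗ⋆[ℂ] S.Space →ₗ[ℂ] C := S.form

theorem norm_spaceForm_le (S : SemiInnerModule C F) (x y : S.Space) :
    ‖S.spaceForm x y‖ ≤ √‖S.spaceForm x x‖ * √‖S.spaceForm y y‖ := S.norm_form_le x y

theorem norm_def (S : SemiInnerModule C F) (x : S.Space) : ‖x‖ = √‖S.spaceForm x x‖ := rfl

theorem seminormedCore (S : SemiInnerModule C F) : SeminormedSpace.Core ℂ S.Space where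
  norm_nonneg _ := Real.sqrt_nonneg _
  norm_smul c x := by
    rw [norm_def, norm_def, LinearMap.map_smulₛₗ₂, map_smul, norm_smul, norm_smul,
      RCLike.norm_conj, ← mul_assoc, Real.sqrt_mul (by positivity),
      Real.sqrt_mul_self (norm_nonneg _)]
  norm_triangle x y := by
    rw [norm_def, norm_def, norm_def, Real.sqrt_le_left (by positivity)]
    have e : S.spaceForm (x + y) (x + y) =
        S.spaceForm x x + S.spaceForm y x + S.spaceForm x y + S.spaceForm y y := by
      simp only [map_add, LinearMap.add_apply]; abel
    rw [e]
    have h1 := S.norm_spaceForm_le x y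
    have h2 := S.norm_spaceForm_le y x
    calc _ ≤ ‖S.spaceForm x x‖ + ‖S.spaceForm y x‖ + ‖S.spaceForm x y‖ + ‖S.spaceForm y y‖ :=
          norm_add₄_le
      _ ≤ ‖S.spaceForm x x‖ + √‖S.spaceForm y y‖ * √‖S.spaceForm x x‖
            + √‖S.spaceForm x x‖ * √‖S.spaceForm y y‖ + ‖S.spaceForm y y‖ := by gcongr
      _ = (√‖S.spaceForm x x‖ + √‖S.spaceForm y y‖) ^ 2 := by
          rw [add_sq, Real.sq_sqrt (norm_nonneg _), Real.sq_sqrt (norm_nonneg _)]; ring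

noncomputable instance (S : SemiInnerModule C F) : SeminormedAddCommGroup S.Space :=
  SeminormedAddCommGroup.ofCore S.seminormedCore

noncomputable instance (S : SemiInnerModule C F) : NormedSpace ℂ S.Space :=
  { norm_smul_le := fun c x => (S.seminormedCore.norm_smul c x).le }

/-- The semi-inner product as a continuous sesquilinear map. -/
noncomputable def formL (S : SemiInnerModule C F) : S.Space →L⋆[ℂ] S.Space →L[ℂ] C :=
  LinearMap.mkContinuous₂ S.spaceForm 1 fun x y => by
    rw [one_mul]; exact S.norm_form_le x y

theorem continuous_form (S : SemiInnerModule C F) :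
    Continuous fun p : S.Space × S.Space => S.spaceForm p.1 p.2 := by
  have h : Continuous fun p : S.Space × S.Space => S.formL p.1 p.2 := by fun_prop
  exact h

/-- The action of `c` on `S.Space`. -/
def spaceAct (S : SemiInnerModule C F) (c : C) : S.Space →ₗ[ℂ] S.Space := S.act c

/-- The action of `c` as a continuous linear map. -/
noncomputable def actL (S : SemiInnerModule C F) (c : C) : S.Space →L[ℂ] S.Space :=
  LinearMap.mkContinuous (S.spaceAct c) ‖c‖ fun x => by
    have e : S.spaceForm (S.spaceAct c x) (S.spaceAct c x) = c * (S.spaceForm x x * star c) :=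
      (S.form_act c _ _).trans (congrArg (c * ·) (S.form_act_left c _ _))
    rw [norm_def, norm_def, Real.sqrt_le_left (by positivity), e, mul_pow,
      Real.sq_sqrt (norm_nonneg _)]
    calc _ ≤ ‖c‖ * (‖S.spaceForm x x‖ * ‖star c‖) :=
          (norm_mul_le _ _).trans (by gcongr; exact norm_mul_le _ _)
      _ = _ := by rw [norm_star]; ring

/-- The Hilbert C⋆-module obtained from a semi-inner-product module by dividing out the vectors `x`
with `⟨x, x⟩ = 0` and completing (the completion of a seminormed space is separated, hence
the quotient is included). -/
def HilbertCompletion (S : SemiInnerModule C F) : Type _ := UniformSpace.Completion S.Space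

namespace HilbertCompletion

variable (S : SemiInnerModule C F)

noncomputable instance : NormedAddCommGroup S.HilbertCompletion :=
  inferInstanceAs (NormedAddCommGroup (UniformSpace.Completion S.Space))

noncomputable instance : NormedSpace ℂ S.HilbertCompletion :=
  inferInstanceAs (NormedSpace ℂ (UniformSpace.Completion S.Space))

instance : CompleteSpace S.HilbertCompletion :=
  inferInstanceAs (CompleteSpace (UniformSpace.Completion S.Space))

/-- The class of `x : F` in the completion. -/
noncomputable def mk (x : F) : S.HilbertCompletion :=
  UniformSpace.Completion.coe' (show S.Space from x)

noncomputable instance : SMul C S.HilbertCompletion :=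
  ⟨fun c => UniformSpace.Completion.map (S.actL c)⟩

noncomputable instance : Inner C S.HilbertCompletion :=
  ⟨Function.curry ((UniformSpace.Completion.isDenseInducing_coe.prodMap
    UniformSpace.Completion.isDenseInducing_coe).extend
      fun p : S.Space × S.Space => S.spaceForm p.1 p.2)⟩

theorem denseRange_mk : DenseRange (mk S) :=
  UniformSpace.Completion.denseRange_coe (α := S.Space)

theorem inner_mk (x y : F) : inner C (mk S x) (mk S y) = S.form x y :=
  (UniformSpace.Completion.isDenseInducing_coe.prodMap
    UniformSpace.Completion.isDenseInducing_coe).extend_eq S.continuous_form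
      ((show S.Space from x), (show S.Space from y))

theorem smul_mk (c : C) (x : F) : c • mk S x = mk S (S.act c x) :=
  UniformSpace.Completion.map_coe (S.actL c).uniformContinuous (show S.Space from x)

theorem mk_add (x y : F) : mk S (x + y) = mk S x + mk S y :=
  UniformSpace.Completion.coe_add (show S.Space from x) (show S.Space from y)

theorem mk_smul (c : ℂ) (x : F) : mk S (c • x) = c • mk S x :=
  UniformSpace.Completion.coe_smul c (show S.Space from x)

theorem norm_mk (x : F) : ‖mk S x‖ = √‖S.form x x‖ :=
  UniformSpace.Completion.norm_coe (show S.Space from x)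

theorem continuous_smul (c : C) : Continuous fun x : S.HilbertCompletion => c • x :=
  UniformSpace.Completion.continuous_map (f := S.actL c)

theorem continuous_inner :
    Continuous fun p : S.HilbertCompletion × S.HilbertCompletion => inner C p.1 p.2 := by
  let f : S.Space →+ S.Space →+ C :=
    { toFun := fun x => (S.formL x).toLinearMap.toAddMonoidHom
      map_zero' := by ext x; simp
      map_add' := fun x y => by ext z; simp }
  have hf : Continuous fun p : S.Space × S.Space => f p.1 p.2 := S.continuous_form
  exact (UniformSpace.Completion.isDenseInducing_toCompl S.Space).extend_Z_bilin
    (UniformSpace.Completion.isDenseInducing_toCompl S.Space) hf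

variable {S} in
theorem continuous_inner' {X : Type*} [TopologicalSpace X] {f g : X → S.HilbertCompletion}
    (hf : Continuous f) (hg : Continuous g) : Continuous fun x => inner C (f x) (g x) :=
  (continuous_inner S).comp (hf.prodMk hg)

theorem norm_eq (x : S.HilbertCompletion) : ‖x‖ = √‖inner C x x‖ := by
  have h : IsClosed {x : S.HilbertCompletion | ‖x‖ = √‖inner C x x‖} :=
    isClosed_eq continuous_norm (continuous_inner' continuous_id continuous_id).norm.sqrt
  refine (denseRange_mk S).induction_on x h fun a => ?_
  rw [inner_mk, norm_mk]

noncomputable instance : CStarModule C S.HilbertCompletion where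
  inner_add_right {x y z} := by
    refine (denseRange_mk S).induction_on₃ (p := fun x y z : S.HilbertCompletion =>
      inner C x (y + z) = inner C x y + inner C x z) ?_ ?_ x y z
    · exact isClosed_eq (continuous_inner' continuous_fst (by fun_prop))
        ((continuous_inner' continuous_fst (by fun_prop)).add
          (continuous_inner' continuous_fst (by fun_prop)))
    · intro a b c
      rw [← mk_add, inner_mk, inner_mk, inner_mk, map_add]
  inner_self_nonneg {x} := by
    refine (denseRange_mk S).induction_on (p := fun x : S.HilbertCompletion =>
      0 ≤ inner C x x) x ?_ ?_
    · exact isClosed_le continuous_const (continuous_inner' continuous_id continuous_id)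
    · intro a
      rw [inner_mk]; exact S.form_nonneg a
  inner_self {x} := by
    rw [← norm_eq_zero (a := x), norm_eq S x, Real.sqrt_eq_zero (norm_nonneg _), norm_eq_zero]
  inner_op_smul_right {c x y} := by
    refine (denseRange_mk S).induction_on₂ (p := fun x y : S.HilbertCompletion =>
      inner C x (c • y) = c * inner C x y) ?_ ?_ x y
    · exact isClosed_eq (continuous_inner' continuous_fst
        ((continuous_smul S c).comp continuous_snd))
        ((continuous_inner' continuous_fst continuous_snd).const_mul c)
    · intro a b
      rw [smul_mk, inner_mk, inner_mk, S.form_act]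
  inner_smul_right_complex {z x y} := by
    refine (denseRange_mk S).induction_on₂ (p := fun x y : S.HilbertCompletion =>
      inner C x (z • y) = z • inner C x y) ?_ ?_ x y
    · have hz : Continuous fun c : C => z • c := continuous_const_smul z
      have hz' : Continuous fun y : S.HilbertCompletion => z • y := continuous_const_smul z
      exact isClosed_eq (continuous_inner' continuous_fst (hz'.comp continuous_snd))
        (hz.comp (continuous_inner' continuous_fst continuous_snd))
    · intro a b
      rw [← mk_smul, inner_mk, inner_mk, map_smul]
  star_inner x y := by
    refine (denseRange_mk S).induction_on₂ (p := fun x y : S.HilbertCompletion =>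
      star (inner C x y) = inner C y x) ?_ ?_ x y
    · exact isClosed_eq (continuous_star.comp (continuous_inner' continuous_fst continuous_snd))
        (continuous_inner' continuous_snd continuous_fst)
    · intro a b
      rw [inner_mk, inner_mk, S.star_form]
  norm_eq_sqrt_norm_inner_self x := norm_eq S x

end HilbertCompletion

end SemiInnerModule

/-! ### Multipliers, the strict topology and strict completely positive maps -/

namespace CStarWeight

section Multiplier

variable {A B : Type*} [NonUnitalCStarAlgebra A] [NonUnitalCStarAlgebra B]

/-- The strict topology on the multiplier algebra `M(A)`: the topology generated by the maps
`m ↦ m a` and `m ↦ a m` (`a ∈ A`) into `A` with its norm topology. -/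
noncomputable abbrev strictTopology (A : Type*) [NonUnitalCStarAlgebra A] : TopologicalSpace 𝓜(ℂ, A) :=
  TopologicalSpace.induced
    (fun m : 𝓜(ℂ, A) => ((fun a => m.fst a, fun a => m.snd a) : (A → A) × (A → A))) inferInstance

/-- The order on the C⋆-algebra `M(A)` given by its C⋆-algebra structure: `m ≤ m'` if and only if `m' - m` is
self-adjoint with spectrum in `[0, ∞)`. -/
noncomputable instance multiplierPartialOrder : PartialOrder 𝓜(ℂ, A) := CStarAlgebra.spectralOrder _

instance multiplierStarOrderedRing : StarOrderedRing 𝓜(ℂ, A) := CStarAlgebra.spectralOrderedRing _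

/-- A map `f : M(A) → M(B)` is strictly continuous on bounded sets. -/
def StrictlyContinuousOnBounded (f : 𝓜(ℂ, A) → 𝓜(ℂ, B)) : Prop :=
  ∀ r : ℝ, @ContinuousOn _ _ (strictTopology A) (strictTopology B) f {m | ‖m‖ ≤ r}

theorem tendsto_strict_iff {ι : Type*} {l : Filter ι} {f : ι → 𝓜(ℂ, A)} {m : 𝓜(ℂ, A)} :
    Tendsto f l (@nhds _ (strictTopology A) m) ↔
      (∀ a, Tendsto (fun i => (f i).fst a) l (𝓝 (m.fst a))) ∧
      ∀ a, Tendsto (fun i => (f i).snd a) l (𝓝 (m.snd a)) := by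
  rw [strictTopology, nhds_induced, tendsto_comap_iff, nhds_prod_eq, tendsto_prod_iff']
  simp only [tendsto_pi_nhds]
  rfl

theorem eq_of_mul_left {x y : A} (h : ∀ z, z * x = z * y) : x = y := by
  rw [← sub_eq_zero, ← CStarRing.star_mul_self_eq_zero_iff, mul_sub, h, sub_self]

theorem fst_mul (m : 𝓜(ℂ, A)) (x y : A) : m.fst (x * y) = m.fst x * y :=
  eq_of_mul_left fun z => by rw [← m.central, ← mul_assoc, ← mul_assoc, m.central]

theorem multiplier_ext_fst {m m' : 𝓜(ℂ, A)} (h : ∀ a, m.fst a = m'.fst a) : m = m' := by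
  have h2 : ∀ a, m.snd a = m'.snd a := fun a => by
    rw [← star_inj]
    exact eq_of_mul_left fun z => by
      rw [← star_star z, ← star_mul, ← star_mul, m.central, m'.central, h]
  exact DoubleCentralizer.ext (𝕜 := ℂ) (A := A) _ _
    (Prod.ext (ContinuousLinearMap.ext h) (ContinuousLinearMap.ext h2))

theorem strict_limit_unique {ι : Type*} {l : Filter ι} [l.NeBot] {f : ι → 𝓜(ℂ, A)}
    {m m' : 𝓜(ℂ, A)} (h : Tendsto f l (@nhds _ (strictTopology A) m))
    (h' : Tendsto f l (@nhds _ (strictTopology A) m')) : m = m' :=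
  multiplier_ext_fst fun a =>
    tendsto_nhds_unique ((tendsto_strict_iff.1 h).1 a) ((tendsto_strict_iff.1 h').1 a)

theorem exists_strict_limit {ι : Type*} {l : Filter ι} [l.NeBot] {f : ι → 𝓜(ℂ, A)}
    (h₁ : ∀ a, ∃ y, Tendsto (fun i => (f i).fst a) l (𝓝 y))
    (h₂ : ∀ a, ∃ y, Tendsto (fun i => (f i).snd a) l (𝓝 y)) :
    ∃ m, Tendsto f l (@nhds _ (strictTopology A) m) := by
  choose L hL using h₁
  choose R hR using h₂
  have central : ∀ x y, R x * y = x * L y := fun x y => by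
    refine tendsto_nhds_unique ((hR x).mul_const y) ?_
    simp_rw [DoubleCentralizer.central]
    exact (hL y).const_mul x
  have smulc : ∀ (c : ℂ), Continuous fun x : A => c • x := fun c => continuous_const_smul c
  let L' : A →ₗ[ℂ] A :=
    { toFun := L
      map_add' := fun x y => tendsto_nhds_unique (hL (x + y)) (by
        simp_rw [map_add]; exact (hL x).add (hL y))
      map_smul' := fun c x => tendsto_nhds_unique (hL (c • x)) (by
        simp_rw [map_smul]; exact ((smulc c).tendsto _).comp (hL x)) }
  let R' : A →ₗ[ℂ] A :=
    { toFun := R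
      map_add' := fun x y => tendsto_nhds_unique (hR (x + y)) (by
        simp_rw [map_add]; exact (hR x).add (hR y))
      map_smul' := fun c x => tendsto_nhds_unique (hR (c • x)) (by
        simp_rw [map_smul]; exact ((smulc c).tendsto _).comp (hR x)) }
  have cL : Continuous L' := L'.continuous_of_seq_closed_graph fun u x y hu hy => by
    refine eq_of_mul_left fun z => ?_
    refine tendsto_nhds_unique (hy.const_mul z) ?_
    change Tendsto (fun n => z * L (u n)) atTop (𝓝 (z * L x))
    simp_rw [← central]
    exact hu.const_mul _
  have cR : Continuous R' := R'.continuous_of_seq_closed_graph fun u x y hu hy => by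
    rw [← star_inj]
    refine eq_of_mul_left fun z => ?_
    rw [← star_star z, ← star_mul, ← star_mul, star_inj]
    refine tendsto_nhds_unique (hy.mul_const _) ?_
    change Tendsto (fun n => R (u n) * star z) atTop (𝓝 (R x * star z))
    simp_rw [central]
    exact hu.mul_const _
  refine ⟨⟨(⟨L', cL⟩, ⟨R', cR⟩), central⟩, tendsto_strict_iff.2 ⟨hL, hR⟩⟩

end Multiplier

section Strict

variable {A B : Type*} [NonUnitalCStarAlgebra A] [PartialOrder A] [StarOrderedRing A]
  [NonUnitalCStarAlgebra B]

/-- A completely positive map `ρ : A → M(B)` is strict: it is continuous on bounded sets for the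
strict topologies on `A` (induced from `M(A)`) and on `M(B)`. -/
def IsStrict (ρ : A →CP 𝓜(ℂ, B)) : Prop :=
  ∀ r : ℝ, @ContinuousOn _ _ (TopologicalSpace.induced (DoubleCentralizer.coe ℂ) (strictTopology A))
    (strictTopology B) ρ {a | ‖a‖ ≤ r}

theorem IsStrict.tendsto {ρ : A →CP 𝓜(ℂ, B)} (hρ : IsStrict ρ) {ι : Type*} {l : Filter ι}
    {f : ι → A} {a : A} (r : ℝ) (hf : ∀ᶠ i in l, ‖f i‖ ≤ r) (ha : ‖a‖ ≤ r)
    (h₁ : ∀ x, Tendsto (fun i => f i * x) l (𝓝 (a * x)))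
    (h₂ : ∀ x, Tendsto (fun i => x * f i) l (𝓝 (x * a))) :
    Tendsto (fun i => ρ (f i)) l (@nhds _ (strictTopology B) (ρ a)) := by
  refine Tendsto.comp (y := @nhdsWithin A (TopologicalSpace.induced (DoubleCentralizer.coe ℂ)
    (strictTopology A)) a {a | ‖a‖ ≤ r}) (hρ r a ha) ?_
  refine tendsto_inf.2 ⟨?_, tendsto_principal.2 hf⟩
  rw [@nhds_induced _ _ (strictTopology A), tendsto_comap_iff]
  exact tendsto_strict_iff.2 ⟨h₁, h₂⟩

theorem tendsto_fst_approximateUnit (m : 𝓜(ℂ, A)) (x : A) :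
    Tendsto (fun e => m.fst e * x) (CStarAlgebra.approximateUnit A) (𝓝 (m.fst x)) := by
  simp_rw [← fst_mul]
  exact (m.fst.continuous.tendsto x).comp
    ((CStarAlgebra.increasingApproximateUnit A).tendsto_mul_right x)

theorem tendsto_snd_approximateUnit (m : 𝓜(ℂ, A)) (x : A) :
    Tendsto (fun e => x * m.fst e) (CStarAlgebra.approximateUnit A) (𝓝 (m.snd x)) := by
  simp_rw [← m.central]
  exact (CStarAlgebra.increasingApproximateUnit A).tendsto_mul_left _

theorem norm_fst_approximateUnit (m : 𝓜(ℂ, A)) :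
    ∀ᶠ e in CStarAlgebra.approximateUnit A, ‖m.fst e‖ ≤ ‖m‖ := by
  filter_upwards [(CStarAlgebra.increasingApproximateUnit A).eventually_norm] with e he
  calc ‖m.fst e‖ ≤ ‖m.fst‖ * ‖e‖ := m.fst.le_opNorm e
    _ ≤ ‖m.fst‖ * 1 := by gcongr
    _ = ‖m‖ := by rw [mul_one, DoubleCentralizer.norm_fst]

theorem IsStrict.exists_limit {ρ : A →CP 𝓜(ℂ, B)} (hρ : IsStrict ρ) (m : 𝓜(ℂ, A)) :
    ∃ n, Tendsto (fun e => ρ (m.fst e)) (CStarAlgebra.approximateUnit A)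
      (@nhds _ (strictTopology B) n) := by
  set l := CStarAlgebra.approximateUnit A
  have h0 := hρ.tendsto (l := l ×ˢ l) (f := fun p => m.fst p.2 - m.fst p.1) (a := 0) (‖m‖ + ‖m‖)
    (by
      filter_upwards [(norm_fst_approximateUnit m).prod_mk (norm_fst_approximateUnit m)] with p hp
      exact (norm_sub_le _ _).trans (add_le_add hp.2 hp.1))
    (by rw [norm_zero]; positivity)
    (fun x => by
      have := ((tendsto_fst_approximateUnit m x).comp tendsto_snd).sub
        ((tendsto_fst_approximateUnit m x).comp (tendsto_fst (f := l) (g := l)))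
      simpa [sub_mul, Function.comp_def] using this)
    (fun x => by
      have := ((tendsto_snd_approximateUnit m x).comp tendsto_snd).sub
        ((tendsto_snd_approximateUnit m x).comp (tendsto_fst (f := l) (g := l)))
      simpa [mul_sub, Function.comp_def] using this)
  rw [tendsto_strict_iff] at h0
  refine exists_strict_limit (fun b => ?_) (fun b => ?_)
  · refine CompleteSpace.complete (cauchy_map_iff.2 ⟨inferInstance, ?_⟩)
    rw [uniformity_eq_comap_nhds_zero, tendsto_comap_iff]
    simpa [Function.comp_def, map_sub, DoubleCentralizer.sub_fst, DoubleCentralizer.zero_fst]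
      using h0.1 b
  · refine CompleteSpace.complete (cauchy_map_iff.2 ⟨inferInstance, ?_⟩)
    rw [uniformity_eq_comap_nhds_zero, tendsto_comap_iff]
    simpa [Function.comp_def, map_sub, DoubleCentralizer.sub_snd, DoubleCentralizer.zero_snd]
      using h0.2 b

/-- A strict completely positive map `ρ : A → M(B)` has a linear extension to `M(A)` that is
strictly continuous on bounded sets. -/
theorem IsStrict.exists_extension {ρ : A →CP 𝓜(ℂ, B)} (hρ : IsStrict ρ) :
    ∃ f : 𝓜(ℂ, A) →ₗ[ℂ] 𝓜(ℂ, B),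
      (∀ a : A, f (DoubleCentralizer.coe ℂ a) = ρ a) ∧ StrictlyContinuousOnBounded f := by
  choose f hf using hρ.exists_limit
  let f' : 𝓜(ℂ, A) →ₗ[ℂ] 𝓜(ℂ, B) :=
    { toFun := f
      map_add' := fun x y => by
        refine strict_limit_unique (hf (x + y)) ?_
        rw [tendsto_strict_iff]
        have hx := tendsto_strict_iff.1 (hf x)
        have hy := tendsto_strict_iff.1 (hf y)
        refine ⟨fun a => ?_, fun a => ?_⟩
        · simpa [DoubleCentralizer.add_fst] using (hx.1 a).add (hy.1 a)
        · simpa [DoubleCentralizer.add_fst, DoubleCentralizer.add_snd]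
            using (hx.2 a).add (hy.2 a)
      map_smul' := fun c x => by
        refine strict_limit_unique (hf (c • x)) ?_
        rw [tendsto_strict_iff]
        have hx := tendsto_strict_iff.1 (hf x)
        have hc : Continuous fun b : B => c • b := continuous_const_smul c
        refine ⟨fun a => ?_, fun a => ?_⟩
        · simpa [DoubleCentralizer.smul_fst, Function.comp_def] using (hc.tendsto _).comp (hx.1 a)
        · simpa [DoubleCentralizer.smul_fst, DoubleCentralizer.smul_snd, Function.comp_def]
            using (hc.tendsto _).comp (hx.2 a) }
  refine ⟨f', fun a => ?_, ?_⟩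
  · refine strict_limit_unique (hf (DoubleCentralizer.coe ℂ a)) ?_
    exact hρ.tendsto ‖DoubleCentralizer.coe ℂ a‖ (norm_fst_approximateUnit _) (by
      refine le_of_tendsto ((CStarAlgebra.increasingApproximateUnit A).tendsto_mul_left a).norm ?_
      exact norm_fst_approximateUnit (DoubleCentralizer.coe ℂ a))
      (tendsto_fst_approximateUnit _) (tendsto_snd_approximateUnit _)
  · -- continuity at `0` first
    have key : ∀ (r : ℝ) (b : B) (ε : ℝ), 0 < ε →
        (∀ᶠ m in @nhdsWithin _ (strictTopology A) 0 {m | ‖m‖ ≤ r}, ‖(f m).fst b‖ ≤ ε) ∧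
        (∀ᶠ m in @nhdsWithin _ (strictTopology A) 0 {m | ‖m‖ ≤ r}, ‖(f m).snd b‖ ≤ ε) := by
      intro r b ε hε
      have aux : ∀ P : A → Prop, (∀ᶠ a in @nhdsWithin _ (TopologicalSpace.induced
          (DoubleCentralizer.coe ℂ) (strictTopology A)) 0 {a | ‖a‖ ≤ r}, P a) →
          ∀ᶠ m in @nhdsWithin _ (strictTopology A) 0 {m | ‖m‖ ≤ r},
            ∀ᶠ e in CStarAlgebra.approximateUnit A, P (m.fst e) := by
        intro P hP
        rw [@nhdsWithin.eq_1 _ (TopologicalSpace.induced _ _), eventually_inf_principal,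
          @nhds_induced _ _ (strictTopology A), eventually_comap] at hP
        rw [@nhdsWithin.eq_1 _ (strictTopology A), eventually_inf_principal]
        have h0 : DoubleCentralizer.coe ℂ (0 : A) = 0 := map_zero (DoubleCentralizer.coeHom (𝕜 := ℂ))
        rw [h0] at hP
        rw [@eventually_nhds_iff _ (strictTopology A)] at hP ⊢
        obtain ⟨V, hV, hVo, hV0⟩ := hP
        refine ⟨V, fun m hm hmr => ?_, hVo, hV0⟩
        have ht : Tendsto (fun e => DoubleCentralizer.coe ℂ (m.fst e))
            (CStarAlgebra.approximateUnit A) (@nhds _ (strictTopology A) m) :=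
          tendsto_strict_iff.2 ⟨tendsto_fst_approximateUnit m, tendsto_snd_approximateUnit m⟩
        filter_upwards [ht.eventually ((@eventually_nhds_iff _ (strictTopology A) m (· ∈ V)).2
            ⟨V, fun _ h => h, hVo, hm⟩),
          norm_fst_approximateUnit m] with e he he'
        exact hV _ he _ rfl (he'.trans hmr)
      have h0 : ρ 0 = 0 := map_zero ρ
      rcases lt_or_ge r 0 with hr | hr
      · have hem : {m : 𝓜(ℂ, A) | ‖m‖ ≤ r} = ∅ := by
          ext m
          simp only [Set.mem_ofPred_eq, Set.mem_empty_iff_false, iff_false, not_le]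
          exact hr.trans_le (norm_nonneg m)
        rw [hem, @nhdsWithin_empty]
        exact ⟨eventually_bot, eventually_bot⟩
      have hc := tendsto_strict_iff.1 (hρ r 0 (by simpa using hr))
      rw [h0] at hc
      constructor
      · have h1 := aux _ ((hc.1 b).eventually (Metric.closedBall_mem_nhds _ hε))
        filter_upwards [h1] with m hm
        refine le_of_tendsto ((tendsto_strict_iff.1 (hf m)).1 b).norm ?_
        filter_upwards [hm] with e he
        simpa [DoubleCentralizer.zero_fst] using he
      · have h1 := aux _ ((hc.2 b).eventually (Metric.closedBall_mem_nhds _ hε))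
        filter_upwards [h1] with m hm
        refine le_of_tendsto ((tendsto_strict_iff.1 (hf m)).2 b).norm ?_
        filter_upwards [hm] with e he
        simpa [DoubleCentralizer.zero_snd] using he
    intro r m₀ hm₀
    have hsub : Tendsto (fun m => m - m₀) (@nhdsWithin _ (strictTopology A) m₀ {m | ‖m‖ ≤ r})
        (@nhdsWithin _ (strictTopology A) 0 {m | ‖m‖ ≤ r + r}) := by
      refine tendsto_inf.2 ⟨?_, tendsto_principal.2 ?_⟩
      · have hid : Tendsto id (@nhdsWithin _ (strictTopology A) m₀ {m | ‖m‖ ≤ r})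
            (@nhds _ (strictTopology A) m₀) := tendsto_id.mono_left inf_le_left
        rw [tendsto_strict_iff] at hid ⊢
        refine ⟨fun a => ?_, fun a => ?_⟩
        · simpa [DoubleCentralizer.sub_fst, DoubleCentralizer.zero_fst]
            using (hid.1 a).sub_const (m₀.fst a)
        · simpa [DoubleCentralizer.sub_snd, DoubleCentralizer.zero_snd]
            using (hid.2 a).sub_const (m₀.snd a)
      · filter_upwards [@self_mem_nhdsWithin _ (strictTopology A) m₀ {m | ‖m‖ ≤ r}] with m hm
        exact (norm_sub_le _ _).trans (add_le_add hm hm₀)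
    have hlin : ∀ m, f (m - m₀) = f m - f m₀ := fun m => map_sub f' m m₀
    change Tendsto f _ _
    rw [tendsto_strict_iff]
    refine ⟨fun b => ?_, fun b => ?_⟩
    · rw [Metric.tendsto_nhds]
      intro ε hε
      filter_upwards [hsub.eventually (key (r + r) b (ε / 2) (half_pos hε)).1] with m hm
      rw [dist_eq_norm]
      rw [hlin, DoubleCentralizer.sub_fst] at hm
      exact lt_of_le_of_lt hm (half_lt_self hε)
    · rw [Metric.tendsto_nhds]
      intro ε hε
      filter_upwards [hsub.eventually (key (r + r) b (ε / 2) (half_pos hε)).2] with m hm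
      rw [dist_eq_norm]
      rw [hlin, DoubleCentralizer.sub_snd] at hm
      exact lt_of_le_of_lt hm (half_lt_self hε)

/-- The extension of a strict completely positive map `ρ : A → M(B)` to `M(A)`: the (unique)
linear map extending `ρ` that is strictly continuous on bounded sets. -/
noncomputable def IsStrict.extend {ρ : A →CP 𝓜(ℂ, B)} (hρ : IsStrict ρ) :
    𝓜(ℂ, A) →ₗ[ℂ] 𝓜(ℂ, B) := hρ.exists_extension.choose

theorem IsStrict.extend_coe {ρ : A →CP 𝓜(ℂ, B)} (hρ : IsStrict ρ) (a : A) :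
    hρ.extend (DoubleCentralizer.coe ℂ a) = ρ a := hρ.exists_extension.choose_spec.1 a

theorem IsStrict.extend_continuous {ρ : A →CP 𝓜(ℂ, B)} (hρ : IsStrict ρ) :
    StrictlyContinuousOnBounded hρ.extend := hρ.exists_extension.choose_spec.2

end Strict

/-! ### Order and positivity of completely positive maps -/

section Order

variable {A₁ A₂ : Type*} [NonUnitalCStarAlgebra A₁] [PartialOrder A₁] [StarOrderedRing A₁]
  [NonUnitalCStarAlgebra A₂] [PartialOrder A₂] [StarOrderedRing A₂]

/-- The order on completely positive maps: `ρ₁ ≤ ρ₂` if and only if `ρ₂ - ρ₁` is completely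
positive. -/
instance cpPreorder : Preorder (A₁ →CP A₂) where
  le ρ₁ ρ₂ := ∃ η : A₁ →CP A₂, ∀ a, ρ₂ a = ρ₁ a + η a
  le_refl ρ := by
    refine ⟨⟨0, fun k M _ => ?_⟩, fun a => (add_zero _).symm⟩
    have : M.map (0 : A₁ →ₗ[ℂ] A₂) = 0 := by
      ext i j; rfl
    rw [this]
  le_trans ρ₁ ρ₂ ρ₃ := by
    rintro ⟨η, hη⟩ ⟨ξ, hξ⟩
    refine ⟨⟨η.toLinearMap + ξ.toLinearMap, fun k M hM => ?_⟩, fun a => ?_⟩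
    · have : M.map (η.toLinearMap + ξ.toLinearMap : A₁ →ₗ[ℂ] A₂)
          = M.map η.toLinearMap + M.map ξ.toLinearMap := by
        ext i j; rfl
      rw [this]
      exact add_nonneg (η.map_cstarMatrix_nonneg' k M hM) (ξ.map_cstarMatrix_nonneg' k M hM)
    · rw [hξ, hη, add_assoc]; rfl

theorem cp_le_iff {ρ₁ ρ₂ : A₁ →CP A₂} : ρ₁ ≤ ρ₂ ↔ ∃ η : A₁ →CP A₂, ∀ a, ρ₂ a = ρ₁ a + η a :=
  Iff.rfl

end Order

section Positivity

variable {A B : Type*} [NonUnitalCStarAlgebra A] [PartialOrder A] [StarOrderedRing A]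
  [NonUnitalCStarAlgebra B] [PartialOrder B] [StarOrderedRing B]

theorem multiplier_sum_fst {ι : Type*} (s : Finset ι) (g : ι → 𝓜(ℂ, B)) (x : B) :
    (∑ k ∈ s, g k).fst x = ∑ k ∈ s, (g k).fst x := by
  induction s using Finset.cons_induction with
  | empty => rfl
  | cons a s ha ih =>
    rw [Finset.sum_cons, Finset.sum_cons, DoubleCentralizer.add_fst,
      add_apply, ih]

theorem star_mul_fst_star_mul (m m' : 𝓜(ℂ, A)) (x y : A) :
    star x * (star m * m').fst y = star (m.fst x) * m'.fst y := by
  change star x * star (m.snd (star (m'.fst y))) = star (m.fst x) * m'.fst y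
  rw [← star_mul, m.central, star_mul, star_star]

theorem cp_sum_nonneg (ρ : A →CP 𝓜(ℂ, B)) {n : ℕ} (a : Fin n → A) (b : Fin n → B) :
    0 ≤ ∑ i, ∑ j, star (b i) * (ρ (star (a i) * a j)).fst (b j) := by
  rcases n with _ | n
  · simp
  let V : CStarMatrix (Fin (n + 1)) (Fin (n + 1)) A := fun i j => if i = 0 then a j else 0
  have hM : star V * V = (CStarMatrix.ofMatrix fun i j => star (a i) * a j) := by
    ext i j
    rw [CStarMatrix.mul_apply]
    rw [Finset.sum_eq_single 0]
    · rw [CStarMatrix.star_apply]; simp only [V, if_true]; rfl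
    · intro k _ hk; rw [CStarMatrix.star_apply]; simp [V, hk]
    · simp
  have h := ρ.map_cstarMatrix_nonneg' (n + 1) (star V * V)
    (star_mul_self_nonneg V)
  have hmain : ∀ M : CStarMatrix (Fin (n + 1)) (Fin (n + 1)) 𝓜(ℂ, B), 0 ≤ M →
      0 ≤ ∑ i, ∑ j, star (b i) * (M i j).fst (b j) := by
    intro M hM0
    rw [StarOrderedRing.nonneg_iff] at hM0
    induction hM0 using AddSubmonoid.closure_induction with
    | mem M hM1 =>
      obtain ⟨Q, rfl⟩ := hM1
      have hQij : ∀ i j, (star Q * Q) i j = ∑ k, star (Q k i) * Q k j := fun i j => by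
        simp only [CStarMatrix.mul_apply, CStarMatrix.star_apply]
      have e : ∑ i, ∑ j, star (b i) * ((star Q * Q) i j).fst (b j) =
          ∑ k, star (∑ i, (Q k i).fst (b i)) * ∑ j, (Q k j).fst (b j) := by
        simp_rw [hQij, multiplier_sum_fst, Finset.mul_sum, star_mul_fst_star_mul, star_sum,
          Finset.sum_mul]
        calc _ = ∑ i, ∑ k, ∑ j, star ((Q k i).fst (b i)) * (Q k j).fst (b j) :=
              Finset.sum_congr rfl fun i _ => Finset.sum_comm
          _ = ∑ k, ∑ i, ∑ j, star ((Q k i).fst (b i)) * (Q k j).fst (b j) := Finset.sum_comm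
          _ = _ := Finset.sum_congr rfl fun k _ => Finset.sum_comm
      rw [e]
      exact Finset.sum_nonneg fun k _ => star_mul_self_nonneg _
    | zero =>
      refine le_of_eq (Finset.sum_eq_zero fun i _ => Finset.sum_eq_zero fun j _ => ?_).symm
      exact mul_zero (star (b i))
    | add M M' _ _ h1 h2 =>
      refine (add_nonneg h1 h2).trans (le_of_eq ?_)
      rw [← Finset.sum_add_distrib]
      refine Finset.sum_congr rfl fun i _ => ?_
      rw [← Finset.sum_add_distrib]
      exact Finset.sum_congr rfl fun j _ => (mul_add (star (b i)) _ _).symm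
  rw [hM] at h
  exact hmain _ h

theorem tendsto_approximateUnit_mul {y : A} {f : A → A}
    (hf : Tendsto f (CStarAlgebra.approximateUnit A) (𝓝 y)) :
    Tendsto (fun e => star e * f e) (CStarAlgebra.approximateUnit A) (𝓝 y) := by
  have hl := CStarAlgebra.increasingApproximateUnit A
  have h1 : Tendsto (fun e => e * (f e - y) + e * y) (CStarAlgebra.approximateUnit A)
      (𝓝 (0 + y)) := by
    refine Tendsto.add ?_ (hl.tendsto_mul_right y)
    refine squeeze_zero_norm' (a := fun e => ‖f e - y‖) ?_ (tendsto_iff_norm_sub_tendsto_zero.1 hf)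
    filter_upwards [hl.eventually_norm] with e he
    calc ‖e * (f e - y)‖ ≤ ‖e‖ * ‖f e - y‖ := norm_mul_le _ _
      _ ≤ 1 * ‖f e - y‖ := by gcongr
      _ = _ := one_mul _
  rw [zero_add] at h1
  refine h1.congr' ?_
  filter_upwards [hl.eventually_star_eq] with e he
  rw [he, mul_sub, sub_add_cancel]

theorem tendsto_mul_approximateUnit {y : A} {f : A → A}
    (hf : Tendsto f (CStarAlgebra.approximateUnit A) (𝓝 y)) :
    Tendsto (fun e => f e * e) (CStarAlgebra.approximateUnit A) (𝓝 y) := by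
  have := (tendsto_approximateUnit_mul hf.star).star
  simpa using this

theorem tendsto_extend_sum {f : 𝓜(ℂ, A) →ₗ[ℂ] 𝓜(ℂ, B)} (hf : StrictlyContinuousOnBounded f)
    {n : ℕ} (m : Fin n → 𝓜(ℂ, A)) (b : Fin n → B) :
    Tendsto (fun e : A => ∑ i, ∑ j, star (b i) *
      (f (DoubleCentralizer.coe ℂ (star ((m i).fst e) * (m j).fst e))).fst (b j))
      (CStarAlgebra.approximateUnit A)
      (𝓝 (∑ i, ∑ j, star (b i) * (f (star (m i) * m j)).fst (b j))) := by
  refine tendsto_finsetSum _ fun i _ => tendsto_finsetSum _ fun j _ => ?_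
  refine Tendsto.const_mul _ ?_
  set l := CStarAlgebra.approximateUnit A
  have hl := CStarAlgebra.increasingApproximateUnit A
  have hstar : ∀ᶠ e in l, star e = e := hl.eventually_star_eq
  have hle : ∀ᶠ e in l, ‖e‖ ≤ 1 := hl.eventually_norm
  have hr0 : ‖star (m i) * m j‖ ≤ ‖m i‖ * ‖m j‖ :=
    (norm_mul_le _ _).trans (by rw [norm_star])
  have key : ∀ e, star ((m i).fst e) * (m j).fst e = star e * (star (m i) * m j).fst e :=
    fun e => (star_mul_fst_star_mul _ _ _ _).symm
  have hT : Tendsto (fun e => DoubleCentralizer.coe ℂ (star ((m i).fst e) * (m j).fst e)) l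
      (@nhdsWithin _ (strictTopology A) (star (m i) * m j) {x | ‖x‖ ≤ ‖m i‖ * ‖m j‖}) := by
    refine tendsto_inf.2 ⟨tendsto_strict_iff.2 ⟨fun x => ?_, fun x => ?_⟩,
      tendsto_principal.2 ?_⟩
    · change Tendsto (fun e => star ((m i).fst e) * (m j).fst e * x) l _
      simp_rw [key, mul_assoc]
      exact tendsto_approximateUnit_mul (tendsto_fst_approximateUnit _ x)
    · change Tendsto (fun e => x * (star ((m i).fst e) * (m j).fst e)) l _
      simp_rw [key]
      have h1 : Tendsto (fun e => (star (m i) * m j).snd (x * star e) * e) l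
          (𝓝 ((star (m i) * m j).snd x)) := by
        refine tendsto_mul_approximateUnit ?_
        have h2 : Tendsto (fun e => x * star e) l (𝓝 x) := by
          refine (hl.tendsto_mul_left x).congr' ?_
          filter_upwards [hstar] with e he
          rw [he]
        exact ((star (m i) * m j).snd.continuous.tendsto x).comp h2
      simpa only [DoubleCentralizer.central, mul_assoc] using h1
    · filter_upwards [norm_fst_approximateUnit (m i), norm_fst_approximateUnit (m j)] with e h1 h2
      calc ‖DoubleCentralizer.coe ℂ (star ((m i).fst e) * (m j).fst e)‖
          ≤ ‖star ((m i).fst e) * (m j).fst e‖ := by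
            rw [← DoubleCentralizer.norm_fst]
            exact ContinuousLinearMap.opNorm_mul_apply_le ℂ A _
        _ ≤ ‖star ((m i).fst e)‖ * ‖(m j).fst e‖ := norm_mul_le _ _
        _ ≤ ‖m i‖ * ‖m j‖ := by rw [norm_star]; gcongr
  exact (tendsto_strict_iff.1 (Tendsto.comp (hf _ _ hr0) hT)).1 (b j)

end Positivity

/-! ### Limits of monotone nets of positive sesquilinear forms -/

section MonotoneForms

variable {B G V : Type*} [NonUnitalCStarAlgebra B] [PartialOrder B] [StarOrderedRing B]
  [Preorder G] [AddCommGroup V] [Module ℂ V]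

theorem form_add_smul (s : V →ₗ⋆[ℂ] V →ₗ[ℂ] B) (c : ℂ) (x y : V) :
    s (x + c • y) (x + c • y) =
      s x x + c • s x y + (starRingEnd ℂ c) • s y x + (starRingEnd ℂ c * c) • s y y := by
  have h : s (c • y) = (starRingEnd ℂ c) • s y := LinearMap.map_smulₛₗ s c y
  rw [map_add s, h, map_add, LinearMap.add_apply, LinearMap.add_apply, map_smul,
    LinearMap.smul_apply, LinearMap.smul_apply, map_smul]
  module

theorem form_star_of_nonneg {s : V →ₗ⋆[ℂ] V →ₗ[ℂ] B} (hs : ∀ x, 0 ≤ s x x) (x y : V) :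
    star (s x y) = s y x := by
  have hsa : ∀ z, star (s z z) = s z z := fun z => (IsSelfAdjoint.of_nonneg (hs z)).star_eq
  have e1 : star (s x y) + star (s y x) = s x y + s y x := by
    have h1 := hsa (x + y)
    simp only [map_add, LinearMap.add_apply, star_add, hsa x, hsa y] at h1
    linear_combination (norm := module) h1
  have e2 : star (s x y) - star (s y x) = s y x - s x y := by
    have h2 := hsa (x + Complex.I • y)
    rw [form_add_smul, Complex.conj_I, neg_mul, Complex.I_mul_I, neg_neg, one_smul, neg_smul] at h2
    simp only [star_add, star_neg, star_smul, hsa x, hsa y, RCLike.star_def, Complex.conj_I,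
      neg_smul] at h2
    have h3 : Complex.I • (star (s x y) - star (s y x)) = Complex.I • (s y x - s x y) := by
      linear_combination (norm := module) -h2
    exact smul_right_injective _ Complex.I_ne_zero h3
  linear_combination (norm := module) (1 / 2 : ℂ) • e1 + (1 / 2 : ℂ) • e2

theorem exists_tendsto_add {s : G → V →ₗ⋆[ℂ] V →ₗ[ℂ] B}
    (hm : ∀ ρ ρ', ρ ≤ ρ' → ∀ x, s ρ x x ≤ s ρ' x x) {x y : V}
    (hx : ∃ z, Tendsto (fun ρ => s ρ x x) atTop (𝓝 z))
    (hy : ∃ z, Tendsto (fun ρ => s ρ y y) atTop (𝓝 z)) :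
    ∃ z, Tendsto (fun ρ => s ρ (x + y) (x + y)) atTop (𝓝 z) := by
  rcases (atTop : Filter G).eq_or_neBot with hG | hG
  · exact ⟨0, by rw [hG]; exact tendsto_bot⟩
  have hdir : IsDirectedOrder G := ⟨fun a b =>
    ((eventually_ge_atTop a).and (eventually_ge_atTop b)).exists⟩
  have hne : Nonempty G := nonempty_of_neBot (atTop : Filter G)
  obtain ⟨p, hp⟩ := hx
  obtain ⟨q, hq⟩ := hy
  refine CompleteSpace.complete (Metric.cauchy_iff.2 ⟨inferInstance, fun ε hε => ?_⟩)
  have hpq := (hp.add hq).eventually (Metric.ball_mem_nhds _ (show 0 < ε / 10 by positivity))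
  obtain ⟨ρ₀, hρ₀⟩ := eventually_atTop.1 hpq
  have hinc : ∀ ρ, ρ₀ ≤ ρ → ‖s ρ (x + y) (x + y) - s ρ₀ (x + y) (x + y)‖ ≤ 2 * (2 * (ε / 10)) := by
    intro ρ hρ
    have h1 : s ρ (x + y) (x + y) - s ρ₀ (x + y) (x + y) ≤
        (2 : ℝ) • ((s ρ x x + s ρ y y) - (s ρ₀ x x + s ρ₀ y y)) := by
      have h2 : 0 ≤ s ρ (x - y) (x - y) - s ρ₀ (x - y) (x - y) := sub_nonneg.2 (hm _ _ hρ _)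
      refine (le_add_of_nonneg_right h2).trans (le_of_eq ?_)
      rw [two_smul]
      simp only [map_add, map_sub, LinearMap.add_apply, LinearMap.sub_apply]
      abel
    calc _ ≤ ‖(2 : ℝ) • ((s ρ x x + s ρ y y) - (s ρ₀ x x + s ρ₀ y y))‖ :=
          CStarAlgebra.norm_le_norm_of_nonneg_of_le (sub_nonneg.2 (hm _ _ hρ _)) h1
      _ = 2 * dist (s ρ x x + s ρ y y) (s ρ₀ x x + s ρ₀ y y) := by
          rw [norm_smul, dist_eq_norm]; norm_num
      _ ≤ 2 * (ε / 10 + ε / 10) := by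
          gcongr
          exact (dist_triangle_right _ _ (p + q)).trans
            (add_le_add (le_of_lt (hρ₀ ρ hρ)) (le_of_lt (hρ₀ ρ₀ le_rfl)))
      _ = _ := by ring
  refine ⟨_, image_mem_map (Ici_mem_atTop ρ₀), ?_⟩
  rintro _ ⟨ρ, hρ, rfl⟩ _ ⟨ρ', hρ', rfl⟩
  have h3 := hinc ρ hρ
  have h4 := hinc ρ' hρ'
  rw [← dist_eq_norm] at h3 h4
  exact (dist_triangle_right _ _ _).trans_lt (by linarith)

theorem exists_tendsto_smul {s : G → V →ₗ⋆[ℂ] V →ₗ[ℂ] B} {x : V} (c : ℂ)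
    (hx : ∃ z, Tendsto (fun ρ => s ρ x x) atTop (𝓝 z)) :
    ∃ z, Tendsto (fun ρ => s ρ (c • x) (c • x)) atTop (𝓝 z) := by
  obtain ⟨p, hp⟩ := hx
  refine ⟨star c • c • p, ?_⟩
  have hc : Continuous fun b : B => star c • c • b :=
    (continuous_const_smul _).comp (continuous_const_smul _)
  refine ((hc.tendsto p).comp hp).congr fun ρ => ?_
  have h : s ρ (c • x) = (starRingEnd ℂ c) • s ρ x := LinearMap.map_smulₛₗ (s ρ) c x
  rw [h, LinearMap.smul_apply, map_smul]
  rfl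

theorem exists_tendsto_polar {s : G → V →ₗ⋆[ℂ] V →ₗ[ℂ] B}
    (hm : ∀ ρ ρ', ρ ≤ ρ' → ∀ x, s ρ x x ≤ s ρ' x x) {x y : V}
    (hx : ∃ z, Tendsto (fun ρ => s ρ x x) atTop (𝓝 z))
    (hy : ∃ z, Tendsto (fun ρ => s ρ y y) atTop (𝓝 z)) :
    ∃ z, Tendsto (fun ρ => s ρ x y) atTop (𝓝 z) := by
  have key : ∀ c : ℂ, ∃ z, Tendsto (fun ρ => s ρ (x + c • y) (x + c • y)) atTop (𝓝 z) :=
    fun c => exists_tendsto_add hm hx (exists_tendsto_smul c hy)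
  obtain ⟨z₁, h₁⟩ := key 1
  obtain ⟨z₂, h₂⟩ := key (-1)
  obtain ⟨z₃, h₃⟩ := key Complex.I
  obtain ⟨z₄, h₄⟩ := key (-Complex.I)
  have hc : ∀ c : ℂ, Continuous fun b : B => c • b := fun c => continuous_const_smul c
  have h5 := (((hc (1 / 4)).tendsto _).comp (h₁.sub h₂)).sub
    (((hc (Complex.I / 4)).tendsto _).comp (h₃.sub h₄))
  refine ⟨_, h5.congr fun ρ => ?_⟩
  simp only [Function.comp_apply, form_add_smul]
  generalize s ρ x x = p, s ρ x y = q, s ρ y x = r, s ρ y y = t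
  have h : ∀ w : B, (Complex.I / 4) • (Complex.I • w) = (-1 / 4 : ℂ) • w := fun w => by
    rw [smul_smul, div_mul_eq_mul_div, Complex.I_mul_I]
  have h1 : (starRingEnd ℂ) (-1) = -1 := by simp
  have h2 : (starRingEnd ℂ) (-Complex.I) = Complex.I := by simp
  simp only [h1, h2, map_one, Complex.conj_I, neg_mul, mul_neg, Complex.I_mul_I, neg_neg,
    mul_one, one_smul, neg_smul]
  simp only [smul_add, smul_sub, smul_neg, h]
  module

theorem exists_limit_form {F : Type*} [AddCommMonoid F] [Module ℂ F]
    {s : G → V →ₗ⋆[ℂ] V →ₗ[ℂ] B}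
    (hm : ∀ ρ ρ', ρ ≤ ρ' → ∀ x, s ρ x x ≤ s ρ' x x) (j : F →ₗ[ℂ] V)
    (hj : ∀ x, ∃ z, Tendsto (fun ρ => s ρ (j x) (j x)) atTop (𝓝 z)) :
    ∃ t : F →ₗ⋆[ℂ] F →ₗ[ℂ] B,
      (∀ x y, Tendsto (fun ρ => s ρ (j x) (j y)) atTop (𝓝 (t x y))) ∧
      (¬ (atTop : Filter G).NeBot → t = 0) := by
  by_cases hG : (atTop : Filter G).NeBot
  · have hlim := fun x y => exists_tendsto_polar hm (hj x) (hj y)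
    choose t ht using hlim
    have hc : ∀ c : ℂ, Continuous fun b : B => c • b := fun c => continuous_const_smul c
    refine ⟨LinearMap.mk₂'ₛₗ (starRingEnd ℂ) (RingHom.id ℂ) t ?_ ?_ ?_ ?_, ht,
      fun h => absurd hG h⟩
    · intro x x' y
      refine tendsto_nhds_unique (ht _ _) (((ht x y).add (ht x' y)).congr fun ρ => ?_)
      simp
    · intro c x y
      refine tendsto_nhds_unique (ht _ _) ((((hc _).tendsto _).comp (ht x y)).congr fun ρ => ?_)
      simp [LinearMap.map_smulₛₗ]
    · intro x y y'
      refine tendsto_nhds_unique (ht _ _) (((ht x y).add (ht x y')).congr fun ρ => ?_)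
      simp
    · intro c x y
      refine tendsto_nhds_unique (ht _ _) ((((hc _).tendsto _).comp (ht x y)).congr fun ρ => ?_)
      simp
  · refine ⟨0, fun x y => ?_, fun _ => rfl⟩
    rw [not_neBot.1 hG]
    exact tendsto_bot

end MonotoneForms

/-! ### The sesquilinear forms attached to strict completely positive maps -/

section CPForm

variable {A B : Type*} [NonUnitalCStarAlgebra A] [PartialOrder A] [StarOrderedRing A]
  [NonUnitalCStarAlgebra B] [PartialOrder B] [StarOrderedRing B]

/-- For a linear map `f : M(A) → M(B)`, the sesquilinear form on `M(A) ⊙ B` with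
`(a₂ ⊗ b₂, a₁ ⊗ b₁) ↦ b₂* f(a₂* a₁) b₁` (conjugate-linear in the first variable). -/
noncomputable def tensorForm (f : 𝓜(ℂ, A) →ₗ[ℂ] 𝓜(ℂ, B)) :
    (𝓜(ℂ, A) ⊗[ℂ] B) →ₗ⋆[ℂ] (𝓜(ℂ, A) ⊗[ℂ] B) →ₗ[ℂ] B :=
  TensorProduct.lift <| LinearMap.mk₂'ₛₗ (starRingEnd ℂ) (starRingEnd ℂ)
    (fun a₂ b₂ => TensorProduct.lift <| LinearMap.mk₂ ℂ
      (fun a₁ b₁ => star b₂ * (f (star a₂ * a₁)).fst b₁)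
      (fun a a' b => by
        rw [mul_add, map_add, DoubleCentralizer.add_fst, add_apply, mul_add])
      (fun c a b => by
        rw [mul_smul_comm, map_smul, DoubleCentralizer.smul_fst, smul_apply,
          mul_smul_comm])
      (fun a b b' => by rw [map_add, mul_add])
      (fun c a b => by rw [map_smul, mul_smul_comm]))
    (fun a a' b => by
      ext a₁ b₁
      simp [add_mul, mul_add])
    (fun c a b => by
      ext a₁ b₁
      simp [star_smul, smul_mul_assoc, mul_smul_comm])
    (fun a b b' => by
      ext a₁ b₁
      simp [add_mul])
    (fun c a b => by
      ext a₁ b₁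
      simp [star_smul, smul_mul_assoc])

theorem tensorForm_tmul (f : 𝓜(ℂ, A) →ₗ[ℂ] 𝓜(ℂ, B)) (a₁ a₂ : 𝓜(ℂ, A)) (b₁ b₂ : B) :
    tensorForm f (a₂ ⊗ₜ b₂) (a₁ ⊗ₜ b₁) = star b₂ * (f (star a₂ * a₁)).fst b₁ := rfl

theorem tensorForm_sum (f : 𝓜(ℂ, A) →ₗ[ℂ] 𝓜(ℂ, B)) {n : ℕ} (m : Fin n → 𝓜(ℂ, A))
    (b : Fin n → B) :
    tensorForm f (∑ i, m i ⊗ₜ b i) (∑ j, m j ⊗ₜ b j) =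
      ∑ i, ∑ j, star (b i) * (f (star (m i) * m j)).fst (b j) := by
  simp only [map_sum, LinearMap.sum_apply, tensorForm_tmul]
  exact Finset.sum_comm

theorem tensorForm_nonneg {ρ : A →CP 𝓜(ℂ, B)} (hρ : IsStrict ρ) (x : 𝓜(ℂ, A) ⊗[ℂ] B) :
    0 ≤ tensorForm hρ.extend x x := by
  obtain ⟨n, m, b, rfl⟩ := TensorProduct.exists_sum_tmul_eq x
  rw [tensorForm_sum]
  refine ge_of_tendsto' (tendsto_extend_sum hρ.extend_continuous m b) fun e => ?_
  simp only [hρ.extend_coe]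
  exact cp_sum_nonneg ρ _ _

theorem tensorForm_mono {ρ ρ' : A →CP 𝓜(ℂ, B)} (hρ : IsStrict ρ) (hρ' : IsStrict ρ')
    (h : ρ ≤ ρ') (x : 𝓜(ℂ, A) ⊗[ℂ] B) :
    tensorForm hρ.extend x x ≤ tensorForm hρ'.extend x x := by
  obtain ⟨η, hη⟩ := cp_le_iff.1 h
  obtain ⟨n, m, b, rfl⟩ := TensorProduct.exists_sum_tmul_eq x
  rw [tensorForm_sum, tensorForm_sum]
  refine le_of_tendsto_of_tendsto' (tendsto_extend_sum hρ.extend_continuous m b)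
    (tendsto_extend_sum hρ'.extend_continuous m b) fun e => ?_
  simp only [hρ.extend_coe, hρ'.extend_coe, hη, DoubleCentralizer.add_fst, add_apply, mul_add,
    Finset.sum_add_distrib]
  exact le_add_of_nonneg_right (cp_sum_nonneg η _ _)

end CPForm

/-! ### Hilbert C⋆-modules over `B`

A (right) Hilbert C⋆-module over `B` is a module over `Bᵐᵒᵖ`, with `op b • v` for the product `v b`.
Mathlib's inner product `inner Bᵐᵒᵖ w v` is linear in `v` and satisfies
`inner Bᵐᵒᵖ w (op b • v) = op b * inner Bᵐᵒᵖ w v`. -/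

section Module

variable {B E F : Type*} [NonUnitalCStarAlgebra B] [PartialOrder B] [StarOrderedRing B]
  [NormedAddCommGroup E] [NormedSpace ℂ E] [SMul Bᵐᵒᵖ E] [CStarModule Bᵐᵒᵖ E]
  [NormedAddCommGroup F] [NormedSpace ℂ F] [SMul Bᵐᵒᵖ F] [CStarModule Bᵐᵒᵖ F]

variable (B) in
/-- The `B`-valued inner product `⟨v, w⟩` of a right Hilbert C⋆-module over `B`: it is linear in `v`
and `⟨v b, w⟩ = ⟨v, w⟩ b`. -/
def rinner (v w : E) : B := unop (inner Bᵐᵒᵖ w v)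

theorem rinner_op_smul (b : B) (v w : E) : rinner B (op b • v) w = rinner B v w * b := by
  rw [rinner, CStarModule.inner_op_smul_right]; rfl

variable (B) in
/-- `T` is adjointable, i.e. `T ∈ 𝓛(E, F)`. -/
def IsAdjointable (T : E → F) : Prop := ∃ T' : F → E, ∀ v w, rinner B (T v) w = rinner B v (T' w)

variable (B) in
/-- `T` is a positive element of the C⋆-algebra `𝓛(E)` of adjointable operators on `E`. -/
def IsPositiveOperator (T : E → E) : Prop := IsAdjointable B T ∧ ∀ v, 0 ≤ rinner B (T v) v

variable (B) in
/-- `U` is a unitary transformation from `E` to `F`: it is adjointable with `U* U = 1` and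
`U U* = 1`. -/
def IsUnitary (U : E → F) : Prop :=
  ∃ V : F → E, (∀ v w, rinner B (U v) w = rinner B v (V w)) ∧ (∀ v, V (U v) = v) ∧ ∀ w, U (V w) = w

end Module

/-! ### The families of completely positive maps attached to `Λ` -/

section Families

variable {A B E : Type*} [NonUnitalCStarAlgebra A] [PartialOrder A] [StarOrderedRing A]
  [NonUnitalCStarAlgebra B] [PartialOrder B] [StarOrderedRing B]
  [NormedAddCommGroup E] [NormedSpace ℂ E] [SMul Bᵐᵒᵖ E] [CStarModule Bᵐᵒᵖ E]
  {N : Submodule ℂ A}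

/-- The relation `b₂* ρ(a₂* a₁) b₁ = ⟨T Λ(a₁) b₁, Λ(a₂) b₂⟩` for `a₁, a₂ ∈ N` and `b₁, b₂ ∈ B`
between `ρ` and `T`. It determines `T` if the elements `Λ(a) b` span a dense subspace; then
`T = T_ρ`. -/
def Implements (Λ : N →ₗ[ℂ] B →ₗ[ℂ] E) (ρ : A →CP 𝓜(ℂ, B)) (T : E →L[ℂ] E) : Prop :=
  ∀ (a₁ a₂ : N) (b₁ b₂ : B),
    star b₂ * (ρ (star (a₂ : A) * a₁)).fst b₁ = rinner B (T (Λ a₁ b₁)) (Λ a₂ b₂)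

/-- The set `𝓗` of strict completely positive maps `ρ : A → M(B)` that are implemented by a
positive element `T` of `𝓛(E)`. -/
def setH (Λ : N →ₗ[ℂ] B →ₗ[ℂ] E) : Set (A →CP 𝓜(ℂ, B)) :=
  {ρ | IsStrict ρ ∧ ∃ T : E →L[ℂ] E, IsPositiveOperator B T ∧ Implements Λ ρ T}

/-- The set `𝓕` of all `ρ ∈ 𝓗` with `T_ρ ≤ 1`. -/
def setF (Λ : N →ₗ[ℂ] B →ₗ[ℂ] E) : Set (A →CP 𝓜(ℂ, B)) :=
  {ρ | IsStrict ρ ∧ ∃ T : E →L[ℂ] E, IsPositiveOperator B T ∧ Implements Λ ρ T ∧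
    ∀ v, rinner B (T v) v ≤ rinner B v v}

/-- The set `𝓖 = {t ρ | t ∈ [0, 1), ρ ∈ 𝓕}`. -/
def setG (Λ : N →ₗ[ℂ] B →ₗ[ℂ] E) : Set (A →CP 𝓜(ℂ, B)) :=
  {ρ | ∃ t : ℝ, 0 ≤ t ∧ t < 1 ∧ ∃ ρ' ∈ setF Λ, ∀ a, ρ a = (t : ℂ) • ρ' a}

theorem setF_subset_setH (Λ : N →ₗ[ℂ] B →ₗ[ℂ] E) : setF Λ ⊆ setH Λ :=
  fun _ ⟨h, T, hT, hi, _⟩ => ⟨h, T, hT, hi⟩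

theorem isStrict_of_mem_setG {Λ : N →ₗ[ℂ] B →ₗ[ℂ] E} {ρ : A →CP 𝓜(ℂ, B)} (hρ : ρ ∈ setG Λ) :
    IsStrict ρ := by
  obtain ⟨t, -, -, ρ', ⟨h, -⟩, e⟩ := hρ
  intro r a ha
  have h1 := tendsto_strict_iff.1 (h r a ha)
  have hc : Continuous fun b : B => (t : ℂ) • b := continuous_const_smul _
  change Tendsto ρ _ _
  rw [tendsto_strict_iff]
  simp only [e, DoubleCentralizer.smul_fst, DoubleCentralizer.smul_snd, smul_apply]
  exact ⟨fun b => (hc.tendsto _).comp (h1.1 b), fun b => (hc.tendsto _).comp (h1.2 b)⟩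

/-- The extension of `ρ ∈ 𝓖` to `M(A)`. -/
noncomputable def extendG {Λ : N →ₗ[ℂ] B →ₗ[ℂ] E} (ρ : setG Λ) : 𝓜(ℂ, A) →ₗ[ℂ] 𝓜(ℂ, B) :=
  (isStrict_of_mem_setG ρ.2).extend

/-- The set `𝓟` of all `a ∈ M(A)⁺` such that the net `(d* ρ(a) d)`, indexed by `ρ ∈ 𝓖`, converges in
`B` for every `d ∈ D`. -/
def setP (Λ : N →ₗ[ℂ] B →ₗ[ℂ] E) (D : Submodule ℂ B) : Set 𝓜(ℂ, A) :=
  {a | 0 ≤ a ∧ ∀ d ∈ D, ∃ x : B,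
    Tendsto (fun ρ : setG Λ => star d * (extendG ρ a).fst d) atTop (𝓝 x)}

theorem formG_nonneg {Λ : N →ₗ[ℂ] B →ₗ[ℂ] E} (ρ : setG Λ) (x : 𝓜(ℂ, A) ⊗[ℂ] B) :
    0 ≤ tensorForm (extendG ρ) x x := tensorForm_nonneg (isStrict_of_mem_setG ρ.2) x

theorem formG_mono {Λ : N →ₗ[ℂ] B →ₗ[ℂ] E} (ρ ρ' : setG Λ) (h : ρ ≤ ρ') (x : 𝓜(ℂ, A) ⊗[ℂ] B) :
    tensorForm (extendG ρ) x x ≤ tensorForm (extendG ρ') x x :=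
  tensorForm_mono (isStrict_of_mem_setG ρ.2) (isStrict_of_mem_setG ρ'.2) h x

theorem star_mul_self_mem_setP_iff {Λ : N →ₗ[ℂ] B →ₗ[ℂ] E} {D : Submodule ℂ B} {a : 𝓜(ℂ, A)} :
    star a * a ∈ setP Λ D ↔ ∀ d ∈ D, ∃ x : B,
      Tendsto (fun ρ : setG Λ => tensorForm (extendG ρ) (a ⊗ₜ d) (a ⊗ₜ d)) atTop (𝓝 x) :=
  ⟨fun h => h.2, fun h => ⟨star_mul_self_nonneg a, h⟩⟩

/-- The set `𝓝 = {a ∈ M(A) | a* a ∈ 𝓟}`, which is a subspace of `M(A)`. -/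
def calN (Λ : N →ₗ[ℂ] B →ₗ[ℂ] E) (D : Submodule ℂ B) : Submodule ℂ 𝓜(ℂ, A) where
  carrier := {a | star a * a ∈ setP Λ D}
  add_mem' {a a'} h h' := star_mul_self_mem_setP_iff.2 fun d hd => by
    simp only [TensorProduct.add_tmul]
    exact exists_tendsto_add (s := fun ρ : setG Λ => tensorForm (extendG ρ)) formG_mono (star_mul_self_mem_setP_iff.1 h d hd)
      (star_mul_self_mem_setP_iff.1 h' d hd)
  zero_mem' := star_mul_self_mem_setP_iff.2 fun d _ => ⟨0, by
    simp only [TensorProduct.zero_tmul, map_zero]; exact tendsto_const_nhds⟩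
  smul_mem' c a h := star_mul_self_mem_setP_iff.2 fun d hd => by
    simp only [← TensorProduct.smul_tmul']
    exact exists_tendsto_smul c (star_mul_self_mem_setP_iff.1 h d hd)

/-- The inclusion of `𝓝 ⊙ D` into `M(A) ⊙ B`. -/
noncomputable def inclTensor (Λ : N →ₗ[ℂ] B →ₗ[ℂ] E) (D : Submodule ℂ B) :
    (calN Λ D ⊗[ℂ] D) →ₗ[ℂ] 𝓜(ℂ, A) ⊗[ℂ] B :=
  TensorProduct.map (calN Λ D).subtype D.subtype

theorem exists_tendsto_inclTensor (Λ : N →ₗ[ℂ] B →ₗ[ℂ] E) (D : Submodule ℂ B)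
    (x : calN Λ D ⊗[ℂ] D) :
    ∃ z, Tendsto (fun ρ : setG Λ => tensorForm (extendG ρ) (inclTensor Λ D x) (inclTensor Λ D x))
      atTop (𝓝 z) := by
  induction x using TensorProduct.induction_on with
  | zero => exact ⟨0, by simp only [map_zero]; exact tendsto_const_nhds⟩
  | tmul a d => exact star_mul_self_mem_setP_iff.1 a.2 d d.2
  | add x y hx hy =>
    simp only [map_add (inclTensor Λ D)]
    exact exists_tendsto_add (s := fun ρ : setG Λ => tensorForm (extendG ρ)) formG_mono hx hy

/-- The limit over `𝓖` of the sesquilinear forms on `𝓝 ⊙ D` with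
`(a₂ ⊗ b₂, a₁ ⊗ b₁) ↦ b₂* ρ(a₂* a₁) b₁`. (If `𝓖` were not directed, the value is `0`.) -/
noncomputable def limitForm (Λ : N →ₗ[ℂ] B →ₗ[ℂ] E) (D : Submodule ℂ B) :
    (calN Λ D ⊗[ℂ] D) →ₗ⋆[ℂ] (calN Λ D ⊗[ℂ] D) →ₗ[ℂ] B :=
  (exists_limit_form (s := fun ρ : setG Λ => tensorForm (extendG ρ)) formG_mono (inclTensor Λ D) (exists_tendsto_inclTensor Λ D)).choose

theorem tendsto_limitForm (Λ : N →ₗ[ℂ] B →ₗ[ℂ] E) (D : Submodule ℂ B) (x y : calN Λ D ⊗[ℂ] D) :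
    Tendsto (fun ρ : setG Λ => tensorForm (extendG ρ) (inclTensor Λ D x) (inclTensor Λ D y))
      atTop (𝓝 (limitForm Λ D x y)) :=
  (exists_limit_form (s := fun ρ : setG Λ => tensorForm (extendG ρ)) formG_mono (inclTensor Λ D) (exists_tendsto_inclTensor Λ D)).choose_spec.1 x y

theorem limitForm_eq_zero (Λ : N →ₗ[ℂ] B →ₗ[ℂ] E) (D : Submodule ℂ B)
    (h : ¬ (atTop : Filter (setG Λ)).NeBot) : limitForm Λ D = 0 :=
  (exists_limit_form (s := fun ρ : setG Λ => tensorForm (extendG ρ)) formG_mono (inclTensor Λ D) (exists_tendsto_inclTensor Λ D)).choose_spec.2 h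

theorem tendsto_limitForm_tmul (Λ : N →ₗ[ℂ] B →ₗ[ℂ] E) (D : Submodule ℂ B) (a₁ a₂ : calN Λ D)
    (b₁ b₂ : D) :
    Tendsto (fun ρ : setG Λ => star (b₂ : B) * (extendG ρ (star (a₂ : 𝓜(ℂ, A)) * a₁)).fst b₁)
      atTop (𝓝 (limitForm Λ D (a₂ ⊗ₜ b₂) (a₁ ⊗ₜ b₁))) :=
  tendsto_limitForm Λ D _ _

theorem limitForm_nonneg (Λ : N →ₗ[ℂ] B →ₗ[ℂ] E) (D : Submodule ℂ B) (x : calN Λ D ⊗[ℂ] D) :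
    0 ≤ limitForm Λ D x x := by
  by_cases h : (atTop : Filter (setG Λ)).NeBot
  · exact ge_of_tendsto' (tendsto_limitForm Λ D x x) fun ρ => formG_nonneg ρ _
  · rw [limitForm_eq_zero Λ D h]; exact le_rfl

variable {D : Submodule ℂ B}

/-- Right multiplication by `b` on a right ideal `D` of `B`. -/
def rightMul (hD : ∀ d ∈ D, ∀ b, d * b ∈ D) (b : B) : D →ₗ[ℂ] D where
  toFun d := ⟨d * b, hD d d.2 b⟩
  map_add' d d' := Subtype.ext (add_mul _ _ _)
  map_smul' c d := Subtype.ext (smul_mul_assoc _ _ _)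

theorem limitForm_rightMul (Λ : N →ₗ[ℂ] B →ₗ[ℂ] E) (hD : ∀ d ∈ D, ∀ b, d * b ∈ D) (b : B)
    (x y : calN Λ D ⊗[ℂ] D) :
    limitForm Λ D x ((rightMul hD b).lTensor (calN Λ D) y) = limitForm Λ D x y * b := by
  by_cases h : (atTop : Filter (setG Λ)).NeBot
  · refine tendsto_nhds_unique (tendsto_limitForm Λ D _ _)
      (((tendsto_limitForm Λ D x y).mul_const b).congr fun ρ => ?_)
    induction x using TensorProduct.induction_on with
    | zero => simp
    | add x x' hx hx' => simp only [map_add, LinearMap.add_apply, add_mul, hx, hx']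
    | tmul a₂ b₂ =>
      induction y using TensorProduct.induction_on with
      | zero => simp
      | add y y' hy hy' => simp only [map_add, add_mul, hy, hy']
      | tmul a₁ b₁ =>
        simp only [inclTensor, LinearMap.lTensor_tmul, TensorProduct.map_tmul, tensorForm_tmul,
          Submodule.subtype_apply, rightMul, LinearMap.coe_mk, AddHom.coe_mk, fst_mul, mul_assoc]
  · rw [limitForm_eq_zero Λ D h]; simp

/-- The semi-inner-product module `𝓝 ⊙ D` over `B`, with `(a ⊗ d) b = a ⊗ (d b)` and
`⟨a₁ ⊗ b₁, a₂ ⊗ b₂⟩` the limit over `𝓖` of `b₂* ρ(a₂* a₁) b₁`. -/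
noncomputable def tensorModule (Λ : N →ₗ[ℂ] B →ₗ[ℂ] E) (hD : ∀ d ∈ D, ∀ b, d * b ∈ D) :
    SemiInnerModule Bᵐᵒᵖ (calN Λ D ⊗[ℂ] D) where
  form := LinearMap.mk₂'ₛₗ (starRingEnd ℂ) (RingHom.id ℂ) (fun x y => op (limitForm Λ D x y))
    (fun x x' y => by simp) (fun c x y => by simp [LinearMap.map_smulₛₗ])
    (fun x y y' => by simp) (fun c x y => by simp)
  act c := (rightMul hD (unop c)).lTensor (calN Λ D)
  star_form x y := congrArg op (form_star_of_nonneg (limitForm_nonneg Λ D) x y)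
  form_nonneg x := limitForm_nonneg Λ D x
  form_act c x y := congrArg op (limitForm_rightMul Λ hD (unop c) x y)

/-- The Hilbert C⋆-module `M(A) ⊗̇ D` over `B`: divide `𝓝 ⊙ D` by the vectors `x` with `⟨x, x⟩ = 0`
and complete. -/
abbrev MultTensor (Λ : N →ₗ[ℂ] B →ₗ[ℂ] E) (hD : ∀ d ∈ D, ∀ b, d * b ∈ D) : Type _ :=
  (tensorModule Λ hD).HilbertCompletion

/-- The element `a ⊗̇ d` of `M(A) ⊗̇ D`, for `a ∈ 𝓝` and `d ∈ D`. -/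
noncomputable def dotTmul (Λ : N →ₗ[ℂ] B →ₗ[ℂ] E) (hD : ∀ d ∈ D, ∀ b, d * b ∈ D) (a : calN Λ D)
    (d : D) : MultTensor Λ hD :=
  SemiInnerModule.HilbertCompletion.mk (tensorModule Λ hD) (a ⊗ₜ d)

theorem rinner_dotTmul (Λ : N →ₗ[ℂ] B →ₗ[ℂ] E) (hD : ∀ d ∈ D, ∀ b, d * b ∈ D) (a₁ a₂ : calN Λ D)
    (b₁ b₂ : D) :
    Tendsto (fun ρ : setG Λ => star (b₂ : B) * (extendG ρ (star (a₂ : 𝓜(ℂ, A)) * a₁)).fst b₁)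
      atTop (𝓝 (rinner B (dotTmul Λ hD a₁ b₁) (dotTmul Λ hD a₂ b₂))) := by
  rw [rinner, dotTmul, dotTmul, SemiInnerModule.HilbertCompletion.inner_mk]
  exact tendsto_limitForm_tmul Λ D a₁ a₂ b₁ b₂

theorem op_smul_dotTmul (Λ : N →ₗ[ℂ] B →ₗ[ℂ] E) (hD : ∀ d ∈ D, ∀ b, d * b ∈ D) (a : calN Λ D)
    (d : D) (b : B) :
    op b • dotTmul Λ hD a d = dotTmul Λ hD a ⟨d * b, hD d d.2 b⟩ :=
  SemiInnerModule.HilbertCompletion.smul_mk _ _ _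

/-- `Λ : N → L(B, E)` is closed for the norm topology on `A` and the topology of pointwise convergence
on `L(B, E)`. -/
def IsNormStronglyClosed (Λ : N →ₗ[ℂ] B →ₗ[ℂ] E) : Prop :=
  IsClosed {p : A × (B → E) | ∃ h : p.1 ∈ N, ∀ b, p.2 b = Λ ⟨p.1, h⟩ b}

/-- The net `(u i)` in `M(A)`, with the operators `S i ∈ 𝓛(E)` and the strict completely positive maps
`ρ i : A → M(B)`, is truncating for `Λ`. -/
structure IsTruncatingNet {I : Type*} [Preorder I] (Λ : N →ₗ[ℂ] B →ₗ[ℂ] E) (u : I → 𝓜(ℂ, A))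
    (S : I → E →L[ℂ] E) (ρ : I → A →CP 𝓜(ℂ, B)) : Prop where
  /-- `N u i ⊆ N` -/
  mul_mem : ∀ (i : I) (a : N), (u i).snd (a : A) ∈ N
  /-- `S i ∈ 𝓛(E)` -/
  adjointable : ∀ i, IsAdjointable B (S i)
  /-- `S i Λ(a) = Λ(a u i)` -/
  S_apply : ∀ (i : I) (a : N) (b : B), S i (Λ a b) = Λ ⟨(u i).snd (a : A), mul_mem i a⟩ b
  norm_u_le : ∀ i, ‖u i‖ ≤ 1
  norm_S_le : ∀ i, ‖S i‖ ≤ 1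
  strict : ∀ i, IsStrict (ρ i)
  /-- `b₂* (ρ i)(a₂* a₁) b₁ = ⟨S i Λ(a₁) b₁, S i Λ(a₂) b₂⟩` -/
  ρ_apply : ∀ (i : I) (a₁ a₂ : N) (b₁ b₂ : B),
    star b₂ * (ρ i (star (a₂ : A) * a₁)).fst b₁ = rinner B (S i (Λ a₁ b₁)) (S i (Λ a₂ b₂))
  /-- `u i → 1` strictly -/
  tendsto_u : Tendsto u atTop (@nhds _ (strictTopology A) 1)
  /-- `S i → 1` strongly -/
  tendsto_S : ∀ v : E, Tendsto (fun i => S i v) atTop (𝓝 v)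

end Families

end CStarWeight

/-! Isometry. For σ in 𝓖 with operator T and x in N ⊙ B, the form of σ at x is ⟨T Λx, Λx⟩ ≤ ⟨Λx,
Λx⟩, where Λx denotes `lam Λ x`. The maps t ρ_i with t < 1 lie in 𝓖 and have the form t ⟨S_i Λx, S_i
Λx⟩, which comes arbitrarily close to ⟨Λx, Λx⟩ as t ↑ 1 and S_i → 1. Since forms increase with σ,
they converge to ⟨Λx, Λx⟩ (`IsTruncatingNet.tendsto_formG`). This puts N inside 𝓝 and makes U
isometric on the dense subspace spanned by Λ(N)D.

Directedness. Limits over 𝓖 are only meaningful once 𝓖 is directed. By `mem_setG_iff`, 𝓖 consists of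
the strict maps implemented by positive operators of norm < 1, so an upper bound of two such
operators is needed that is again implemented by a strict map. The element t = 1 - ((1-a)⁻¹ +
(1-b)⁻¹ - 1)⁻¹ of `exists_le_of_norm_lt_one` is an upper bound of a and b in the open unit ball,
with three further properties: it commutes with whatever commutes with a and b; it has the form xa +
yb, so that tΛ(c) inherits an adjoint and Λ(c₂)* t Λ(c₁) is a multiplier; and t ≤ ca + db, so that
it is dominated by a strict map. `exists_strict_implements` turns these properties into a strict
completely positive map.

Surjectivity. It suffices to approximate a ⊗ d, with a in 𝓝, by elements of N ⊗ d in the limit form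
φ. As φ is an increasing limit of strictly continuous forms, approximating a strictly is not enough.
Choose σ in 𝓖 whose form nearly attains φ at a ⊗ d, and c_k in N bounded with c_k → a strictly. Then
φ at c_k u_i ⊗ d is d* ρ_i(c_k* c_k) d, whose limit is at most φ at a ⊗ d because t ρ_i is in 𝓖 for
t < 1. Hence the positive form φ - σ is small at a ⊗ d and at c_k u_i ⊗ d, and so at their
difference, while σ itself is small there by strict continuity
(`IsTruncatingNet.exists_limitForm_sub_lt`). An isometry with dense range and complete domain is
onto, and polarisation makes it unitary. -/

namespace CStarWeight

/-! ### Calculus of the right `B`-valued inner product. -/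

section RightInner

variable {B E F : Type*} [NonUnitalCStarAlgebra B] [PartialOrder B] [StarOrderedRing B]
  [NormedAddCommGroup E] [NormedSpace ℂ E] [SMul Bᵐᵒᵖ E] [CStarModule Bᵐᵒᵖ E]

theorem star_rinner (v w : E) : star (rinner B v w) = rinner B w v := by
  rw [rinner, ← unop_star, CStarModule.star_inner]; rfl

theorem rinner_add_left (v v' w : E) : rinner B (v + v') w = rinner B v w + rinner B v' w := by
  simp only [rinner, CStarModule.inner_add_right, unop_add]

theorem rinner_smul_left (c : ℂ) (v w : E) : rinner B (c • v) w = c • rinner B v w := by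
  simp only [rinner, CStarModule.inner_smul_right_complex, unop_smul]

theorem rinner_add_right (v w w' : E) : rinner B v (w + w') = rinner B v w + rinner B v w' := by
  simp only [rinner, CStarModule.inner_add_left, unop_add]

theorem rinner_smul_right (c : ℂ) (v w : E) : rinner B v (c • w) = star c • rinner B v w := by
  simp only [rinner, CStarModule.inner_smul_left_complex, unop_smul]

variable (B E) in
/-- The sesquilinear form `(w, v) ↦ ⟨v, w⟩`. -/
def rinnerForm : E →ₗ⋆[ℂ] E →ₗ[ℂ] B :=
  LinearMap.mk₂'ₛₗ (starRingEnd ℂ) (RingHom.id ℂ) (fun w v => rinner B v w)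
    (fun _ _ _ => rinner_add_right _ _ _) (fun _ _ _ => rinner_smul_right _ _ _)
    (fun _ _ _ => rinner_add_left _ _ _) (fun _ _ _ => rinner_smul_left _ _ _)

theorem rinnerForm_apply (v w : E) : rinnerForm B E w v = rinner B v w := rfl

theorem rinner_zero_left (w : E) : rinner B 0 w = 0 := map_zero (rinnerForm B E w)

theorem rinner_sub_left (v v' w : E) : rinner B (v - v') w = rinner B v w - rinner B v' w :=
  map_sub (rinnerForm B E w) v v'

theorem rinner_neg_left (v w : E) : rinner B (-v) w = -rinner B v w :=
  map_neg (rinnerForm B E w) v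

theorem rinner_zero_right (v : E) : rinner B v 0 = 0 := by
  rw [← star_rinner, rinner_zero_left, star_zero]

theorem rinner_sub_right (v w w' : E) : rinner B v (w - w') = rinner B v w - rinner B v w' := by
  rw [← star_rinner, rinner_sub_left, star_sub, star_rinner, star_rinner]

theorem rinner_self_nonneg (v : E) : 0 ≤ rinner B v v :=
  CStarModule.inner_self_nonneg (A := Bᵐᵒᵖ) (x := v)

theorem norm_rinner_self (v : E) : ‖rinner B v v‖ = ‖v‖ ^ 2 :=
  (CStarModule.norm_sq_eq Bᵐᵒᵖ (x := v)).symm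

theorem norm_rinner_le (v w : E) : ‖rinner B v w‖ ≤ ‖v‖ * ‖w‖ := by
  rw [mul_comm]
  exact CStarModule.norm_inner_le (A := Bᵐᵒᵖ) E (x := w) (y := v)

theorem eq_of_rinner_eq {v v' : E} (h : ∀ w, rinner B v w = rinner B v' w) : v = v' := by
  rw [← sub_eq_zero, ← norm_eq_zero, ← sq_eq_zero_iff, ← norm_rinner_self (B := B),
    rinner_sub_left, h, sub_self, norm_zero]

theorem continuous_rinner : Continuous fun p : E × E => rinner B p.1 p.2 :=
  continuous_unop.comp ((CStarModule.continuous_inner (A := Bᵐᵒᵖ) (E := E)).comp continuous_swap)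

theorem Continuous.rinner {X : Type*} [TopologicalSpace X] {f g : X → E} (hf : Continuous f)
    (hg : Continuous g) : Continuous fun x => rinner B (f x) (g x) :=
  continuous_rinner.comp (hf.prodMk hg)

theorem tendsto_rinner {ι : Type*} {l : Filter ι} {f g : ι → E} {v w : E}
    (hf : Tendsto f l (𝓝 v)) (hg : Tendsto g l (𝓝 w)) :
    Tendsto (fun i => rinner B (f i) (g i)) l (𝓝 (rinner B v w)) :=
  (continuous_rinner.tendsto (v, w)).comp (hf.prodMk_nhds hg)

theorem eq_of_rinner_eq_of_dense {s : Set E} (hs : Dense s) {v v' : E}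
    (h : ∀ w ∈ s, rinner B v w = rinner B v' w) : v = v' :=
  eq_of_rinner_eq (B := B) fun w => hs.induction h
    (isClosed_eq (Continuous.rinner continuous_const continuous_id)
      (Continuous.rinner continuous_const continuous_id)) w

end RightInner

/-! ### Polarisation and positivity tests in C⋆-algebras. -/

theorem sesquilinear_eq_zero_of_diag {V B : Type*} [NonUnitalCStarAlgebra B] [PartialOrder B]
    [StarOrderedRing B] [AddCommGroup V] [Module ℂ V] {s : V →ₗ⋆[ℂ] V →ₗ[ℂ] B}
    (h : ∀ x, s x x = 0) (x y : V) : s x y = 0 := by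
  have h1 := h (x + (1 : ℂ) • y)
  have h2 := h (x + Complex.I • y)
  rw [form_add_smul] at h1 h2
  simp only [h, map_one, one_smul, smul_zero, add_zero, zero_add, Complex.conj_I] at h1 h2
  have h3 : Complex.I • (s x y - s y x) = 0 := by
    linear_combination (norm := module) h2
  have h4 := (smul_eq_zero.1 h3).resolve_left Complex.I_ne_zero
  linear_combination (norm := module) (1 / 2 : ℂ) • h1 + (1 / 2 : ℂ) • h4

/-- A self-adjoint element of a C⋆-algebra is nonnegative if it is so under a separating family of
positive maps which is stable under the maps `a ↦ c* a c`. -/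
theorem nonneg_of_separating_family {R X B : Type*} [CStarAlgebra R] [PartialOrder R]
    [StarOrderedRing R] [NonUnitalCStarAlgebra B] [PartialOrder B] [StarOrderedRing B]
    (q : X → R → B) (hneg : ∀ v a, q v (-a) = -q v a) (hpos : ∀ v a, 0 ≤ q v (star a * a))
    (hconj : ∀ (c : R) v, ∃ w, ∀ a, q w a = q v (star c * a * c))
    (hsep : ∀ a, (∀ v, q v (star a * a) = 0) → star a * a = 0) {p : R} (hp : IsSelfAdjoint p)
    (h : ∀ v, 0 ≤ q v p) : 0 ≤ p := by
  -- The negative part n satisfies p n = -n², so n p n = -n³. Testing n p n against the family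
  -- forces n³ = 0, and hence n = 0.
  set n := p⁻ with hn
  have hn0 : 0 ≤ n := CFC.negPart_nonneg p
  have hns : star n = n := (IsSelfAdjoint.of_nonneg hn0).star_eq
  have hpn : p * n = -(n * n) := by
    conv_lhs => rw [← CFC.posPart_sub_negPart p hp]
    rw [sub_mul, CFC.posPart_mul_negPart, zero_sub]
  have hcube : star n * p * n = -(star n * n * n) := by rw [mul_assoc, hpn, mul_neg, mul_assoc]
  have hcube0 : 0 ≤ star n * n * n := by
    have := star_left_conjugate_nonneg hn0 n
    rwa [hns] at this ⊢
  obtain ⟨c, hc⟩ := CStarAlgebra.nonneg_iff_eq_star_mul_self.1 hcube0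
  have hz : star n * n * n = 0 := hc ▸ hsep c fun v => by
    obtain ⟨w, hw⟩ := hconj n v
    refine le_antisymm ?_ (hpos v c)
    have := h w
    rwa [hw, hcube, hneg, Left.nonneg_neg_iff, hc] at this
  rw [hns] at hz
  have h2 : n * n = 0 := by
    rw [← CStarRing.star_mul_self_eq_zero_iff, star_mul, hns, ← mul_assoc, hz, zero_mul]
  have h1 : n = 0 := by rwa [← CStarRing.star_mul_self_eq_zero_iff, hns]
  exact (CFC.negPart_eq_zero_iff p hp).1 h1

/-! ### The C⋆-algebra 𝓛(E) and its order. -/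

section Adjointable

variable {B E : Type*} [NonUnitalCStarAlgebra B] [PartialOrder B] [StarOrderedRing B]
  [NormedAddCommGroup E] [NormedSpace ℂ E] [SMul Bᵐᵒᵖ E] [CStarModule Bᵐᵒᵖ E]

variable (B) in
/-- `T'` is the adjoint of `T`. -/
def IsAdjointPair (T T' : E →L[ℂ] E) : Prop := ∀ v w, rinner B (T v) w = rinner B v (T' w)

theorem IsAdjointPair.symm {T T' : E →L[ℂ] E} (h : IsAdjointPair B T T') :
    IsAdjointPair B T' T := fun v w => by rw [← star_rinner, ← h, star_rinner]

theorem IsAdjointPair.unique {T T' T'' : E →L[ℂ] E} (h : IsAdjointPair B T T')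
    (h' : IsAdjointPair B T T'') : T' = T'' :=
  ContinuousLinearMap.ext fun v => eq_of_rinner_eq (B := B) fun w => by
    rw [h.symm, h'.symm]

/-- Cauchy–Schwarz applied to ⟨Tv, Tv⟩ = ⟨v, T'Tv⟩. It yields the C⋆-identity of 𝓛(E) and, after
cancelling ‖T‖, that the adjoint is isometric. -/
theorem IsAdjointPair.norm_le_sq {T T' : E →L[ℂ] E} (h : IsAdjointPair B T T') :
    ‖T‖ ^ 2 ≤ ‖T' * T‖ := by
  refine (Real.le_sqrt (norm_nonneg _) (norm_nonneg _)).1 ?_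
  refine T.opNorm_le_bound (Real.sqrt_nonneg _) fun v => ?_
  rw [← Real.sqrt_sq (norm_nonneg v), ← Real.sqrt_mul (norm_nonneg _)]
  refine Real.le_sqrt_of_sq_le ?_
  rw [← norm_rinner_self (B := B), h]
  calc _ ≤ ‖v‖ * ‖(T' * T) v‖ := norm_rinner_le _ _
    _ ≤ ‖v‖ * (‖T' * T‖ * ‖v‖) := by gcongr; exact ContinuousLinearMap.le_opNorm _ _
    _ = _ := by ring

theorem IsAdjointPair.norm_le {T T' : E →L[ℂ] E} (h : IsAdjointPair B T T') : ‖T‖ ≤ ‖T'‖ := by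
  have h1 := h.norm_le_sq.trans (norm_mul_le _ _)
  rcases (norm_nonneg T).eq_or_lt with h0 | h0
  · rw [← h0]; exact norm_nonneg _
  · rw [sq] at h1; exact le_of_mul_le_mul_right h1 h0

theorem IsAdjointPair.norm_eq {T T' : E →L[ℂ] E} (h : IsAdjointPair B T T') : ‖T'‖ = ‖T‖ :=
  le_antisymm h.symm.norm_le h.norm_le

theorem IsAdjointPair.sub {T T' R R' : E →L[ℂ] E} (h : IsAdjointPair B T T')
    (h' : IsAdjointPair B R R') : IsAdjointPair B (T - R) (T' - R') := fun v w => by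
  simp only [sub_apply, rinner_sub_left, rinner_sub_right, h v w, h' v w]

variable (B E) in
/-- The algebra `𝓛(E)` of adjointable operators on `E`. -/
def adjointables : Subalgebra ℂ (E →L[ℂ] E) where
  carrier := {T | ∃ T', IsAdjointPair B T T'}
  mul_mem' := by
    rintro T R ⟨T', hT⟩ ⟨R', hR⟩
    exact ⟨R' * T', fun v w => (hT _ _).trans (hR _ _)⟩
  add_mem' := by
    rintro T R ⟨T', hT⟩ ⟨R', hR⟩
    refine ⟨T' + R', fun v w => ?_⟩
    simp only [add_apply, rinner_add_left, rinner_add_right, hT v w, hR v w]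
  algebraMap_mem' c := by
    refine ⟨algebraMap ℂ _ (star c), fun v w => ?_⟩
    simp only [Algebra.algebraMap_eq_smul_one, smul_apply, one_apply_eq_self, rinner_smul_left,
      rinner_smul_right, star_star]

namespace adjointables

/-- The adjoint operator. -/
noncomputable def adj (T : adjointables B E) : E →L[ℂ] E := T.2.choose

theorem isAdjointPair (T : adjointables B E) : IsAdjointPair B (T : E →L[ℂ] E) (adj T) :=
  T.2.choose_spec

noncomputable instance : Star (adjointables B E) := ⟨fun T => ⟨adj T, T, (isAdjointPair T).symm⟩⟩

theorem rinner_star (T : adjointables B E) (v w : E) :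
    rinner B (T.1 v) w = rinner B v ((star T).1 w) := isAdjointPair T v w

theorem star_rinner_apply (T : adjointables B E) (v w : E) :
    rinner B ((star T).1 v) w = rinner B v (T.1 w) := (isAdjointPair T).symm v w

theorem star_eq_of_isAdjointPair {T R : adjointables B E} (h : IsAdjointPair B T.1 R.1) :
    star T = R := Subtype.ext ((isAdjointPair T).unique h)

noncomputable instance : StarRing (adjointables B E) where
  star_involutive T := star_eq_of_isAdjointPair (isAdjointPair T).symm
  star_mul T R := star_eq_of_isAdjointPair fun v w =>
    (rinner_star T _ _).trans (rinner_star R _ _)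
  star_add T R := star_eq_of_isAdjointPair fun v w => by
    change rinner B (T.1 v + R.1 v) w = rinner B v ((star T).1 w + (star R).1 w)
    rw [rinner_add_left, rinner_add_right, rinner_star, rinner_star]

instance : StarModule ℂ (adjointables B E) where
  star_smul c T := star_eq_of_isAdjointPair fun v w => by
    change rinner B (c • T.1 v) w = rinner B v (star c • (star T).1 w)
    rw [rinner_smul_left, rinner_smul_right, rinner_star, star_star]

instance : CStarRing (adjointables B E) where
  norm_mul_self_le T := by
    have := (isAdjointPair T).norm_le_sq
    rw [sq] at this
    exact this

variable [CompleteSpace E]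

/-- Passing to adjoints is isometric, so the adjoints of a convergent sequence are Cauchy; their
limit is the adjoint of the limit. -/
theorem isClosed : IsClosed (adjointables B E : Set (E →L[ℂ] E)) := by
  refine isClosed_of_closure_subset fun T hT => ?_
  obtain ⟨t, ht, hlim⟩ := mem_closure_iff_seq_limit.1 hT
  choose t' ht' using ht
  have hc : CauchySeq t' := by
    have h1 := hlim.cauchySeq
    rw [Metric.cauchySeq_iff] at h1 ⊢
    intro ε hε
    obtain ⟨n, hn⟩ := h1 ε hε
    refine ⟨n, fun k hk m hm => ?_⟩
    rw [dist_eq_norm, ((ht' k).sub (ht' m)).norm_eq, ← dist_eq_norm]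
    exact hn k hk m hm
  obtain ⟨T', hT'⟩ := cauchySeq_tendsto_of_complete hc
  refine ⟨T', fun v w => tendsto_nhds_unique (f := fun n => rinner B (t n v) w) (l := atTop) ?_ ?_⟩
  · exact tendsto_rinner ((ContinuousLinearMap.apply ℂ E v).continuous.tendsto T |>.comp hlim)
      tendsto_const_nhds
  · simp only [ht' _ v w]
    exact tendsto_rinner tendsto_const_nhds
      ((ContinuousLinearMap.apply ℂ E w).continuous.tendsto T' |>.comp hT')

noncomputable instance : CStarAlgebra (adjointables B E) where
  toCompleteSpace := isClosed.completeSpace_coe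

noncomputable instance : PartialOrder (adjointables B E) := CStarAlgebra.spectralOrder _

instance : StarOrderedRing (adjointables B E) := CStarAlgebra.spectralOrderedRing _

theorem rinner_star_mul (T : adjointables B E) (v : E) :
    rinner B ((star T * T).1 v) v = rinner B (T.1 v) (T.1 v) := star_rinner_apply T _ _

/-- This identifies the spectral order, in which functional calculus is available, with the order by
inner products used to define 𝓗 and 𝓕. Factor T = R*R in one direction; in the other, the maps T ↦
⟨Tv, v⟩ form a separating family. -/
theorem nonneg_iff {T : adjointables B E} : 0 ≤ T ↔ ∀ v, 0 ≤ rinner B (T.1 v) v := by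
  have hpos : ∀ (v : E) (R : adjointables B E), 0 ≤ rinner B ((star R * R).1 v) v := by
    intro v R
    rw [rinner_star_mul]
    exact rinner_self_nonneg _
  refine ⟨fun h v => ?_, fun h => ?_⟩
  · obtain ⟨R, rfl⟩ := CStarAlgebra.nonneg_iff_eq_star_mul_self.1 h
    exact hpos v R
  refine nonneg_of_separating_family (fun (v : E) (T : adjointables B E) => rinner B (T.1 v) v)
    (fun v T => rinner_neg_left _ _) hpos (fun c v => ⟨c.1 v, fun T => ?_⟩) (fun Q h0 => ?_) ?_ h
  · change _ = rinner B ((star c).1 (T.1 (c.1 v))) v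
    exact (star_rinner_apply c _ _).symm
  · suffices Q = 0 by rw [this, mul_zero]
    refine Subtype.ext (ContinuousLinearMap.ext fun v => ?_)
    have h1 := h0 v
    rw [rinner_star_mul] at h1
    exact CStarModule.inner_self.1 (congrArg op h1 : inner Bᵐᵒᵖ (Q.1 v) (Q.1 v) = 0)
  -- Self-adjointness of T is not assumed: over ℂ it follows by polarisation from the positivity of
  -- all ⟨Tv, v⟩.
  · refine star_eq_of_isAdjointPair fun v w => ?_
    have h1 := form_star_of_nonneg (s := (rinnerForm B E).compl₂ (T.1 : E →ₗ[ℂ] E)) h v w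
    rw [← star_rinner (T.1 w) v]
    exact h1.symm

theorem le_iff {T R : adjointables B E} :
    T ≤ R ↔ ∀ v, rinner B (T.1 v) v ≤ rinner B (R.1 v) v := by
  rw [← sub_nonneg, nonneg_iff]
  refine forall_congr' fun v => ?_
  rw [← sub_nonneg (a := rinner B (R.1 v) v), ← rinner_sub_left]
  rfl

/-- Cauchy–Schwarz for the semi-inner product ⟨T·, ·⟩, reduced to that of E by T = R*R. -/
theorem norm_rinner_sq_le {T : adjointables B E} (hT : 0 ≤ T) (v w : E) :
    ‖rinner B (T.1 v) w‖ ^ 2 ≤ ‖rinner B (T.1 v) v‖ * ‖rinner B (T.1 w) w‖ := by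
  obtain ⟨R, rfl⟩ := CStarAlgebra.nonneg_iff_eq_star_mul_self.1 hT
  rw [rinner_star_mul, rinner_star_mul, norm_rinner_self, norm_rinner_self, ← mul_pow]
  have : rinner B ((star R * R).1 v) w = rinner B (R.1 v) (R.1 w) :=
    star_rinner_apply R _ _
  rw [this]
  gcongr
  exact norm_rinner_le _ _

/-- `IsAdjointable` only supplies a function T'. Nondegeneracy of the inner product makes it linear,
and ⟨T'v, T'v⟩ = ⟨v, TT'v⟩ bounds it by ‖T‖. -/
theorem exists_of_isAdjointable (T : E →L[ℂ] E) (h : IsAdjointable B T) :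
    ∃ R : adjointables B E, R.1 = T := by
  obtain ⟨T', hT⟩ := h
  have hT' : ∀ v w, rinner B (T' v) w = rinner B v (T w) := fun v w => by
    rw [← star_rinner, ← hT, star_rinner]
  let T₁ : E →ₗ[ℂ] E :=
    { toFun := T'
      map_add' := fun v w => eq_of_rinner_eq (B := B) fun x => by
        rw [hT', rinner_add_left, rinner_add_left, hT', hT']
      map_smul' := fun c v => eq_of_rinner_eq (B := B) fun x => by
        rw [hT', RingHom.id_apply, rinner_smul_left, rinner_smul_left, hT'] }
  have hb : ∀ v, ‖T₁ v‖ ≤ ‖T‖ * ‖v‖ := fun v => by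
    rcases (norm_nonneg (T₁ v)).eq_or_lt with h0 | h0
    · rw [← h0]; positivity
    · refine le_of_mul_le_mul_right ?_ h0
      rw [← sq, ← norm_rinner_self (B := B)]
      change ‖rinner B (T' v) (T' v)‖ ≤ _
      rw [hT']
      calc _ ≤ ‖v‖ * ‖T (T' v)‖ := norm_rinner_le _ _
        _ ≤ ‖v‖ * (‖T‖ * ‖T' v‖) := by gcongr; exact T.le_opNorm _
        _ = ‖T‖ * ‖v‖ * ‖T' v‖ := by ring
  exact ⟨⟨T, T₁.mkContinuous _ hb, hT⟩, rfl⟩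

theorem exists_of_isPositiveOperator {T : E →L[ℂ] E} (h : IsPositiveOperator B T) :
    ∃ R : adjointables B E, R.1 = T ∧ 0 ≤ R := by
  obtain ⟨R, rfl⟩ := exists_of_isAdjointable T h.1
  exact ⟨R, rfl, nonneg_iff.2 h.2⟩

theorem isPositiveOperator {T : adjointables B E} (h : 0 ≤ T) : IsPositiveOperator B T.1 :=
  ⟨⟨_, rinner_star T⟩, nonneg_iff.1 h⟩

end adjointables

end Adjointable

/-! ### Bounded nets in the strict topology. -/

section StrictNets

variable {A B : Type*} [NonUnitalCStarAlgebra A] [NonUnitalCStarAlgebra B]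

theorem norm_coe_le (a : A) : ‖DoubleCentralizer.coe ℂ a‖ ≤ ‖a‖ := by
  rw [← DoubleCentralizer.norm_fst]
  exact ContinuousLinearMap.opNorm_mul_apply_le ℂ A _

theorem coe_star (a : A) :
    DoubleCentralizer.coe ℂ (star a) = star (DoubleCentralizer.coe ℂ a) :=
  map_star (DoubleCentralizer.coeHom (𝕜 := ℂ)) a

theorem coe_mul (a b : A) : DoubleCentralizer.coe ℂ (a * b) =
    DoubleCentralizer.coe ℂ a * DoubleCentralizer.coe ℂ b :=
  map_mul (DoubleCentralizer.coeHom (𝕜 := ℂ)) a b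

theorem coe_snd_apply (m : 𝓜(ℂ, A)) (a : A) :
    DoubleCentralizer.coe ℂ (m.snd a) = DoubleCentralizer.coe ℂ a * m :=
  multiplier_ext_fst fun x => m.central a x

theorem tendsto_strict_star {ι : Type*} {l : Filter ι} {f : ι → 𝓜(ℂ, A)} {m : 𝓜(ℂ, A)}
    (h : Tendsto f l (@nhds _ (strictTopology A) m)) :
    Tendsto (fun i => star (f i)) l (@nhds _ (strictTopology A) (star m)) := by
  rw [tendsto_strict_iff] at h ⊢
  simp only [DoubleCentralizer.star_fst, DoubleCentralizer.star_snd]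
  exact ⟨fun a => (h.2 _).star, fun a => (h.1 _).star⟩

/-- The eventual bound on ‖T i‖ replaces joint continuity; this is why multiplication is strictly
continuous only along bounded nets. -/
theorem tendsto_apply_of_eventually_bounded {V W ι : Type*} [NormedAddCommGroup V] [NormedSpace ℂ V]
    [NormedAddCommGroup W] [NormedSpace ℂ W] {l : Filter ι} {T : ι → V →L[ℂ] W} {S : V →L[ℂ] W}
    {f : ι → V} {x : V} {r : ℝ} (hT : ∀ᶠ i in l, ‖T i‖ ≤ r)
    (h : Tendsto (fun i => T i x) l (𝓝 (S x))) (hf : Tendsto f l (𝓝 x)) :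
    Tendsto (fun i => T i (f i)) l (𝓝 (S x)) := by
  have h1 : Tendsto (fun i => T i (f i - x)) l (𝓝 0) := by
    have h2 : Tendsto (fun i => r * ‖f i - x‖) l (𝓝 0) := by
      have := (tendsto_iff_norm_sub_tendsto_zero.1 hf).const_mul r
      rwa [mul_zero] at this
    refine squeeze_zero_norm' ?_ h2
    filter_upwards [hT] with i hi
    exact (T i).le_of_opNorm_le hi _
  simpa using h1.add h

theorem tendsto_strict_mul {ι : Type*} {l : Filter ι} {f g : ι → 𝓜(ℂ, A)} {m n : 𝓜(ℂ, A)} {r : ℝ}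
    (hf : Tendsto f l (@nhds _ (strictTopology A) m)) (hfr : ∀ᶠ i in l, ‖f i‖ ≤ r)
    (hg : Tendsto g l (@nhds _ (strictTopology A) n)) (hgr : ∀ᶠ i in l, ‖g i‖ ≤ r) :
    Tendsto (fun i => f i * g i) l (@nhds _ (strictTopology A) (m * n)) := by
  rw [tendsto_strict_iff] at hf hg ⊢
  refine ⟨fun a => ?_, fun a => ?_⟩
  · refine tendsto_apply_of_eventually_bounded (T := fun i => (f i).fst) (S := m.fst) (r := r) ?_
      (hf.1 (n.fst a)) (hg.1 a)
    simpa only [DoubleCentralizer.norm_fst] using hfr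
  · refine tendsto_apply_of_eventually_bounded (T := fun i => (g i).snd) (S := n.snd) (r := r) ?_
      (hg.2 (m.snd a)) (hf.2 a)
    simpa only [DoubleCentralizer.norm_snd] using hgr

theorem tendsto_strict_sub {ι : Type*} {l : Filter ι} {f g : ι → 𝓜(ℂ, A)} {m n : 𝓜(ℂ, A)}
    (hf : Tendsto f l (@nhds _ (strictTopology A) m))
    (hg : Tendsto g l (@nhds _ (strictTopology A) n)) :
    Tendsto (fun i => f i - g i) l (@nhds _ (strictTopology A) (m - n)) := by
  rw [tendsto_strict_iff] at hf hg ⊢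
  exact ⟨fun a => (hf.1 a).sub (hg.1 a), fun a => (hf.2 a).sub (hg.2 a)⟩

theorem StrictlyContinuousOnBounded.tendsto {f : 𝓜(ℂ, A) → 𝓜(ℂ, B)}
    (hf : StrictlyContinuousOnBounded f) {ι : Type*} {l : Filter ι} {g : ι → 𝓜(ℂ, A)}
    {m : 𝓜(ℂ, A)} {r : ℝ} (hg : Tendsto g l (@nhds _ (strictTopology A) m))
    (hr : ∀ᶠ i in l, ‖g i‖ ≤ r) : Tendsto (fun i => f (g i)) l (@nhds _ (strictTopology B) (f m)) :=
  Tendsto.comp (hf (max r ‖m‖) m (show ‖m‖ ≤ _ from le_max_right _ _))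
    (tendsto_inf.2 ⟨hg, tendsto_principal.2 (hr.mono fun _ h => h.trans (le_max_left _ _))⟩)

theorem StrictlyContinuousOnBounded.tendsto_star_mul {f : 𝓜(ℂ, A) → 𝓜(ℂ, B)}
    (hf : StrictlyContinuousOnBounded f) {ι : Type*} {l : Filter ι} {g : ι → 𝓜(ℂ, A)}
    {m : 𝓜(ℂ, A)} {r : ℝ} (hg : Tendsto g l (@nhds _ (strictTopology A) m))
    (hr : ∀ᶠ i in l, ‖g i‖ ≤ r) (d : B) :
    Tendsto (fun i => star d * (f (star (g i) * g i)).fst d) l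
      (𝓝 (star d * (f (star m * m)).fst d)) := by
  refine Tendsto.const_mul _ ?_
  have hr' : ∀ᶠ i in l, ‖star (g i)‖ ≤ r := by simpa only [norm_star] using hr
  refine (tendsto_strict_iff.1 (hf.tendsto (r := r * r)
    (tendsto_strict_mul (tendsto_strict_star hg) hr' hg hr) ?_)).1 d
  filter_upwards [hr] with i hi
  refine (norm_mul_le _ _).trans ?_
  rw [norm_star]
  exact mul_le_mul hi hi (norm_nonneg _) ((norm_nonneg _).trans hi)

variable [PartialOrder A] [StarOrderedRing A]

/-- The elements m e, with e running through the approximate unit, tend strictly to m and are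
bounded by ‖m‖. The index n in ℕ moves m e into the dense subspace N with an error of at most
1/(n+1) ≤ 1, whence the bound ‖m‖ + 1. -/
theorem exists_bounded_net {N : Submodule ℂ A} (hN : Dense (N : Set A)) (m : 𝓜(ℂ, A)) :
    ∃ c : A × ℕ → N, (∀ᶠ p in CStarAlgebra.approximateUnit A ×ˢ atTop, ‖(c p : A)‖ ≤ ‖m‖ + 1) ∧
      Tendsto (fun p => DoubleCentralizer.coe ℂ (c p : A))
        (CStarAlgebra.approximateUnit A ×ˢ atTop) (@nhds _ (strictTopology A) m) := by
  have h : ∀ p : A × ℕ, ∃ c : N, ‖(c : A) - m.fst p.1‖ ≤ 1 / ((p.2 : ℝ) + 1) := fun p => by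
    obtain ⟨y, hy, hd⟩ := hN.exists_dist_lt (m.fst p.1) (ε := 1 / ((p.2 : ℝ) + 1)) (by positivity)
    exact ⟨⟨y, hy⟩, by rw [← dist_eq_norm, dist_comm]; exact hd.le⟩
  choose c hc using h
  have h0 : Tendsto (fun p : A × ℕ => (c p : A) - m.fst p.1)
      (CStarAlgebra.approximateUnit A ×ˢ atTop) (𝓝 0) :=
    squeeze_zero_norm hc (tendsto_one_div_add_atTop_nhds_zero_nat.comp tendsto_snd)
  refine ⟨c, ?_, ?_⟩
  · filter_upwards [(norm_fst_approximateUnit m).prod_inl (atTop : Filter ℕ)] with p hp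
    have h1 : (1 : ℝ) / ((p.2 : ℝ) + 1) ≤ 1 := by
      rw [div_le_one (by positivity)]; linarith [(p.2.cast_nonneg : (0 : ℝ) ≤ p.2)]
    calc ‖(c p : A)‖ = ‖m.fst p.1 + ((c p : A) - m.fst p.1)‖ := by rw [add_sub_cancel]
      _ ≤ ‖m‖ + 1 := (norm_add_le _ _).trans (add_le_add hp ((hc p).trans h1))
  · refine tendsto_strict_iff.2 ⟨fun x => ?_, fun x => ?_⟩
    · have := ((tendsto_fst_approximateUnit m x).comp (tendsto_fst (g := (atTop : Filter ℕ)))).add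
        (h0.mul_const x)
      simpa [sub_mul] using this
    · have := ((tendsto_snd_approximateUnit m x).comp (tendsto_fst (g := (atTop : Filter ℕ)))).add
        (h0.const_mul x)
      simpa [mul_sub] using this

theorem cp_exists_norm_le [PartialOrder B] [StarOrderedRing B] (ρ : A →CP 𝓜(ℂ, B)) :
    ∃ C : ℝ, 0 ≤ C ∧ ∀ a, ‖ρ a‖ ≤ C * ‖a‖ := by
  obtain ⟨C, hC⟩ := PositiveLinearMap.exists_norm_apply_le
    (⟨ρ.toLinearMap, OrderHomClass.mono ρ⟩ : A →ₚ[ℂ] 𝓜(ℂ, B))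
  exact ⟨C, C.2, hC⟩

end StrictNets

/-! ### Positivity of matrices over `M(B)`, tested on columns over `B`. -/

section MatrixPositivity

variable {B : Type*} [NonUnitalCStarAlgebra B] {n : ℕ}

/-- The action of a matrix over `M(B)` on column vectors over `B`. -/
noncomputable def matrixAct (P : CStarMatrix (Fin n) (Fin n) 𝓜(ℂ, B)) : (Fin n → B) →ₗ[ℂ] (Fin n → B) where
  toFun b k := ∑ i, (P k i).fst (b i)
  map_add' b c := by ext k; simp [Finset.sum_add_distrib]
  map_smul' c b := by ext k; simp [Finset.smul_sum]

/-- The sesquilinear form `(b, c) ↦ ∑ i, b_i* c_i` on column vectors over `B`. -/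
noncomputable def columnForm : (Fin n → B) →ₗ⋆[ℂ] (Fin n → B) →ₗ[ℂ] B :=
  LinearMap.mk₂'ₛₗ (starRingEnd ℂ) (RingHom.id ℂ) (fun b c => ∑ i, star (b i) * c i)
    (fun b b' c => by simp [add_mul, Finset.sum_add_distrib])
    (fun z b c => by simp [Finset.smul_sum, smul_mul_assoc])
    (fun b c c' => by simp [mul_add, Finset.sum_add_distrib])
    (fun z b c => by simp [Finset.smul_sum, mul_smul_comm])

theorem columnForm_apply (b c : Fin n → B) : columnForm b c = ∑ i, star (b i) * c i := rfl

theorem multiplier_fst_sum {ι : Type*} (s : Finset ι) (g : ι → 𝓜(ℂ, B)) (x : B) :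
    (∑ k ∈ s, g k).fst x = ∑ k ∈ s, (g k).fst x :=
  map_sum ({ toFun := fun m => m.fst x, map_zero' := rfl, map_add' := fun _ _ => rfl } :
    𝓜(ℂ, B) →+ B) g s

theorem matrixAct_mul (P Q : CStarMatrix (Fin n) (Fin n) 𝓜(ℂ, B)) (b : Fin n → B) :
    matrixAct (P * Q) b = matrixAct P (matrixAct Q b) := by
  ext k
  change ∑ i, ((P * Q) k i).fst (b i) = ∑ j, (P k j).fst (∑ i, (Q j i).fst (b i))
  simp only [CStarMatrix.mul_apply, multiplier_fst_sum, map_sum]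
  exact Finset.sum_comm

theorem columnForm_matrixAct_star (P : CStarMatrix (Fin n) (Fin n) 𝓜(ℂ, B)) (b c : Fin n → B) :
    columnForm b (matrixAct (star P) c) = columnForm (matrixAct P b) c := by
  change ∑ i, star (b i) * ∑ j, (star P i j).fst (c j) = ∑ j, star (∑ i, (P j i).fst (b i)) * c j
  simp only [CStarMatrix.star_apply, Finset.mul_sum, star_sum, Finset.sum_mul]
  rw [Finset.sum_comm]
  refine Finset.sum_congr rfl fun j _ => Finset.sum_congr rfl fun i _ => ?_
  rw [DoubleCentralizer.star_fst, ← star_star (c j), ← star_mul, ← star_mul, star_star,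
    DoubleCentralizer.central]

theorem eq_of_columnForm_eq {P Q : CStarMatrix (Fin n) (Fin n) 𝓜(ℂ, B)}
    (h : ∀ b c, columnForm b (matrixAct P c) = columnForm b (matrixAct Q c)) : P = Q := by
  classical
  have key : ∀ (R : CStarMatrix (Fin n) (Fin n) 𝓜(ℂ, B)) (i j : Fin n) (x y : B),
      columnForm (Pi.single i x) (matrixAct R (Pi.single j y)) = star x * (R i j).fst y := by
    intro R i j x y
    rw [columnForm_apply, Finset.sum_eq_single i]
    · change star _ * ∑ k, (R i k).fst ((Pi.single j y : Fin n → B) k) = _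
      rw [Finset.sum_eq_single j]
      · simp
      · intro k _ hk; simp [hk]
      · simp
    · intro k _ hk; simp [hk]
    · simp
  ext i j : 1
  refine multiplier_ext_fst fun y => eq_of_mul_left fun z => ?_
  rw [← star_star z, ← key, ← key, h]
  
/-- Converse to `cp_sum_nonneg`: column vectors over B form a separating family for the matrix
algebra over M(B). It is the tool for proving that a map into M(B) is completely positive. -/
theorem matrix_nonneg_of_form [PartialOrder B] [StarOrderedRing B]
    {P : CStarMatrix (Fin n) (Fin n) 𝓜(ℂ, B)}
    (h : ∀ b : Fin n → B, 0 ≤ ∑ i, ∑ j, star (b i) * (P i j).fst (b j)) : 0 ≤ P := by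
  have h' : ∀ b, 0 ≤ columnForm b (matrixAct P b) := fun b => by
    refine (h b).trans_eq (Finset.sum_congr rfl fun i _ => ?_)
    rw [← Finset.mul_sum]; rfl
  have hstar : ∀ (Q : CStarMatrix (Fin n) (Fin n) 𝓜(ℂ, B)) b,
      columnForm b (matrixAct (star Q * Q) b) =
        ∑ i, star (matrixAct Q b i) * matrixAct Q b i := fun Q b => by
    rw [matrixAct_mul, columnForm_matrixAct_star, columnForm_apply]
  -- By polarisation the diagonal values determine a matrix. This gives both the separation property
  -- and, further below, the self-adjointness of P.
  have hz : ∀ P Q : CStarMatrix (Fin n) (Fin n) 𝓜(ℂ, B),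
    (∀ b, columnForm b (matrixAct P b) = columnForm b (matrixAct Q b)) → P = Q := by
    intro P Q hPQ
    refine eq_of_columnForm_eq fun b c => sub_eq_zero.1 ?_
    refine sesquilinear_eq_zero_of_diag (s := (columnForm (B := B) (n := n)).compl₂ (matrixAct P) -
      (columnForm (B := B) (n := n)).compl₂ (matrixAct Q)) (fun x => ?_) b c
    exact sub_eq_zero.2 (hPQ x)
  refine nonneg_of_separating_family (fun (b : Fin n → B) P => columnForm b (matrixAct P b))
    (fun b P => ?_) (fun b Q => ?_) (fun c b => ⟨matrixAct c b, fun a => ?_⟩) (fun Q h0 => ?_)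
    ?_ h'
  · rw [← map_neg]
    congr 1
    ext i
    change ∑ j, (-P i j).fst (b j) = -∑ j, (P i j).fst (b j)
    rw [← Finset.sum_neg_distrib]; rfl
  · rw [hstar]
    exact Finset.sum_nonneg fun _ _ => star_mul_self_nonneg _
  · rw [← columnForm_matrixAct_star, mul_assoc, matrixAct_mul, matrixAct_mul]
  · refine hz _ _ fun b => ?_
    rw [h0, matrixAct, columnForm_apply]
    simp
  · refine hz _ _ fun b => ?_
    rw [columnForm_matrixAct_star]
    have : star (columnForm b (matrixAct P b)) = columnForm b (matrixAct P b) :=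
      (IsSelfAdjoint.of_nonneg (h' b)).star_eq
    rw [← this, columnForm_apply, columnForm_apply, star_sum]
    simp

end MatrixPositivity

/-! ### Left multiplication on `E`, and completely positive maps from positive operators. -/

section GNS

variable {A B E : Type*} [NonUnitalCStarAlgebra A] [PartialOrder A] [StarOrderedRing A]
  [NonUnitalCStarAlgebra B] [PartialOrder B] [StarOrderedRing B]
  [NormedAddCommGroup E] [NormedSpace ℂ E] [SMul Bᵐᵒᵖ E] [CStarModule Bᵐᵒᵖ E]
  {N : Submodule ℂ A}

/-- The linear map `N ⊙ B → E` with `a ⊗ b ↦ Λ(a) b`. -/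
noncomputable def lam (Λ : N →ₗ[ℂ] B →ₗ[ℂ] E) : N ⊗[ℂ] B →ₗ[ℂ] E := TensorProduct.lift Λ

theorem lam_tmul (Λ : N →ₗ[ℂ] B →ₗ[ℂ] E) (a : N) (b : B) : lam Λ (a ⊗ₜ b) = Λ a b := rfl

theorem denseRange_lam {Λ : N →ₗ[ℂ] B →ₗ[ℂ] E}
    (h : Dense (Submodule.span ℂ {v : E | ∃ (a : N) (b : B), v = Λ a b} : Set E)) :
    DenseRange (lam Λ) := by
  refine h.mono ?_
  rw [← LinearMap.coe_range, SetLike.coe_subset_coe, Submodule.span_le]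
  rintro _ ⟨a, b, rfl⟩
  exact ⟨a ⊗ₜ b, rfl⟩

theorem eq_of_rinner_lam {Λ : N →ₗ[ℂ] B →ₗ[ℂ] E} (hd : DenseRange (lam Λ)) {v v' : E}
    (h : ∀ a b, rinner B v (Λ a b) = rinner B v' (Λ a b)) : v = v' := by
  refine eq_of_rinner_eq_of_dense (B := B) hd ?_
  rintro _ ⟨t, rfl⟩
  induction t using TensorProduct.induction_on with
  | zero => simp only [map_zero, rinner_zero_right]
  | tmul a b => exact h a b
  | add s t hs ht => simp only [map_add, rinner_add_right, hs, ht]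

theorem clm_eq_of_lam {Λ : N →ₗ[ℂ] B →ₗ[ℂ] E} (hd : DenseRange (lam Λ)) {T R : E →L[ℂ] E}
    (h : ∀ a b, T (Λ a b) = R (Λ a b)) : T = R := by
  refine ContinuousLinearMap.ext fun v => hd.induction_on (p := fun v => T v = R v) v
    (isClosed_eq T.continuous R.continuous) fun t => ?_
  induction t using TensorProduct.induction_on with
  | zero => simp only [map_zero]
  | tmul a b => exact h a b
  | add s t hs ht => simp only [map_add, hs, ht]

/-- The inclusion of `N ⊙ B` into `M(A) ⊙ B`. -/
noncomputable def inclN (N : Submodule ℂ A) (B : Type*) [NonUnitalCStarAlgebra B] :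
    N ⊗[ℂ] B →ₗ[ℂ] 𝓜(ℂ, A) ⊗[ℂ] B :=
  (((DoubleCentralizer.coeHom : A →⋆ₙₐ[ℂ] 𝓜(ℂ, A)) : A →ₗ[ℂ] 𝓜(ℂ, A)) ∘ₗ N.subtype).rTensor B

theorem sesquilinear_ext_tmul {V W X : Type*} [AddCommGroup V] [Module ℂ V] [AddCommGroup W]
    [Module ℂ W] [AddCommGroup X] [Module ℂ X] {s s' : V ⊗[ℂ] W →ₗ⋆[ℂ] V ⊗[ℂ] W →ₗ[ℂ] X}
    (h : ∀ v w v' w', s (v ⊗ₜ w) (v' ⊗ₜ w') = s' (v ⊗ₜ w) (v' ⊗ₜ w')) : s = s' := by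
  refine LinearMap.ext fun x => LinearMap.ext fun y => ?_
  induction x using TensorProduct.induction_on with
  | zero => simp only [map_zero, LinearMap.zero_apply]
  | add x x' hx hx' => simp only [map_add, LinearMap.add_apply, hx, hx']
  | tmul v w =>
    induction y using TensorProduct.induction_on with
    | zero => simp only [map_zero]
    | add y y' hy hy' => simp only [map_add, hy, hy']
    | tmul v' w' => exact h v w v' w'

/-- The bridge between the forms on M(A) ⊙ B, where limits over 𝓖 are taken, and operators on E. -/
theorem tensorForm_inclN {Λ : N →ₗ[ℂ] B →ₗ[ℂ] E} {ρ : A →CP 𝓜(ℂ, B)} (hρ : IsStrict ρ)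
    {T : E →L[ℂ] E} (hT : Implements Λ ρ T) (t t' : N ⊗[ℂ] B) :
    tensorForm hρ.extend (inclN N B t') (inclN N B t) = rinner B (T (lam Λ t)) (lam Λ t') := by
  have h := sesquilinear_ext_tmul (s := ((tensorForm hρ.extend).compl₂ (inclN N B)) ∘ₛₗ inclN N B)
    (s' := ((rinnerForm B E).compl₂ (T.toLinearMap ∘ₗ lam Λ)) ∘ₛₗ lam Λ) (fun a b a' b' => ?_)
  · exact LinearMap.congr_fun (LinearMap.congr_fun h t') t
  · change star b * (hρ.extend (star (DoubleCentralizer.coe ℂ (a : A)) *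
      DoubleCentralizer.coe ℂ (a' : A))).fst b' = rinner B (T (Λ a' b')) (Λ a b)
    rw [← coe_star, ← coe_mul, hρ.extend_coe, hT]

theorem tensorForm_rTensor_mulLeft (f : 𝓜(ℂ, A) →ₗ[ℂ] 𝓜(ℂ, B)) (y : 𝓜(ℂ, A))
    (s s' : 𝓜(ℂ, A) ⊗[ℂ] B) :
    tensorForm f ((LinearMap.mulLeft ℂ y).rTensor B s) s' =
      tensorForm f s ((LinearMap.mulLeft ℂ (star y)).rTensor B s') := by
  have h := sesquilinear_ext_tmul
    (s := tensorForm f ∘ₛₗ (LinearMap.mulLeft ℂ y).rTensor B)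
    (s' := (tensorForm f).compl₂ ((LinearMap.mulLeft ℂ (star y)).rTensor B)) (fun a b a' b' => ?_)
  · exact LinearMap.congr_fun (LinearMap.congr_fun h s) s'
  · change star b * (f (star (y * a) * a')).fst b' = star b * (f (star a * (star y * a'))).fst b'
    rw [star_mul, mul_assoc]

/-- Write ‖x‖² - x*x = y*y in M(A) and use positivity of the form at y·s. -/
theorem tensorForm_mulLeft_le {ρ : A →CP 𝓜(ℂ, B)} (hρ : IsStrict ρ) (x : A)
    (s : 𝓜(ℂ, A) ⊗[ℂ] B) :
    tensorForm hρ.extend ((LinearMap.mulLeft ℂ (DoubleCentralizer.coe ℂ x)).rTensor B s)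
      ((LinearMap.mulLeft ℂ (DoubleCentralizer.coe ℂ x)).rTensor B s) ≤
      ((‖x‖ ^ 2 : ℝ) : ℂ) • tensorForm hρ.extend s s := by
  set m := DoubleCentralizer.coe ℂ x with hm
  have h1 : 0 ≤ algebraMap ℝ 𝓜(ℂ, A) (‖x‖ ^ 2) - star m * m := by
    rw [sub_nonneg]
    refine (IsSelfAdjoint.le_algebraMap_norm_self (IsSelfAdjoint.star_mul_self m)).trans ?_
    refine algebraMap_mono _ ?_
    rw [CStarRing.norm_star_mul_self, ← sq]
    gcongr
    exact norm_coe_le x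
  obtain ⟨y, hy⟩ := CStarAlgebra.nonneg_iff_eq_star_mul_self.1 h1
  have h2 := tensorForm_nonneg hρ ((LinearMap.mulLeft ℂ y).rTensor B s)
  have h3 : ∀ z : 𝓜(ℂ, A), tensorForm hρ.extend ((LinearMap.mulLeft ℂ z).rTensor B s)
      ((LinearMap.mulLeft ℂ z).rTensor B s) =
      tensorForm hρ.extend s ((LinearMap.mulLeft ℂ (star z * z)).rTensor B s) := fun z => by
    rw [tensorForm_rTensor_mulLeft, ← LinearMap.rTensor_comp_apply, ← LinearMap.mulLeft_mul]
  have h4 : LinearMap.mulLeft ℂ (star y * y) =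
      ((‖x‖ ^ 2 : ℝ) : ℂ) • LinearMap.id - LinearMap.mulLeft ℂ (star m * m) := by
    ext z : 1
    simp only [← hy, LinearMap.mulLeft_apply, LinearMap.sub_apply, LinearMap.smul_apply,
      LinearMap.id_apply, sub_mul, Algebra.algebraMap_eq_smul_one, smul_mul_assoc, one_mul]
    norm_cast
  rw [h3, h4, LinearMap.rTensor_sub, LinearMap.rTensor_smul, LinearMap.rTensor_id,
    LinearMap.sub_apply, LinearMap.smul_apply, LinearMap.id_apply, map_sub, map_smul,
    sub_nonneg, ← h3] at h2
  exact h2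

/-- Left multiplication by `x` on a left ideal `N` of `A`. -/
def leftMul (hN : ∀ x : A, ∀ a ∈ N, x * a ∈ N) (x : A) : N →ₗ[ℂ] N where
  toFun a := ⟨x * a, hN x a a.2⟩
  map_add' a a' := Subtype.ext (mul_add _ _ _)
  map_smul' c a := Subtype.ext (mul_smul_comm _ _ _)

theorem inclN_leftMul (hN : ∀ x : A, ∀ a ∈ N, x * a ∈ N) (x : A) (t : N ⊗[ℂ] B) :
    inclN N B ((leftMul hN x).rTensor B t) =
      (LinearMap.mulLeft ℂ (DoubleCentralizer.coe ℂ x)).rTensor B (inclN N B t) := by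
  simp only [inclN]
  rw [← LinearMap.rTensor_comp_apply, ← LinearMap.rTensor_comp_apply]
  congr 2
  ext a : 1
  exact coe_mul x a

section Truncating

variable {I : Type*} [Preorder I] [IsDirectedOrder I] [Nonempty I] [CompleteSpace E]
  {Λ : N →ₗ[ℂ] B →ₗ[ℂ] E} {u : I → 𝓜(ℂ, A)} {S : I → E →L[ℂ] E} {ρ : I → A →CP 𝓜(ℂ, B)}

theorem IsTruncatingNet.exists_implements (hu : IsTruncatingNet Λ u S ρ) (i : I) :
    ∃ R : adjointables B E, R.1 = S i ∧ Implements Λ (ρ i) (star R * R).1 := by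
  obtain ⟨R, hR⟩ := adjointables.exists_of_isAdjointable (S i) (hu.adjointable i)
  refine ⟨R, hR, fun a₁ a₂ b₁ b₂ => ?_⟩
  rw [hu.ρ_apply, ← hR]
  exact (adjointables.star_rinner_apply R _ _).symm

theorem IsTruncatingNet.tensorForm_eq (hu : IsTruncatingNet Λ u S ρ) (i : I) (t t' : N ⊗[ℂ] B) :
    tensorForm (hu.strict i).extend (inclN N B t') (inclN N B t) =
      rinner B (S i (lam Λ t)) (S i (lam Λ t')) := by
  obtain ⟨R, hR, hi⟩ := hu.exists_implements i
  rw [tensorForm_inclN _ hi, ← hR]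
  exact adjointables.star_rinner_apply R _ _

/-- With S_i inserted on both sides this is the form of ρ_i, where a left factor moves across by
definition. The factors S_i disappear in the limit. -/
theorem IsTruncatingNet.rinner_leftMul (hu : IsTruncatingNet Λ u S ρ)
    (hN : ∀ x : A, ∀ a ∈ N, x * a ∈ N) (x : A) (t t' : N ⊗[ℂ] B) :
    rinner B (lam Λ ((leftMul hN x).rTensor B t)) (lam Λ t') =
      rinner B (lam Λ t) (lam Λ ((leftMul hN (star x)).rTensor B t')) := by
  refine tendsto_nhds_unique (tendsto_rinner (hu.tendsto_S _) (hu.tendsto_S _))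
    ((tendsto_rinner (hu.tendsto_S _) (hu.tendsto_S _)).congr fun i => ?_)
  rw [← hu.tensorForm_eq, ← hu.tensorForm_eq, inclN_leftMul, inclN_leftMul,
    tensorForm_rTensor_mulLeft, coe_star, star_star]

/-- The form of each ρ_i gives the bound ‖x‖ ‖S_i Λt‖ after truncation by S_i; now use ‖S_i‖ ≤ 1 and
S_i → 1. -/
theorem IsTruncatingNet.norm_lam_leftMul_le (hu : IsTruncatingNet Λ u S ρ)
    (hN : ∀ x : A, ∀ a ∈ N, x * a ∈ N) (x : A) (t : N ⊗[ℂ] B) :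
    ‖lam Λ ((leftMul hN x).rTensor B t)‖ ≤ ‖x‖ * ‖lam Λ t‖ := by
  refine le_of_tendsto (hu.tendsto_S _).norm (Eventually.of_forall fun i => ?_)
  have h1 : ‖S i (lam Λ ((leftMul hN x).rTensor B t))‖ ^ 2 ≤ (‖x‖ * ‖S i (lam Λ t)‖) ^ 2 := by
    rw [mul_pow, ← norm_rinner_self (B := B) (S i _), ← norm_rinner_self (B := B) (S i _),
      ← hu.tensorForm_eq,
      ← hu.tensorForm_eq, inclN_leftMul]
    refine (CStarAlgebra.norm_le_norm_of_nonneg_of_le (tensorForm_nonneg _ _)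
      (tensorForm_mulLeft_le (hu.strict i) x _)).trans_eq ?_
    rw [norm_smul, Complex.norm_real, Real.norm_of_nonneg (by positivity)]
  refine (le_of_sq_le_sq h1 (by positivity)).trans ?_
  gcongr
  exact ((S i).le_of_opNorm_le (hu.norm_S_le i) _).trans_eq (one_mul _)

/-- The left multiplication operators `Λ(a) b ↦ Λ(x a) b` in `𝓛(E)`. -/
theorem IsTruncatingNet.exists_leftAction (hu : IsTruncatingNet Λ u S ρ)
    (hN : ∀ x : A, ∀ a ∈ N, x * a ∈ N) (hd : DenseRange (lam Λ)) (x : A) :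
    ∃ P : adjointables B E, (∀ a b, P.1 (Λ a b) = Λ (leftMul hN x a) b) ∧
      ∀ a b, (star P).1 (Λ a b) = Λ (leftMul hN (star x) a) b := by
  -- All the operators are defined at once, because the adjoint of P x is P (star x).
  let P : A → E →L[ℂ] E := fun x => (lam Λ ∘ₗ (leftMul hN x).rTensor B).extendOfNorm (lam Λ)
  have hP : ∀ x t, P x (lam Λ t) = lam Λ ((leftMul hN x).rTensor B t) := fun x t =>
    LinearMap.extendOfNorm_eq hd ⟨‖x‖, fun t => hu.norm_lam_leftMul_le hN x t⟩ t
  have hadj : IsAdjointPair B (P x) (P (star x)) := fun v w => by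
    refine hd.induction_on₂ (p := fun v w => rinner B (P x v) w = rinner B v (P (star x) w)) ?_ ?_ v w
    · exact isClosed_eq (Continuous.rinner ((P x).continuous.comp continuous_fst) continuous_snd)
        (Continuous.rinner continuous_fst ((P (star x)).continuous.comp continuous_snd))
    · intro t t'
      rw [hP, hP, hu.rinner_leftMul]
  have hs : star (⟨P x, _, hadj⟩ : adjointables B E) = ⟨P (star x), _, hadj.symm⟩ :=
    adjointables.star_eq_of_isAdjointPair hadj
  exact ⟨⟨P x, _, hadj⟩, fun a b => hP x (a ⊗ₜ b), fun a b => by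
    rw [hs]; exact hP (star x) (a ⊗ₜ b)⟩

/-- Λ(a) is a priori only linear from B to E. Its truncation S_i*S_i Λ(a) is weakly controlled by
the bounded multipliers ρ_i(a₂* a), which suffices for the closed graph theorem. -/
theorem IsTruncatingNet.continuous_apply (hu : IsTruncatingNet Λ u S ρ)
    (hd : DenseRange (lam Λ)) (a : N) : Continuous (Λ a) := by
  refine (Λ a).continuous_of_seq_closed_graph fun b b₀ y hb hy => ?_
  -- Equality under S_i*S_i is tested against the vectors Λ(a₂)b₂; the inner product with y - Λ(a)b₀
  -- then removes the outer S_i*.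
  have key : ∀ i, S i y = S i (Λ a b₀) := fun i => by
    obtain ⟨R, hR, hi⟩ := hu.exists_implements i
    have h1 : (star R * R).1 y = (star R * R).1 (Λ a b₀) := by
      refine eq_of_rinner_lam hd fun a₂ b₂ => ?_
      refine tendsto_nhds_unique
        (tendsto_rinner (((star R * R).1.continuous.tendsto y).comp hy) tendsto_const_nhds) ?_
      rw [← hi]
      refine (((ContinuousLinearMap.continuous _).tendsto b₀ |>.comp hb).const_mul _).congr
        fun n => hi _ _ _ _
    rw [← sub_eq_zero, ← map_sub, ← hR, ← norm_eq_zero, ← sq_eq_zero_iff,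
      ← norm_rinner_self (B := B), ← adjointables.rinner_star_mul, map_sub, h1, sub_self,
      rinner_zero_left, norm_zero]
  refine tendsto_nhds_unique (hu.tendsto_S y) ?_
  simp only [key]
  exact hu.tendsto_S _

end Truncating

/-- `T` intertwines the left multiplications on the span of the elements `Λ(a) b`. -/
def Intertwines (hN : ∀ x : A, ∀ a ∈ N, x * a ∈ N) (Λ : N →ₗ[ℂ] B →ₗ[ℂ] E) (T : E →L[ℂ] E) : Prop :=
  ∀ (x : A) (a₁ a₂ : N) (b₁ b₂ : B), rinner B (T (Λ (leftMul hN x a₁) b₁)) (Λ a₂ b₂) =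
    rinner B (T (Λ a₁ b₁)) (Λ (leftMul hN (star x) a₂) b₂)

theorem Implements.intertwines {hN : ∀ x : A, ∀ a ∈ N, x * a ∈ N} {Λ : N →ₗ[ℂ] B →ₗ[ℂ] E}
    {ρ : A →CP 𝓜(ℂ, B)} {T : E →L[ℂ] E} (h : Implements Λ ρ T) : Intertwines hN Λ T :=
  fun x a₁ a₂ b₁ b₂ => by
    rw [← h, ← h]
    simp only [leftMul, LinearMap.coe_mk, AddHom.coe_mk, star_mul, star_star, mul_assoc]

theorem continuous_multiplier_fst (b : B) : Continuous fun m : 𝓜(ℂ, B) => m.fst b := by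
  refine AddMonoidHomClass.continuous_of_bound
    ({ toFun := fun m => m.fst b, map_zero' := rfl, map_add' := fun _ _ => rfl } : 𝓜(ℂ, B) →+ B)
    ‖b‖ fun m => ?_
  rw [mul_comm, ← DoubleCentralizer.norm_fst]
  exact m.fst.le_opNorm b

/-- Positivity of R gives the sum criterion for tuples in N, continuity of θ extends it to tuples in
A, and matrices V*V split into such sums. The same lemma serves for limits, differences and
multiples of maps. -/
theorem exists_cp_of_implements (hN : Dense (N : Set A)) {Λ : N →ₗ[ℂ] B →ₗ[ℂ] E}
    {θ : A →ₗ[ℂ] 𝓜(ℂ, B)} (hθ : Continuous θ) {R : E →L[ℂ] E} (hR : ∀ v, 0 ≤ rinner B (R v) v)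
    (h : ∀ (a₁ a₂ : N) (b₁ b₂ : B),
      star b₂ * (θ (star (a₂ : A) * a₁)).fst b₁ = rinner B (R (Λ a₁ b₁)) (Λ a₂ b₂)) :
    ∃ η : A →CP 𝓜(ℂ, B), ∀ a, η a = θ a := by
  have hsum : ∀ (n : ℕ) (b : Fin n → B) (a : Fin n → A),
      0 ≤ ∑ i, ∑ j, star (b i) * (θ (star (a i) * a j)).fst (b j) := by
    intro n b a
    have hcl : IsClosed {a : Fin n → A |
        0 ≤ ∑ i, ∑ j, star (b i) * (θ (star (a i) * a j)).fst (b j)} := by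
      refine isClosed_le continuous_const ?_
      refine continuous_finsetSum _ fun i _ => continuous_finsetSum _ fun j _ => ?_
      refine continuous_const.mul ((continuous_multiplier_fst _).comp (hθ.comp ?_))
      exact (continuous_apply i).star.mul (continuous_apply j)
    have hdense : Dense (Set.univ.pi fun _ : Fin n => (N : Set A)) := dense_pi _ fun _ _ => hN
    refine hdense.induction (P := fun a => 0 ≤ ∑ i, ∑ j, star (b i) *
      (θ (star (a i) * a j)).fst (b j)) (fun a ha => ?_) hcl a
    have ha' : ∀ i, a i ∈ N := fun i => ha i (Set.mem_univ i)
    refine (hR (∑ i, Λ ⟨a i, ha' i⟩ (b i))).trans_eq ?_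
    rw [← rinnerForm_apply]
    simp only [map_sum, LinearMap.sum_apply, rinnerForm_apply, ← h]
    exact Finset.sum_comm
  refine ⟨⟨θ, fun n M hM => matrix_nonneg_of_form fun b => ?_⟩, fun a => rfl⟩
  change 0 ≤ ∑ i, ∑ j, star (b i) * (θ (M i j)).fst (b j)
  rw [StarOrderedRing.nonneg_iff] at hM
  induction hM using AddSubmonoid.closure_induction with
  | zero =>
    refine (Finset.sum_eq_zero fun i _ => Finset.sum_eq_zero fun j _ => ?_).ge
    change star (b i) * (θ 0).fst (b j) = 0
    rw [map_zero]
    exact mul_zero _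
  | add M M' _ _ h1 h2 =>
    refine (add_nonneg h1 h2).trans_eq ?_
    simp only [← Finset.sum_add_distrib, ← mul_add]
    refine Finset.sum_congr rfl fun i _ => Finset.sum_congr rfl fun j _ => ?_
    change _ = star (b i) * (θ (M i j + M' i j)).fst (b j)
    rw [map_add]; rfl
  | mem M hM =>
    -- Each row V k of the matrix contributes one double sum of the kind covered by `hsum`.
    obtain ⟨V, rfl⟩ := hM
    simp only [CStarMatrix.mul_apply, CStarMatrix.star_apply, map_sum, multiplier_fst_sum,
      Finset.mul_sum]
    have e2 : ∑ i, ∑ j, ∑ k, star (b i) * (θ (star (V k i) * V k j)).fst (b j) =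
        ∑ k, ∑ i, ∑ j, star (b i) * (θ (star (V k i) * V k j)).fst (b j) := by
      calc _ = ∑ i, ∑ k, ∑ j, star (b i) * (θ (star (V k i) * V k j)).fst (b j) :=
            Finset.sum_congr rfl fun i _ => Finset.sum_comm
        _ = _ := Finset.sum_comm
    rw [e2]
    exact Finset.sum_nonneg fun k _ => hsum n b (V k)

end GNS

/-! ### Convergence of bounded nets of operators on a dense set. -/

section LimitLemmas

theorem exists_tendsto_of_dense {V W ι : Type*} [NormedAddCommGroup V] [NormedSpace ℂ V]
    [NormedAddCommGroup W] [NormedSpace ℂ W] [CompleteSpace W] {l : Filter ι} [l.NeBot]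
    {T : ι → V →ₗ[ℂ] W} {K : ℝ} (hT : ∀ᶠ i in l, ∀ x, ‖T i x‖ ≤ K * ‖x‖) {s : Set V}
    (hs : Dense s) (h : ∀ x ∈ s, ∃ y, Tendsto (fun i => T i x) l (𝓝 y)) (x : V) :
    ∃ y, Tendsto (fun i => T i x) l (𝓝 y) := by
  refine CompleteSpace.complete (Metric.cauchy_iff.2 ⟨inferInstance, fun ε hε => ?_⟩)
  have hK : 0 < 4 * (|K| + 1) := by positivity
  obtain ⟨z, hz, hd⟩ := hs.exists_dist_lt x (ε := ε / (4 * (|K| + 1))) (by positivity)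
  obtain ⟨y, hy⟩ := h z hz
  have hev : ∀ᶠ i in l, ‖T i x - y‖ < ε / 2 := by
    filter_upwards [hT, Metric.tendsto_nhds.1 hy (ε / 4) (by positivity)] with i hi hi'
    rw [dist_eq_norm] at hi' hd
    have h1 : ‖T i (x - z)‖ ≤ ε / 4 := by
      refine (hi _).trans ?_
      calc K * ‖x - z‖ ≤ (|K| + 1) * (ε / (4 * (|K| + 1))) := by
            gcongr
            linarith [le_abs_self K]
        _ = ε / 4 := by field_simp
    calc ‖T i x - y‖ = ‖T i (x - z) + (T i z - y)‖ := by rw [map_sub]; abel_nf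
      _ ≤ ‖T i (x - z)‖ + ‖T i z - y‖ := norm_add_le _ _
      _ < ε / 2 := by linarith
  refine ⟨_, image_mem_map hev, ?_⟩
  rintro _ ⟨i, hi, rfl⟩ _ ⟨j, hj, rfl⟩
  have h1 : dist (T i x) y < ε / 2 := by rw [dist_eq_norm]; exact hi
  have h2 : dist (T j x) y < ε / 2 := by rw [dist_eq_norm]; exact hj
  exact (dist_triangle_right _ _ y).trans_lt (by linarith)

end LimitLemmas

/-! ### Constructing and estimating multipliers. -/

section Multipliers

variable {B : Type*} [NonUnitalCStarAlgebra B]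

/-- The centrality relation alone forces linearity of L and R, and continuity by the closed graph
theorem, since products separate the points of B. -/
theorem exists_multiplier (L R : B → B) (central : ∀ x y, R x * y = x * L y) :
    ∃ m : 𝓜(ℂ, B), ∀ x, m.fst x = L x := by
  have eq_of_mul_right : ∀ {x y : B}, (∀ z, x * z = y * z) → x = y := fun {x y} h => by
    rw [← star_inj]
    exact eq_of_mul_left fun z => by rw [← star_star z, ← star_mul, ← star_mul, h]
  let L' : B →ₗ[ℂ] B :=
    { toFun := L
      map_add' := fun x y => eq_of_mul_left fun z => by
        rw [← central, mul_add, mul_add, central, central]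
      map_smul' := fun c x => eq_of_mul_left fun z => by
        rw [← central, mul_smul_comm, central, RingHom.id_apply, mul_smul_comm] }
  let R' : B →ₗ[ℂ] B :=
    { toFun := R
      map_add' := fun x y => eq_of_mul_right fun z => by
        rw [central, add_mul, add_mul, central, central]
      map_smul' := fun c x => eq_of_mul_right fun z => by
        rw [central, smul_mul_assoc, ← central, RingHom.id_apply, smul_mul_assoc] }
  have cL : Continuous L' := L'.continuous_of_seq_closed_graph fun u x y hu hy => by
    refine eq_of_mul_left fun z => ?_
    refine tendsto_nhds_unique (hy.const_mul z) ?_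
    change Tendsto (fun n => z * L (u n)) atTop (𝓝 (z * L x))
    simp_rw [← central]
    exact hu.const_mul _
  have cR : Continuous R' := R'.continuous_of_seq_closed_graph fun u x y hu hy => by
    refine eq_of_mul_right fun z => ?_
    refine tendsto_nhds_unique (hy.mul_const z) ?_
    change Tendsto (fun n => R (u n) * z) atTop (𝓝 (R x * z))
    simp_rw [central]
    exact hu.mul_const _
  exact ⟨⟨(⟨L', cL⟩, ⟨R', cR⟩), central⟩, fun x => rfl⟩

theorem multiplier_ext_form {m m' : 𝓜(ℂ, B)}
    (h : ∀ b₁ b₂, star b₂ * m.fst b₁ = star b₂ * m'.fst b₁) : m = m' :=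
  multiplier_ext_fst fun b => eq_of_mul_left fun z => by rw [← star_star z, h]

/-- Take c = m b and cancel ‖m b‖². -/
theorem norm_fst_le_of_form {m : 𝓜(ℂ, B)} {b : B} {K : ℝ} (hK : 0 ≤ K)
    (h : ∀ c, ‖star c * m.fst b‖ ^ 2 ≤ K * ‖c‖ ^ 2) : ‖m.fst b‖ ^ 2 ≤ K := by
  have h1 := h (m.fst b)
  rw [CStarRing.norm_star_mul_self] at h1
  rcases (norm_nonneg (m.fst b)).eq_or_lt with h0 | h0
  · rw [← h0]; simpa using hK
  · refine le_of_mul_le_mul_right (?_ : _ * ‖m.fst b‖ ^ 2 ≤ K * ‖m.fst b‖ ^ 2) (by positivity)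
    calc _ = (‖m.fst b‖ * ‖m.fst b‖) ^ 2 := by ring
      _ ≤ _ := h1

theorem multiplier_norm_le_of_form {m : 𝓜(ℂ, B)} {K : ℝ} (hK : 0 ≤ K)
    (h : ∀ b c, ‖star c * m.fst b‖ ^ 2 ≤ K ^ 2 * ‖b‖ ^ 2 * ‖c‖ ^ 2) : ‖m‖ ≤ K := by
  rw [← DoubleCentralizer.norm_fst]
  refine m.fst.opNorm_le_bound hK fun b => ?_
  refine le_of_sq_le_sq ?_ (by positivity)
  rw [mul_pow]
  exact norm_fst_le_of_form (by positivity) (h b)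

theorem norm_fst_apply_le (m : 𝓜(ℂ, B)) (b : B) : ‖m.fst b‖ ≤ ‖m‖ * ‖b‖ := by
  rw [← DoubleCentralizer.norm_fst]
  exact m.fst.le_opNorm b

end Multipliers

/-! ### Strictness by domination. -/

section Strictness

variable {A B : Type*} [NonUnitalCStarAlgebra A] [PartialOrder A] [StarOrderedRing A]
  [NonUnitalCStarAlgebra B] [PartialOrder B] [StarOrderedRing B]

/-- A completely positive map that is dominated by a strict map is strict. -/
theorem isStrict_of_norm_le {ρ : A →CP 𝓜(ℂ, B)} {f : 𝓜(ℂ, A) →ₗ[ℂ] 𝓜(ℂ, B)}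
    (hf : StrictlyContinuousOnBounded f) {K : ℝ}
    (h : ∀ x b, ‖(ρ x).fst b‖ ^ 2 ≤ K * ‖star b *
      (f (star (DoubleCentralizer.coe ℂ x) * DoubleCentralizer.coe ℂ x)).fst b‖) :
    IsStrict ρ := by
  intro r a ha
  change Tendsto ρ _ _
  set l := @nhdsWithin A (TopologicalSpace.induced (DoubleCentralizer.coe ℂ)
    (strictTopology A)) a {a | ‖a‖ ≤ r} with hl
  have hid : Tendsto (fun x => DoubleCentralizer.coe ℂ x) l
      (@nhds _ (strictTopology A) (DoubleCentralizer.coe ℂ a)) := by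
    refine Tendsto.mono_left ?_ (inf_le_left : l ≤ _)
    rw [@nhds_induced _ _ (strictTopology A)]
    exact tendsto_comap
  have hsub : Tendsto (fun x => DoubleCentralizer.coe ℂ (x - a)) l
      (@nhds _ (strictTopology A) 0) := by
    have h1 := tendsto_strict_sub hid (tendsto_strict_iff.2
      ⟨fun _ => tendsto_const_nhds, fun _ => tendsto_const_nhds⟩ : Tendsto (fun _ =>
        DoubleCentralizer.coe ℂ a) l (@nhds _ (strictTopology A) (DoubleCentralizer.coe ℂ a)))
    rw [sub_self] at h1
    refine h1.congr fun x => ?_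
    exact (map_sub (DoubleCentralizer.coeHom (𝕜 := ℂ)) x a).symm
  have hb : ∀ᶠ x in l, ‖x - a‖ ≤ r + r := by
    filter_upwards [@self_mem_nhdsWithin _ (TopologicalSpace.induced (DoubleCentralizer.coe ℂ)
      (strictTopology A)) a {a | ‖a‖ ≤ r}] with x hx
    exact (norm_sub_le _ _).trans (add_le_add hx ha)
  -- The domination only controls the left action of ρ(x). The statement is kept general in g so
  -- that it applies to x - a and also to its adjoint.
  have lim : ∀ g : A → A, (∀ x, ‖g x‖ = ‖x - a‖) → Tendsto (fun x => DoubleCentralizer.coe ℂ (g x)) l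
      (@nhds _ (strictTopology A) 0) → ∀ b, Tendsto (fun x => (ρ (g x)).fst b) l (𝓝 0) := by
    intro g hgn hg b
    have h2 := hf.tendsto_star_mul (r := r + r) hg (by
      filter_upwards [hb] with x hx
      exact (norm_coe_le _).trans ((hgn x).trans_le hx)) b
    rw [mul_zero, map_zero, DoubleCentralizer.zero_fst, zero_apply, mul_zero] at h2
    have h3 := (h2.norm.const_mul K)
    rw [norm_zero, mul_zero] at h3
    have h4 : Tendsto (fun x => ‖(ρ (g x)).fst b‖ ^ 2) l (𝓝 0) :=
      squeeze_zero (fun x => by positivity) (fun x => h (g x) b) h3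
    rw [tendsto_zero_iff_norm_tendsto_zero]
    have h5 := h4.sqrt
    simpa only [Real.sqrt_sq (norm_nonneg _), Real.sqrt_zero] using h5
  rw [tendsto_strict_iff]
  constructor
  · intro b
    have h1 := lim (fun x => x - a) (fun _ => rfl) hsub b
    rw [← tendsto_sub_nhds_zero_iff]
    refine h1.congr fun x => ?_
    rw [map_sub, DoubleCentralizer.sub_fst]; rfl
  · intro b
    -- The right action is the left action of the adjoint, because ρ preserves adjoints.
    have h1 := lim (fun x => star (x - a)) (fun _ => norm_star _) (by
      have := tendsto_strict_star hsub
      rw [star_zero] at this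
      simpa only [coe_star] using this) (star b)
    have h2 := h1.star
    rw [star_zero] at h2
    rw [← tendsto_sub_nhds_zero_iff]
    refine h2.congr fun x => ?_
    rw [map_star ρ, DoubleCentralizer.star_fst, star_star, star_star, map_sub,
      DoubleCentralizer.sub_snd]; rfl

end Strictness

/-! ### From a positive operator to a strict completely positive map. -/

section Construction

variable {A B E : Type*} [NonUnitalCStarAlgebra A] [PartialOrder A] [StarOrderedRing A]
  [NonUnitalCStarAlgebra B] [PartialOrder B] [StarOrderedRing B]
  [NormedAddCommGroup E] [NormedSpace ℂ E] [SMul Bᵐᵒᵖ E] [CStarModule Bᵐᵒᵖ E] [CompleteSpace E]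
  {N : Submodule ℂ A} {Λ : N →ₗ[ℂ] B →ₗ[ℂ] E}

/-- `T Λ(a) : B → E` is adjointable for all `a ∈ N`. -/
def HasAdjoints (Λ : N →ₗ[ℂ] B →ₗ[ℂ] E) (T : E →L[ℂ] E) : Prop :=
  ∀ (a : N) (w : E), ∃ p : B, ∀ b, star b * p = rinner B w (T (Λ a b))

theorem adjointables.rinner_of_nonneg {T : adjointables B E} (hT : 0 ≤ T) (v w : E) :
    rinner B (T.1 v) w = rinner B v (T.1 w) := by
  rw [adjointables.rinner_star, (IsSelfAdjoint.of_nonneg hT).star_eq]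

/-- The multiplier is Λ(a₂)* T Λ(a₁), read as (TΛ(a₂))* Λ(a₁) with right action x ↦ ((TΛ(a₁))* Λ(a₂)
x*)*. Only the composites TΛ(a) need adjoints, not Λ(a) itself. -/
theorem HasAdjoints.exists_multiplier {T : adjointables B E} (hT : 0 ≤ T)
    (h : HasAdjoints Λ T.1) (a₁ a₂ : N) :
    ∃ m : 𝓜(ℂ, B), ∀ b₁ b₂, star b₂ * m.fst b₁ = rinner B (T.1 (Λ a₁ b₁)) (Λ a₂ b₂) := by
  choose p hp using h
  obtain ⟨m, hm⟩ := CStarWeight.exists_multiplier (fun b => p a₂ (Λ a₁ b))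
    (fun x => star (p a₁ (Λ a₂ (star x)))) (fun x y => by
      rw [← star_star y, ← star_mul, hp, star_rinner, star_star, adjointables.rinner_of_nonneg hT,
        ← hp, star_star])
  refine ⟨m, fun b₁ b₂ => ?_⟩
  rw [hm, hp, adjointables.rinner_of_nonneg hT]

theorem HasAdjoints.exists_form {T : adjointables B E} (hT : 0 ≤ T) (h : HasAdjoints Λ T.1) :
    ∃ r : N →ₗ⋆[ℂ] N →ₗ[ℂ] 𝓜(ℂ, B), ∀ a₁ a₂ b₁ b₂,
      star b₂ * (r a₂ a₁).fst b₁ = rinner B (T.1 (Λ a₁ b₁)) (Λ a₂ b₂) := by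
  choose r hr using h.exists_multiplier hT
  refine ⟨LinearMap.mk₂'ₛₗ (starRingEnd ℂ) (RingHom.id ℂ) (fun a₂ a₁ => r a₁ a₂) ?_ ?_ ?_ ?_,
    fun a₁ a₂ b₁ b₂ => hr a₁ a₂ b₁ b₂⟩
  · intro a a' c
    refine multiplier_ext_form fun b₁ b₂ => ?_
    rw [DoubleCentralizer.add_fst, add_apply, mul_add, hr, hr, hr, map_add, LinearMap.add_apply,
      rinner_add_right]
  · intro z a c
    refine multiplier_ext_form fun b₁ b₂ => ?_
    rw [DoubleCentralizer.smul_fst, smul_apply, mul_smul_comm, hr, hr, map_smul,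
      LinearMap.smul_apply, rinner_smul_right]
    rfl
  · intro c a a'
    refine multiplier_ext_form fun b₁ b₂ => ?_
    rw [DoubleCentralizer.add_fst, add_apply, mul_add, hr, hr, hr, map_add, LinearMap.add_apply,
      map_add, rinner_add_left]
  · intro z c a
    refine multiplier_ext_form fun b₁ b₂ => ?_
    rw [DoubleCentralizer.smul_fst, smul_apply, mul_smul_comm, hr, hr, map_smul,
      LinearMap.smul_apply, map_smul, rinner_smul_left]
    rfl

theorem exists_continuous_extension (hN : Dense (N : Set A)) {r : N →ₗ⋆[ℂ] N →ₗ[ℂ] 𝓜(ℂ, B)} {C : ℝ}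
    (hr : ∀ a c, ‖r a c‖ ≤ C * ‖a‖ * ‖c‖) :
    ∃ R : A × A → 𝓜(ℂ, B), Continuous R ∧ ∀ a c : N, R (a, c) = r a c := by
  let f : N →+ N →+ 𝓜(ℂ, B) :=
    { toFun := fun a => (r a).toAddMonoidHom
      map_zero' := AddMonoidHom.ext fun x => LinearMap.congr_fun (map_zero r) x
      map_add' := fun x y => AddMonoidHom.ext fun z => LinearMap.congr_fun (map_add r x y) z }
  let rL : N →L⋆[ℂ] N →L[ℂ] 𝓜(ℂ, B) := LinearMap.mkContinuous₂ r C hr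
  have hf : Continuous fun p : N × N => f p.1 p.2 := by
    have : Continuous fun p : N × N => rL p.1 p.2 := by fun_prop
    exact this
  have hdi : IsDenseInducing (N.subtype : N →+ A) :=
    ⟨⟨rfl⟩, by simpa [DenseRange] using hN⟩
  exact ⟨_, hdi.extend_Z_bilin hdi hf, fun a c => (hdi.prodMap hdi).extend_eq hf (a, c)⟩

theorem dense_mul (A : Type*) [NonUnitalCStarAlgebra A] [PartialOrder A] [StarOrderedRing A] :
    Dense {x : A | ∃ y z, x = star z * y} := fun x =>
  mem_closure_of_tendsto ((CStarAlgebra.increasingApproximateUnit A).tendsto_mul_right x)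
    (Eventually.of_forall fun e => ⟨x, star e, by rw [star_star]⟩)

/-- A positive operator `T` that commutes with the left multiplications is implemented by a strict
completely positive map, provided that `T Λ(a)` is always adjointable and that `T` is dominated
by a strict map. -/
theorem exists_strict_implements (hN : ∀ x : A, ∀ a ∈ N, x * a ∈ N) (hNd : Dense (N : Set A))
    {T : adjointables B E} (hT : 0 ≤ T) (hi : Intertwines hN Λ T.1)
    (hadj : HasAdjoints Λ T.1) {f : 𝓜(ℂ, A) →ₗ[ℂ] 𝓜(ℂ, B)} (hf : StrictlyContinuousOnBounded f)
    {C : ℝ} (hC : 0 ≤ C) (hfC : ∀ a : A, ‖f (DoubleCentralizer.coe ℂ a)‖ ≤ C * ‖a‖)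
    (hdom : ∀ (a : N) b, ‖rinner B (T.1 (Λ a b)) (Λ a b)‖ ≤ ‖star b *
      (f (star (DoubleCentralizer.coe ℂ (a : A)) * DoubleCentralizer.coe ℂ (a : A))).fst b‖) :
    ∃ ρ : A →CP 𝓜(ℂ, B), IsStrict ρ ∧ Implements Λ ρ T.1 := by
  obtain ⟨r, hr⟩ := hadj.exists_form hT
  have hdom' : ∀ (a : N) b, ‖rinner B (T.1 (Λ a b)) (Λ a b)‖ ≤ C * ‖a‖ ^ 2 * ‖b‖ ^ 2 :=
    fun a b => by
      refine (hdom a b).trans ?_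
      rw [← coe_star, ← coe_mul]
      calc _ ≤ ‖star b‖ * ((C * (‖star (a : A)‖ * ‖(a : A)‖)) * ‖b‖) := by
            refine (norm_mul_le _ _).trans ?_
            gcongr
            refine (norm_fst_apply_le _ _).trans ?_
            gcongr
            refine (hfC _).trans ?_
            gcongr
            exact norm_mul_le _ _
        _ = _ := by rw [norm_star, norm_star]; change _ = C * ‖(a : A)‖ ^ 2 * _; ring
  have hrb : ∀ a c, ‖r a c‖ ≤ C * ‖a‖ * ‖c‖ := fun a c => by
    refine multiplier_norm_le_of_form (by positivity) fun b d => ?_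
    rw [hr]
    refine (adjointables.norm_rinner_sq_le hT _ _).trans ?_
    calc _ ≤ (C * ‖c‖ ^ 2 * ‖b‖ ^ 2) * (C * ‖a‖ ^ 2 * ‖d‖ ^ 2) := by
          gcongr
          · exact hdom' _ _
          · exact hdom' _ _
      _ = _ := by ring
  obtain ⟨R, hRc, hR⟩ := exists_continuous_extension hNd hrb
  obtain ⟨e, heb, he⟩ := exists_bounded_net hNd (1 : 𝓜(ℂ, A))
  set l := CStarAlgebra.approximateUnit A ×ˢ (atTop : Filter ℕ) with hl
  set M := ‖(1 : 𝓜(ℂ, A))‖ + 1 with hM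
  have hM0 : 0 ≤ M := by positivity
  have hmul : ∀ x : A, Tendsto (fun k => x * (e k : A)) l (𝓝 x) := (tendsto_strict_iff.1 he).2
  -- The net e_k approximates 1 only strictly, so r(e_k, x e_k) has no evident norm limit. For x =
  -- z* y intertwining rewrites it as r(z e_k, y e_k), and z e_k, y e_k converge in norm.
  have hshift : ∀ (x y z : A) (hx : x = star z * y) (k : A × ℕ),
      r (e k) (leftMul hN x (e k)) = r (leftMul hN z (e k)) (leftMul hN y (e k)) := by
    rintro x y z rfl k
    have h1 : leftMul hN (star z * y) (e k) = leftMul hN (star z) (leftMul hN y (e k)) :=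
      Subtype.ext (mul_assoc _ _ _)
    refine multiplier_ext_form fun b₁ b₂ => ?_
    rw [hr, hr, h1, hi, star_star]
  have hprod : ∀ y z : A, Tendsto (fun k => r (e k) (leftMul hN (star z * y) (e k))) l
      (𝓝 (R (z, y))) := fun y z => by
    simp only [hshift _ y z rfl, ← hR]
    exact (hRc.tendsto (z, y)).comp ((hmul z).prodMk_nhds (hmul y))
  let ρk : A × ℕ → A →ₗ[ℂ] 𝓜(ℂ, B) := fun k => r (e k) ∘ₗ
    { toFun := fun x => leftMul hN x (e k)
      map_add' := fun x y => Subtype.ext (add_mul _ _ _)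
      map_smul' := fun c x => Subtype.ext (smul_mul_assoc _ _ _) }
  have hρkb : ∀ᶠ k in l, ∀ x, ‖ρk k x‖ ≤ (C * M * M) * ‖x‖ := by
    filter_upwards [heb] with k hk x
    have h1 : ‖leftMul hN x (e k)‖ ≤ ‖x‖ * M :=
      (norm_mul_le x (e k : A)).trans (by gcongr)
    calc ‖ρk k x‖ ≤ C * ‖e k‖ * ‖leftMul hN x (e k)‖ := hrb _ _
      _ ≤ C * M * (‖x‖ * M) := by gcongr; exact hk
      _ = _ := by ring
  -- Products z* y are dense in A, and the maps `ρk k` are eventually uniformly bounded, so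
  -- convergence extends to all x.
  have hex : ∀ x, ∃ y, Tendsto (fun k => ρk k x) l (𝓝 y) :=
    exists_tendsto_of_dense hρkb (dense_mul A) (by
      rintro _ ⟨y, z, rfl⟩
      exact ⟨_, hprod y z⟩)
  choose ρ hρ using hex
  let θ : A →ₗ[ℂ] 𝓜(ℂ, B) := linearMapOfTendsto ρ ρk (tendsto_pi_nhds.2 hρ)
  have hθ : ∀ x, Tendsto (fun k => r (e k) (leftMul hN x (e k))) l (𝓝 (θ x)) := hρ
  have hθc : Continuous θ := AddMonoidHomClass.continuous_of_bound θ (C * M * M) fun x =>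
    le_of_tendsto (hθ x).norm (hρkb.mono fun k hk => hk x)
  have himp : ∀ (a₁ a₂ : N) (b₁ b₂ : B), star b₂ * (θ (star (a₂ : A) * a₁)).fst b₁ =
      rinner B (T.1 (Λ a₁ b₁)) (Λ a₂ b₂) := fun a₁ a₂ b₁ b₂ => by
    rw [tendsto_nhds_unique (hθ _) (hprod a₁ a₂), hR, hr]
  obtain ⟨η, hη⟩ := exists_cp_of_implements hNd hθc (adjointables.nonneg_iff.1 hT) himp
  -- Cauchy–Schwarz for T at Λ(x e_k)b and Λ(e_k)c: the first factor is dominated by f at (x e_k)*(x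
  -- e_k), the second is at most C M² ‖c‖². Then pass to the limit in k.
  refine ⟨η, isStrict_of_norm_le hf (K := C * M ^ 2) fun x b => ?_, fun a₁ a₂ b₁ b₂ => by
    rw [hη, himp]⟩
  refine norm_fst_le_of_form (by positivity) fun c => ?_
  rw [hη]
  have hl1 : Tendsto (fun k => ‖star c * (r (e k) (leftMul hN x (e k))).fst b‖ ^ 2) l
      (𝓝 (‖star c * (θ x).fst b‖ ^ 2)) :=
    ((((continuous_multiplier_fst b).tendsto _).comp (hθ x)).const_mul _).norm.pow 2
  have hl2 := ((hf.tendsto_star_mul (l := l) (g := fun k => DoubleCentralizer.coe ℂ (x * (e k : A)))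
    (m := DoubleCentralizer.coe ℂ x) (r := ‖x‖ * M) (tendsto_strict_iff.2 ⟨fun y => ?_, fun y => ?_⟩)
    (heb.mono fun k hk => (norm_coe_le _).trans ((norm_mul_le _ _).trans (by gcongr))) b).norm.const_mul
      (C * M ^ 2)).mul_const (‖c‖ ^ 2)
  · refine le_of_tendsto_of_tendsto hl1 hl2 ?_
    filter_upwards [heb] with k hk
    rw [hr]
    refine (adjointables.norm_rinner_sq_le hT _ _).trans ?_
    calc _ ≤ ‖star b * (f (star (DoubleCentralizer.coe ℂ (x * (e k : A))) *
            DoubleCentralizer.coe ℂ (x * (e k : A)))).fst b‖ * (C * M ^ 2 * ‖c‖ ^ 2) := by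
          gcongr
          · exact hdom (leftMul hN x (e k)) b
          · refine (hdom' _ _).trans ?_
            gcongr
            exact hk
      _ = _ := by ring
  · exact ((hmul x).mul_const y)
  · have := ((hmul x).const_mul y)
    exact this

end Construction

/-- The map a ↦ (1-a)⁻¹ - 1 and its inverse preserve order; it takes positive elements of norm < 1
to positive elements. There a sum is an upper bound, and carrying it back gives t = 1 - s⁻¹ with s =
(1-a)⁻¹ + (1-b)⁻¹ - 1. The left coefficients x, y, the domination by a and b, and the commutation
property make t usable as the operator of a strict map. -/
theorem exists_le_of_norm_lt_one {R : Type*} [CStarAlgebra R] [PartialOrder R] [StarOrderedRing R]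
    {a b : R} (ha : 0 ≤ a) (ha1 : ‖a‖ < 1) (hb : 0 ≤ b) (hb1 : ‖b‖ < 1) :
    ∃ t x y : R, ∃ c d : ℝ, 0 ≤ t ∧ ‖t‖ < 1 ∧ a ≤ t ∧ b ≤ t ∧ t = x * a + y * b ∧ 0 ≤ c ∧ 0 ≤ d ∧
      t ≤ (c : ℂ) • a + (d : ℂ) • b ∧ ∀ z, Commute z a → Commute z b → Commute z t := by
  have hinv : ∀ {a : R}, 0 ≤ a → ‖a‖ < 1 → ∃ v : Rˣ, (v : R) = 1 - a ∧ 0 ≤ (v : R) ∧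
      (1 : R) ≤ ↑v⁻¹ ∧ (↑v⁻¹ : R) - 1 = ↑v⁻¹ * a ∧
      ∃ c : ℝ, 0 ≤ c ∧ (↑v⁻¹ : R) - 1 ≤ (c : ℂ) • a := by
    intro a ha ha1
    have hle : a ≤ 1 := CStarAlgebra.norm_le_one_iff_of_nonneg a ha |>.1 ha1.le
    set v := Units.oneSub a ha1 with hv
    have hv1 : (v : R) = 1 - a := rfl
    have hv0 : 0 ≤ (v : R) := by rw [hv1]; exact sub_nonneg.2 hle
    have he : (↑v⁻¹ : R) - 1 = ↑v⁻¹ * a := by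
      have h1 : (↑v⁻¹ : R) * v = 1 := v.inv_mul
      rw [hv1, mul_sub, mul_one] at h1
      linear_combination (norm := abel) h1
    have hv1' : (1 : R) ≤ ↑v⁻¹ :=
      (CStarAlgebra.one_le_inv_iff_le_one hv0).2 (by
        rw [← Units.val_le_val, Units.val_one, hv1]; exact sub_le_self _ ha)
    refine ⟨v, hv1, hv0, hv1', he, ‖(↑v⁻¹ : R)‖, norm_nonneg _, ?_⟩
    have hvs : IsSelfAdjoint (↑v⁻¹ : R) := IsSelfAdjoint.of_nonneg (zero_le_one.trans hv1')
    have h2 : 0 ≤ algebraMap ℝ R ‖(↑v⁻¹ : R)‖ - ↑v⁻¹ := sub_nonneg.2 hvs.le_algebraMap_norm_self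
    have hc : Commute (↑v⁻¹ : R) a := by
      refine Commute.units_inv_left ?_
      rw [hv1]
      exact (Commute.one_left a).sub_left (Commute.refl a)
    -- The commuting positive elements ‖v⁻¹‖ - v⁻¹ and a have a positive product, so v⁻¹ - 1 = v⁻¹ a
    -- ≤ ‖v⁻¹‖ a.
    have h3 := Commute.mul_nonneg h2 ha ((Algebra.commute_algebraMap_left _ _).sub_left hc)
    rw [sub_mul, sub_nonneg, ← he] at h3
    refine h3.trans_eq ?_
    rw [Algebra.algebraMap_eq_smul_one, smul_mul_assoc, one_mul]
    norm_cast
  obtain ⟨v, hv, hv0, hv1, hve, c, hc0, hc⟩ := hinv ha ha1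
  obtain ⟨w, hw, hw0, hw1, hwe, d, hd0, hd⟩ := hinv hb hb1
  have hs1 : (1 : R) ≤ ↑v⁻¹ + ↑w⁻¹ - 1 := by
    rw [add_sub_assoc]
    exact hv1.trans (le_add_of_nonneg_right (sub_nonneg.2 hw1))
  obtain ⟨s, hs⟩ := CStarAlgebra.isUnit_of_le 1 hs1
  rw [← hs] at hs1
  have hs0 : 0 ≤ (s : R) := zero_le_one.trans hs1
  have hvi0 : 0 ≤ (↑v⁻¹ : R) := zero_le_one.trans hv1
  have hwi0 : 0 ≤ (↑w⁻¹ : R) := zero_le_one.trans hw1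
  have hsv : (↑s⁻¹ : R) ≤ v := by
    have := CStarAlgebra.inv_le_inv (a := v⁻¹) (b := s) hvi0 (by
      rw [hs, add_sub_assoc]; exact le_add_of_nonneg_right (sub_nonneg.2 hw1))
    rwa [inv_inv] at this
  have hsw : (↑s⁻¹ : R) ≤ w := by
    have := CStarAlgebra.inv_le_inv (a := w⁻¹) (b := s) hwi0 (by
      rw [hs, add_comm (↑v⁻¹ : R), add_sub_assoc]
      exact le_add_of_nonneg_right (sub_nonneg.2 hv1))
    rwa [inv_inv] at this
  have hsi : (↑s⁻¹ : R) ≤ 1 := CStarAlgebra.inv_le_one hs1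
  have hsi0 : 0 ≤ (↑s⁻¹ : R) := CFC.inv_nonneg_of_nonneg s hs0
  have ht0 : 0 ≤ 1 - (↑s⁻¹ : R) := sub_nonneg.2 hsi
  have hss : (↑s⁻¹ : R) * s = 1 := s.inv_mul
  have hs1' : (s : R) - 1 = (↑v⁻¹ - 1) + (↑w⁻¹ - 1) := by rw [hs]; abel
  refine ⟨1 - ↑s⁻¹, ↑s⁻¹ * ↑v⁻¹, ↑s⁻¹ * ↑w⁻¹, c, d, ht0, ?_, ?_, ?_, ?_, hc0, hd0, ?_, ?_⟩
  -- From s ≤ k follows 1 - s⁻¹ ≤ 1 - 1/k, a scalar < 1; the summand 1 keeps k positive and at least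
  -- 1.
  · set k : ℝ := ‖(s : R)‖ + 1 with hk
    have hk0 : 0 < k := by positivity
    let κ : Rˣ := Units.map (algebraMap ℝ R) (Units.mk0 k hk0.ne')
    have hκ : (κ : R) = algebraMap ℝ R k := rfl
    have hκi : (↑κ⁻¹ : R) = algebraMap ℝ R k⁻¹ := rfl
    have h1 : (s : R) ≤ κ := by
      rw [hκ]
      exact (IsSelfAdjoint.of_nonneg hs0).le_algebraMap_norm_self.trans
        (algebraMap_mono _ (by linarith))
    have h2 := CStarAlgebra.inv_le_inv hs0 h1
    have h3 : 1 - (↑s⁻¹ : R) ≤ algebraMap ℝ R (1 - k⁻¹) := by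
      rw [map_sub, map_one]
      exact sub_le_sub_left (hκi ▸ h2) _
    have hk1 : 0 ≤ 1 - k⁻¹ := by
      rw [sub_nonneg]; exact inv_le_one_of_one_le₀ (by linarith [norm_nonneg (s : R)])
    refine lt_of_le_of_lt ((CStarAlgebra.norm_le_iff_le_algebraMap _ hk1 ht0).2 h3) ?_
    have : 0 < k⁻¹ := by positivity
    linarith
  · rw [le_sub_comm, ← hv]; exact hsv
  · rw [le_sub_comm, ← hw]; exact hsw
  · rw [mul_assoc, mul_assoc, ← hve, ← hwe, ← mul_add, ← hs1', mul_sub, hss, mul_one]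
  -- The difference of the two sides is (s-1) s⁻¹ (s-1).
  · have h1 : 1 - (↑s⁻¹ : R) ≤ s - 1 := by
      have h2 : 0 ≤ star ((s : R) - 1) * ↑s⁻¹ * ((s : R) - 1) := star_left_conjugate_nonneg hsi0 _
      have h3 : star ((s : R) - 1) = s - 1 := (IsSelfAdjoint.of_nonneg (sub_nonneg.2 hs1)).star_eq
      rw [← sub_nonneg]
      refine h2.trans_eq ?_
      rw [h3, mul_assoc, mul_sub, hss, sub_mul, mul_sub]
      simp only [mul_one, one_mul, s.mul_inv]
    exact h1.trans (hs1' ▸ add_le_add hc hd)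
  · intro z hza hzb
    have hzv : Commute z (↑v⁻¹ : R) := Commute.units_inv_right (by
      rw [hv]; exact (Commute.one_right z).sub_right hza)
    have hzw : Commute z (↑w⁻¹ : R) := Commute.units_inv_right (by
      rw [hw]; exact (Commute.one_right z).sub_right hzb)
    refine (Commute.one_right z).sub_right (Commute.units_inv_right ?_)
    rw [hs]
    exact (hzv.add_right hzw).sub_right (Commute.one_right z)

/-! ### Directedness of 𝓖. -/

section Directed

variable {A B E : Type*} [NonUnitalCStarAlgebra A] [PartialOrder A] [StarOrderedRing A]
  [NonUnitalCStarAlgebra B] [PartialOrder B] [StarOrderedRing B]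
  [NormedAddCommGroup E] [NormedSpace ℂ E] [SMul Bᵐᵒᵖ E] [CStarModule Bᵐᵒᵖ E] [CompleteSpace E]
  {N : Submodule ℂ A} {Λ : N →ₗ[ℂ] B →ₗ[ℂ] E}

/-- The adjoint of TΛ(a) sends Λ(a₂)b₂ to ρ(a* a₂)b₂. It is bounded by ‖T‖ ‖Λ(a)‖ on the dense
range, hence extends to E. -/
theorem Implements.hasAdjoints (hd : DenseRange (lam Λ)) (hΛ : ∀ a, Continuous (Λ a))
    {ρ : A →CP 𝓜(ℂ, B)} {T : adjointables B E} (hT : 0 ≤ T) (h : Implements Λ ρ T.1) :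
    HasAdjoints Λ T.1 := by
  intro a
  let La : B →L[ℂ] E := ⟨Λ a, hΛ a⟩
  let g : N ⊗[ℂ] B →ₗ[ℂ] B := TensorProduct.lift (LinearMap.mk₂ ℂ
    (fun a₂ b₂ => (ρ (star (a : A) * a₂)).fst b₂)
    (fun x y b => by
      rw [Submodule.coe_add, mul_add, map_add, DoubleCentralizer.add_fst, add_apply])
    (fun c x b => by
      rw [Submodule.coe_smul, mul_smul_comm, map_smul, DoubleCentralizer.smul_fst, smul_apply])
    (fun x b b' => map_add _ _ _) (fun c x b => map_smul _ _ _))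
  have hg : ∀ t b, star b * g t = rinner B (lam Λ t) (T.1 (Λ a b)) := by
    intro t b
    induction t using TensorProduct.induction_on with
    | zero => rw [map_zero, map_zero, rinner_zero_left, mul_zero]
    | add s t hs ht => rw [map_add, map_add, rinner_add_left, mul_add, hs, ht]
    | tmul a₂ b₂ =>
      rw [lam_tmul, ← adjointables.rinner_of_nonneg hT, ← h]
      rfl
  have hgb : ∀ t, ‖g t‖ ≤ (‖T.1‖ * ‖La‖) * ‖lam Λ t‖ := fun t => by
    rcases (norm_nonneg (g t)).eq_or_lt with h0 | h0
    · rw [← h0]; positivity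
    · refine le_of_mul_le_mul_right ?_ h0
      rw [← CStarRing.norm_star_mul_self, hg]
      refine (norm_rinner_le _ _).trans ?_
      calc _ ≤ ‖lam Λ t‖ * (‖T.1‖ * (‖La‖ * ‖g t‖)) := by
            gcongr
            refine (T.1.le_opNorm _).trans ?_
            gcongr
            exact La.le_opNorm _
        _ = _ := by ring
  intro w
  refine ⟨g.extendOfNorm (lam Λ) w, fun b => ?_⟩
  refine hd.induction_on (p := fun w => star b * g.extendOfNorm (lam Λ) w =
    rinner B w (T.1 (Λ a b))) w ?_ fun t => ?_
  · exact isClosed_eq (continuous_const.mul (ContinuousLinearMap.continuous _))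
      (Continuous.rinner continuous_id continuous_const)
  · rw [LinearMap.extendOfNorm_eq hd ⟨_, hgb⟩, hg]

/-- The adjoint of (XT + YR)Λ(a) is (TΛ(a))* X* + (RΛ(a))* Y*. An upper bound of the form XT + YR
therefore inherits adjoints. -/
theorem HasAdjoints.mul_add_mul {T R : adjointables B E} (hT : HasAdjoints Λ T.1)
    (hR : HasAdjoints Λ R.1) (X Y : adjointables B E) : HasAdjoints Λ (X * T + Y * R).1 := by
  intro a w
  obtain ⟨p, hp⟩ := hT a ((star X).1 w)
  obtain ⟨q, hq⟩ := hR a ((star Y).1 w)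
  refine ⟨p + q, fun b => ?_⟩
  rw [mul_add, hp, hq, adjointables.star_rinner_apply, adjointables.star_rinner_apply,
    ← rinner_add_right]
  rfl

theorem StrictlyContinuousOnBounded.linear_comb {f g : 𝓜(ℂ, A) →ₗ[ℂ] 𝓜(ℂ, B)}
    (hf : StrictlyContinuousOnBounded f) (hg : StrictlyContinuousOnBounded g) (c d : ℂ) :
    StrictlyContinuousOnBounded (c • f + d • g) := by
  intro r m hm
  have h1 := tendsto_strict_iff.1 (hf r m hm)
  have h2 := tendsto_strict_iff.1 (hg r m hm)
  have hc : ∀ z : ℂ, Continuous fun b : B => z • b := fun z => continuous_const_smul z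
  change Tendsto _ _ _
  rw [tendsto_strict_iff]
  exact ⟨fun b => (((hc c).tendsto _).comp (h1.1 b)).add (((hc d).tendsto _).comp (h2.1 b)),
    fun b => (((hc c).tendsto _).comp (h1.2 b)).add (((hc d).tendsto _).comp (h2.2 b))⟩

theorem cp_continuous (ρ : A →CP 𝓜(ℂ, B)) : Continuous ρ := by
  obtain ⟨C, _, hC⟩ := cp_exists_norm_le ρ
  exact AddMonoidHomClass.continuous_of_bound ρ C hC

/-- The difference ρ₂ - ρ₁ is implemented by the positive operator T₂ - T₁, so it is completely
positive. -/
theorem Implements.le_of_le (hNd : Dense (N : Set A)) {ρ₁ ρ₂ : A →CP 𝓜(ℂ, B)}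
    {T₁ T₂ : adjointables B E} (h₁ : Implements Λ ρ₁ T₁.1) (h₂ : Implements Λ ρ₂ T₂.1)
    (h : T₁ ≤ T₂) : ρ₁ ≤ ρ₂ := by
  obtain ⟨η, hη⟩ := exists_cp_of_implements (Λ := Λ) hNd
    (θ := ρ₂.toLinearMap - ρ₁.toLinearMap) ((cp_continuous ρ₂).sub (cp_continuous ρ₁))
    (R := (T₂ - T₁).1) (adjointables.nonneg_iff.1 (sub_nonneg.2 h)) fun a₁ a₂ b₁ b₂ => by
      change star b₂ * (ρ₂ _ - ρ₁ _).fst b₁ = rinner B (T₂.1 _ - T₁.1 _) _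
      rw [DoubleCentralizer.sub_fst, sub_apply, mul_sub, h₁, h₂, rinner_sub_left]
  refine cp_le_iff.2 ⟨η, fun a => ?_⟩
  rw [hη]
  exact (add_sub_cancel (ρ₁ a) (ρ₂ a)).symm

theorem exists_real_smul (hNd : Dense (N : Set A)) {ρ : A →CP 𝓜(ℂ, B)} (hρ : IsStrict ρ)
    {T : adjointables B E} (hT : 0 ≤ T) (h : Implements Λ ρ T.1) {c : ℝ} (hc : 0 ≤ c) :
    ∃ η : A →CP 𝓜(ℂ, B), (∀ a, η a = (c : ℂ) • ρ a) ∧ IsStrict η ∧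
      0 ≤ (c : ℂ) • T ∧ Implements Λ η ((c : ℂ) • T).1 := by
  have hcT : 0 ≤ (c : ℂ) • T := by
    have := smul_nonneg hc hT
    rwa [RCLike.real_smul_eq_coe_smul (K := ℂ)] at this
  have himp : ∀ (a₁ a₂ : N) (b₁ b₂ : B), star b₂ * ((c : ℂ) • ρ (star (a₂ : A) * a₁)).fst b₁ =
      rinner B (((c : ℂ) • T).1 (Λ a₁ b₁)) (Λ a₂ b₂) := fun a₁ a₂ b₁ b₂ => by
    rw [DoubleCentralizer.smul_fst, smul_apply, mul_smul_comm, h, ← rinner_smul_left]; rfl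
  obtain ⟨η, hη⟩ := exists_cp_of_implements (Λ := Λ) hNd (θ := (c : ℂ) • ρ.toLinearMap)
    (continuous_const_smul (c : ℂ) |>.comp (cp_continuous ρ))
    (R := ((c : ℂ) • T).1) (adjointables.nonneg_iff.1 hcT) himp
  have hη' : ∀ a, η a = (c : ℂ) • ρ a := hη
  refine ⟨η, hη', fun r a ha => ?_, hcT, fun a₁ a₂ b₁ b₂ => by rw [hη', himp]⟩
  have h1 := tendsto_strict_iff.1 (hρ r a ha)
  have hcc : Continuous fun b : B => (c : ℂ) • b := continuous_const_smul _
  change Tendsto η _ _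
  rw [tendsto_strict_iff]
  simp only [hη', DoubleCentralizer.smul_fst, DoubleCentralizer.smul_snd, smul_apply]
  exact ⟨fun b => (hcc.tendsto _).comp (h1.1 b), fun b => (hcc.tendsto _).comp (h1.2 b)⟩

/-- Turns 𝓖 into the open unit ball of implemented positive operators. For the converse, T is
divided by some t strictly between ‖T‖ and 1. -/
theorem mem_setG_iff (hNd : Dense (N : Set A)) {ρ : A →CP 𝓜(ℂ, B)} :
    ρ ∈ setG Λ ↔ IsStrict ρ ∧ ∃ T : adjointables B E, 0 ≤ T ∧ ‖T‖ < 1 ∧ Implements Λ ρ T.1 := by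
  constructor
  · intro hρ
    refine ⟨isStrict_of_mem_setG hρ, ?_⟩
    obtain ⟨t, ht0, ht1, ρ', ⟨hs, T', hT', hi, hle⟩, e⟩ := hρ
    obtain ⟨T, rfl, hT⟩ := adjointables.exists_of_isPositiveOperator hT'
    have hn : ‖T‖ ≤ 1 := (CStarAlgebra.norm_le_one_iff_of_nonneg T hT).2
      (adjointables.le_iff.2 hle)
    obtain ⟨η, hη, -, h0, hηi⟩ := exists_real_smul hNd hs hT hi ht0
    refine ⟨(t : ℂ) • T, h0, ?_, fun a₁ a₂ b₁ b₂ => by rw [e, ← hη, hηi]⟩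
    rw [norm_smul, Complex.norm_real, Real.norm_of_nonneg ht0]
    nlinarith
  · rintro ⟨hs, T, hT, hn, hi⟩
    obtain ⟨t, ht, ht1⟩ := exists_between hn
    have ht0 : 0 < t := (norm_nonneg T).trans_lt ht
    obtain ⟨η, hη, hηs, h0, hηi⟩ := exists_real_smul hNd hs hT hi (inv_nonneg.2 ht0.le)
    refine ⟨t, ht0.le, ht1, η, ⟨hηs, _, adjointables.isPositiveOperator h0, hηi, ?_⟩, fun a => ?_⟩
    · refine adjointables.le_iff.1 ((CStarAlgebra.norm_le_one_iff_of_nonneg _ h0).1 ?_)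
      rw [norm_smul, Complex.norm_real, Real.norm_of_nonneg (inv_nonneg.2 ht0.le)]
      exact inv_mul_le_one_of_le₀ ht.le ht0.le
    · rw [hη, smul_smul, ← Complex.ofReal_mul, mul_inv_cancel₀ ht0.ne', Complex.ofReal_one,
        one_smul]

variable {I : Type*} [Preorder I] [IsDirectedOrder I] [Nonempty I]
  {u : I → 𝓜(ℂ, A)} {S : I → E →L[ℂ] E} {ρ : I → A →CP 𝓜(ℂ, B)}

theorem IsTruncatingNet.isDirectedOrder_setG (hu : IsTruncatingNet Λ u S ρ)
    (hN : ∀ x : A, ∀ a ∈ N, x * a ∈ N) (hNd : Dense (N : Set A)) (hd : DenseRange (lam Λ)) :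
    IsDirectedOrder (setG Λ) := by
  refine ⟨fun ρ₁ ρ₂ => ?_⟩
  obtain ⟨hs₁, T₁, hT₁, hn₁, hi₁⟩ := (mem_setG_iff hNd).1 ρ₁.2
  obtain ⟨hs₂, T₂, hT₂, hn₂, hi₂⟩ := (mem_setG_iff hNd).1 ρ₂.2
  obtain ⟨T, X, Y, c, d, hT, hn, h₁, h₂, hXY, hc, hd', hle, hcomm⟩ :=
    exists_le_of_norm_lt_one hT₁ hn₁ hT₂ hn₂
  have hΛ := fun a => hu.continuous_apply hd a
  choose P hP hP' using hu.exists_leftAction hN hd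
  -- Operators implementing a map commute with left multiplications; `hcomm` hands this on to the
  -- upper bound T.
  have hPc : ∀ {η : A →CP 𝓜(ℂ, B)} {R : adjointables B E}, Implements Λ η R.1 →
      ∀ x, Commute (P x) R := by
    intro η R hR x
    refine Subtype.ext (clm_eq_of_lam hd fun a b => eq_of_rinner_lam hd fun a₂ b₂ => ?_)
    change rinner B ((P x).1 (R.1 (Λ a b))) _ = rinner B (R.1 ((P x).1 (Λ a b))) _
    rw [adjointables.rinner_star, hP', hP, hR.intertwines]
  have hint : Intertwines hN Λ T.1 := fun x a₁ a₂ b₁ b₂ => by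
    have hx : Commute (P x) T := hcomm _ (hPc hi₁ x) (hPc hi₂ x)
    have hx' : (P x).1 (T.1 (Λ a₁ b₁)) = T.1 ((P x).1 (Λ a₁ b₁)) :=
      congrArg (fun R : adjointables B E => R.1 (Λ a₁ b₁)) hx.eq
    rw [← hP, ← hx', adjointables.rinner_star, hP']
  have hadj : HasAdjoints Λ T.1 := by
    rw [hXY]
    exact (hi₁.hasAdjoints hd hΛ hT₁).mul_add_mul (hi₂.hasAdjoints hd hΛ hT₂) X Y
  obtain ⟨C₁, hC₁, hb₁⟩ := cp_exists_norm_le ρ₁.1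
  obtain ⟨C₂, hC₂, hb₂⟩ := cp_exists_norm_le ρ₂.1
  obtain ⟨η, hηs, hηi⟩ := exists_strict_implements hN hNd hT hint hadj
    (hs₁.extend_continuous.linear_comb hs₂.extend_continuous (c : ℂ) (d : ℂ))
    (C := c * C₁ + d * C₂) (by positivity) (fun a => by
      change ‖(c : ℂ) • hs₁.extend _ + (d : ℂ) • hs₂.extend _‖ ≤ _
      rw [hs₁.extend_coe, hs₂.extend_coe]
      refine (norm_add_le _ _).trans ?_
      rw [norm_smul, norm_smul, Complex.norm_real, Complex.norm_real, Real.norm_of_nonneg hc,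
        Real.norm_of_nonneg hd', add_mul, mul_assoc, mul_assoc]
      gcongr
      · exact hb₁ a
      · exact hb₂ a) (fun a b => by
      refine CStarAlgebra.norm_le_norm_of_nonneg_of_le (adjointables.nonneg_iff.1 hT _)
        ((adjointables.le_iff.1 hle (Λ a b)).trans_eq ?_)
      change rinner B ((c : ℂ) • T₁.1 (Λ a b) + (d : ℂ) • T₂.1 (Λ a b)) (Λ a b) = star b *
        ((c : ℂ) • (hs₁.extend (star (DoubleCentralizer.coe ℂ (a : A)) *
          DoubleCentralizer.coe ℂ (a : A))).fst b + (d : ℂ) •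
          (hs₂.extend (star (DoubleCentralizer.coe ℂ (a : A)) *
          DoubleCentralizer.coe ℂ (a : A))).fst b)
      rw [← coe_star, ← coe_mul, hs₁.extend_coe, hs₂.extend_coe, rinner_add_left,
        rinner_smul_left, rinner_smul_left, ← hi₁, ← hi₂, mul_add, mul_smul_comm, mul_smul_comm])
  exact ⟨⟨η, (mem_setG_iff hNd).2 ⟨hηs, T, hT, hn, hηi⟩⟩, hi₁.le_of_le hNd hηi h₁,
    hi₂.le_of_le hNd hηi h₂⟩

end Directed

/-- Parallelogram law, dropping the positive term at x + y. -/
theorem norm_form_sub_le {V B : Type*} [NonUnitalCStarAlgebra B] [PartialOrder B]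
    [StarOrderedRing B] [AddCommGroup V] [Module ℂ V] {s : V →ₗ⋆[ℂ] V →ₗ[ℂ] B}
    (hs : ∀ x, 0 ≤ s x x) (x y : V) : ‖s (x - y) (x - y)‖ ≤ 2 * (‖s x x‖ + ‖s y y‖) := by
  have h1 : s (x - y) (x - y) ≤ (2 : ℝ) • (s x x + s y y) := by
    refine (le_add_of_nonneg_right (hs (x + y))).trans_eq ?_
    rw [two_smul]
    simp only [map_add, map_sub, LinearMap.add_apply, LinearMap.sub_apply]
    abel
  refine (CStarAlgebra.norm_le_norm_of_nonneg_of_le (hs _) h1).trans ?_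
  rw [norm_smul, Real.norm_of_nonneg zero_le_two]
  gcongr
  exact norm_add_le _ _

theorem tendsto_real_smul_nhdsLT_one {V : Type*} [NormedAddCommGroup V] [NormedSpace ℂ V] (v : V) :
    Tendsto (fun t : ℝ => (t : ℂ) • v) (𝓝[<] 1) (𝓝 v) := by
  have h : Continuous fun t : ℝ => (t : ℂ) • v := by fun_prop
  have := (h.tendsto 1).mono_left (nhdsWithin_le_nhds (s := Set.Iio 1))
  simpa using this

theorem eventually_nhdsLT_one : ∀ᶠ t : ℝ in 𝓝[<] 1, 0 ≤ t ∧ t < 1 :=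
  ((eventually_ge_nhds zero_lt_one).filter_mono nhdsWithin_le_nhds).and self_mem_nhdsWithin

theorem tendsto_strict_const {A ι : Type*} [NonUnitalCStarAlgebra A] (l : Filter ι)
    (m : 𝓜(ℂ, A)) : Tendsto (fun _ : ι => m) l (@nhds _ (strictTopology A) m) :=
  tendsto_strict_iff.2 ⟨fun _ => tendsto_const_nhds, fun _ => tendsto_const_nhds⟩

/-! ### The limit form, and density of N ⊙ D for it. -/

section Limit

variable {A B E : Type*} [NonUnitalCStarAlgebra A] [PartialOrder A] [StarOrderedRing A]
  [NonUnitalCStarAlgebra B] [PartialOrder B] [StarOrderedRing B]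
  [NormedAddCommGroup E] [NormedSpace ℂ E] [SMul Bᵐᵒᵖ E] [CStarModule Bᵐᵒᵖ E] [CompleteSpace E]
  {N : Submodule ℂ A} {Λ : N →ₗ[ℂ] B →ₗ[ℂ] E}
  {I : Type*} [Preorder I] [IsDirectedOrder I] [Nonempty I]
  {u : I → 𝓜(ℂ, A)} {S : I → E →L[ℂ] E} {ρ : I → A →CP 𝓜(ℂ, B)}

/-- t ρ_i is implemented by t S_i*S_i, which has norm < 1. These maps connect the truncating net
with 𝓖. -/
theorem IsTruncatingNet.exists_setG (hu : IsTruncatingNet Λ u S ρ) (hNd : Dense (N : Set A)) (i : I)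
    {t : ℝ} (ht0 : 0 ≤ t) (ht1 : t < 1) :
    ∃ σ : setG Λ, (∀ a, σ.1 a = (t : ℂ) • ρ i a) ∧ ∀ x : N ⊗[ℂ] B,
      tensorForm (extendG σ) (inclN N B x) (inclN N B x) =
        (t : ℂ) • rinner B (S i (lam Λ x)) (S i (lam Λ x)) := by
  obtain ⟨R, hR, hi⟩ := hu.exists_implements i
  obtain ⟨η, hη, hηs, h0, hηi⟩ := exists_real_smul hNd (hu.strict i) (star_mul_self_nonneg R) hi ht0
  have hRn : ‖R‖ ≤ 1 := (congrArg norm hR).trans_le (hu.norm_S_le i)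
  have hmem : η ∈ setG Λ := (mem_setG_iff hNd).2 ⟨hηs, _, h0, by
    rw [norm_smul, Complex.norm_real, Real.norm_of_nonneg ht0, CStarRing.norm_star_mul_self]
    nlinarith [norm_nonneg R, mul_le_one₀ hRn (norm_nonneg R) hRn], hηi⟩
  refine ⟨⟨η, hmem⟩, hη, fun x => ?_⟩
  refine (tensorForm_inclN (isStrict_of_mem_setG hmem) hηi x x).trans ?_
  change rinner B ((t : ℂ) • (star R * R).1 (lam Λ x)) _ = _
  rw [rinner_smul_left, adjointables.rinner_star_mul, hR]

theorem formG_inclN_le (hNd : Dense (N : Set A)) (σ : setG Λ) (x : N ⊗[ℂ] B) :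
    tensorForm (extendG σ) (inclN N B x) (inclN N B x) ≤ rinner B (lam Λ x) (lam Λ x) := by
  obtain ⟨hs, T, hT, hn, hi⟩ := (mem_setG_iff hNd).1 σ.2
  refine (tensorForm_inclN (isStrict_of_mem_setG σ.2) hi x x).trans_le ?_
  exact adjointables.le_iff.1 ((CStarAlgebra.norm_le_one_iff_of_nonneg T hT).1 hn.le) _

/-- All values lie below ⟨Λx, Λx⟩ and increase with σ, so a single t ρ_i within ε controls the whole
tail. -/
theorem IsTruncatingNet.tendsto_formG (hu : IsTruncatingNet Λ u S ρ) (hNd : Dense (N : Set A))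
    (x : N ⊗[ℂ] B) :
    Tendsto (fun σ : setG Λ => tensorForm (extendG σ) (inclN N B x) (inclN N B x)) atTop
      (𝓝 (rinner B (lam Λ x) (lam Λ x))) := by
  rw [Metric.tendsto_nhds]
  intro ε hε
  obtain ⟨i, hi⟩ := (Metric.tendsto_nhds.1
    (tendsto_rinner (B := B) (hu.tendsto_S (lam Λ x)) (hu.tendsto_S (lam Λ x))) (ε / 2)
      (half_pos hε)).exists
  obtain ⟨t, ht, ht0, ht1⟩ := ((Metric.tendsto_nhds.1 (tendsto_real_smul_nhdsLT_one
    (rinner B (S i (lam Λ x)) (S i (lam Λ x)))) (ε / 2) (half_pos hε)).and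
      eventually_nhdsLT_one).exists
  obtain ⟨σ₀, -, hσ₀⟩ := hu.exists_setG hNd i ht0 ht1
  have h0 : ‖rinner B (lam Λ x) (lam Λ x) -
      tensorForm (extendG σ₀) (inclN N B x) (inclN N B x)‖ < ε := by
    rw [hσ₀, ← dist_eq_norm, dist_comm]
    exact (dist_triangle _ _ _).trans_lt (by linarith)
  filter_upwards [eventually_ge_atTop σ₀] with σ hσ
  rw [dist_comm, dist_eq_norm]
  exact (CStarAlgebra.norm_le_norm_of_nonneg_of_le (sub_nonneg.2 (formG_inclN_le hNd σ x))
    (sub_le_sub_left (formG_mono _ _ hσ _) _)).trans_lt h0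

theorem IsTruncatingNet.coe_mem_calN (hu : IsTruncatingNet Λ u S ρ) (hNd : Dense (N : Set A))
    (D : Submodule ℂ B) (a : N) : DoubleCentralizer.coe ℂ (a : A) ∈ calN Λ D :=
  star_mul_self_mem_setP_iff.2 fun d _ => ⟨_, hu.tendsto_formG hNd (a ⊗ₜ d)⟩

/-- Excludes the degenerate case in which `limitForm` is 0 by convention, and makes limits over 𝓖
unique. -/
theorem IsTruncatingNet.neBot_atTop (hu : IsTruncatingNet Λ u S ρ)
    (hN : ∀ x : A, ∀ a ∈ N, x * a ∈ N) (hNd : Dense (N : Set A)) (hd : DenseRange (lam Λ)) :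
    (atTop : Filter (setG Λ)).NeBot := by
  have := hu.isDirectedOrder_setG hN hNd hd
  obtain ⟨σ, -⟩ := hu.exists_setG hNd (Classical.arbitrary I) le_rfl zero_lt_one
  have : Nonempty (setG Λ) := ⟨σ⟩
  infer_instance

variable {D : Submodule ℂ B}

/-- The map `N ⊙ D → 𝓝 ⊙ D` induced by an inclusion of `N` into `𝓝`. -/
noncomputable def inclCalN (hNN : ∀ a : N, DoubleCentralizer.coe ℂ (a : A) ∈ calN Λ D) :
    N ⊗[ℂ] D →ₗ[ℂ] calN Λ D ⊗[ℂ] D :=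
  ((((DoubleCentralizer.coeHom : A →⋆ₙₐ[ℂ] 𝓜(ℂ, A)) : A →ₗ[ℂ] 𝓜(ℂ, A)) ∘ₗ
    N.subtype).codRestrict (calN Λ D) hNN).rTensor D

theorem inclTensor_inclCalN (hNN : ∀ a : N, DoubleCentralizer.coe ℂ (a : A) ∈ calN Λ D)
    (x : N ⊗[ℂ] D) : inclTensor Λ D (inclCalN hNN x) = inclN N B (D.subtype.lTensor N x) := by
  induction x using TensorProduct.induction_on with
  | zero => simp only [map_zero]
  | tmul a d => rfl
  | add x y hx hy => simp only [map_add, hx, hy]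

theorem IsTruncatingNet.limitForm_inclCalN (hu : IsTruncatingNet Λ u S ρ)
    (hN : ∀ x : A, ∀ a ∈ N, x * a ∈ N) (hNd : Dense (N : Set A)) (hd : DenseRange (lam Λ))
    (hNN : ∀ a : N, DoubleCentralizer.coe ℂ (a : A) ∈ calN Λ D) (x : N ⊗[ℂ] D) :
    limitForm Λ D (inclCalN hNN x) (inclCalN hNN x) =
      rinner B (lam Λ (D.subtype.lTensor N x)) (lam Λ (D.subtype.lTensor N x)) := by
  have := hu.neBot_atTop hN hNd hd
  refine tendsto_nhds_unique (tendsto_limitForm Λ D _ _) ?_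
  rw [inclTensor_inclCalN]
  exact hu.tendsto_formG hNd _

theorem formG_le_limitForm (σ : setG Λ) (hG : (atTop : Filter (setG Λ)).NeBot)
    (x : calN Λ D ⊗[ℂ] D) :
    tensorForm (extendG σ) (inclTensor Λ D x) (inclTensor Λ D x) ≤ limitForm Λ D x x :=
  ge_of_tendsto (tendsto_limitForm Λ D x x)
    ((eventually_ge_atTop σ).mono fun _ h => formG_mono _ _ h _)

theorem extendG_continuous (σ : setG Λ) : StrictlyContinuousOnBounded (extendG σ) :=
  (isStrict_of_mem_setG σ.2).extend_continuous

/-- Elements `a ⊗ d` with `a ∈ 𝓝` are approximated by elements `c ⊗ d` with `c ∈ N`. -/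
theorem IsTruncatingNet.exists_limitForm_sub_lt (hu : IsTruncatingNet Λ u S ρ)
    (hN : ∀ x : A, ∀ a ∈ N, x * a ∈ N) (hNd : Dense (N : Set A)) (hd : DenseRange (lam Λ))
    (hNN : ∀ a : N, DoubleCentralizer.coe ℂ (a : A) ∈ calN Λ D) (a : calN Λ D) (d : D) {ε : ℝ}
    (hε : 0 < ε) : ∃ c : N, ‖limitForm Λ D (a ⊗ₜ d - inclCalN hNN (c ⊗ₜ d))
      (a ⊗ₜ d - inclCalN hNN (c ⊗ₜ d))‖ < 5 * ε := by
  have hG := hu.neBot_atTop hN hNd hd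
  set x : calN Λ D ⊗[ℂ] D := a ⊗ₜ d with hx
  set φ := limitForm Λ D with hφ
  -- From here on φ is compared with this one form, which is strictly continuous on bounded sets.
  obtain ⟨σ, hσ⟩ := (Metric.tendsto_nhds.1 (tendsto_limitForm Λ D x x) ε hε).exists
  rw [dist_comm, dist_eq_norm] at hσ
  let q : 𝓜(ℂ, A) → B := fun m => star (d : B) * (extendG σ (star m * m)).fst d
  -- A common bound for a, for the net c_k (at most ‖a‖ + 1) and for the u_i (at most 1).
  set r : ℝ := max (‖(a : 𝓜(ℂ, A))‖ + 1) 1 with hr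
  have hra : ‖(a : 𝓜(ℂ, A))‖ ≤ r := (le_add_of_nonneg_right zero_le_one).trans (le_max_left _ _)
  have hmulr : ∀ (m : 𝓜(ℂ, A)) (i : I), ‖m‖ ≤ r → ‖m * u i‖ ≤ r := fun m i hm =>
    (norm_mul_le _ _).trans ((mul_le_of_le_one_right (norm_nonneg _) (hu.norm_u_le i)).trans hm)
  have hau : Tendsto (fun i => (a : 𝓜(ℂ, A)) * u i) atTop
      (@nhds _ (strictTopology A) (a : 𝓜(ℂ, A))) := by
    have := tendsto_strict_mul (tendsto_strict_const atTop (a : 𝓜(ℂ, A))) (Eventually.of_forall fun _ => hra)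
      hu.tendsto_u (Eventually.of_forall fun i => (hu.norm_u_le i).trans (le_max_right _ _))
    rwa [mul_one] at this
  have hq0 : q 0 = 0 := by simp [q]
  have h1 : Tendsto (fun i => q ((a : 𝓜(ℂ, A)) * u i)) atTop (𝓝 (q a)) :=
    (extendG_continuous σ).tendsto_star_mul hau (Eventually.of_forall fun i => hmulr _ i hra) (d : B)
  have h2 : Tendsto (fun i => q ((a : 𝓜(ℂ, A)) - (a : 𝓜(ℂ, A)) * u i)) atTop (𝓝 0) := by
    rw [← hq0, ← sub_self (a : 𝓜(ℂ, A))]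
    exact (extendG_continuous σ).tendsto_star_mul (tendsto_strict_sub (tendsto_strict_const _ _) hau)
      (r := r + r) (Eventually.of_forall fun i =>
        (norm_sub_le _ _).trans (add_le_add hra (hmulr _ i hra))) (d : B)
  have h1' : ∀ᶠ i in atTop, ‖φ x x - q ((a : 𝓜(ℂ, A)) * u i)‖ < ε :=
    (tendsto_const_nhds.sub h1).norm.eventually_lt_const hσ
  have h2' : ∀ᶠ i in atTop, ‖q ((a : 𝓜(ℂ, A)) - (a : 𝓜(ℂ, A)) * u i)‖ < ε :=
    h2.norm.eventually_lt_const (by rwa [norm_zero])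
  obtain ⟨i, hi1, hi2⟩ := (h1'.and h2').exists
  obtain ⟨c, hcb, hc⟩ := exists_bounded_net hNd (a : 𝓜(ℂ, A))
  set l := CStarAlgebra.approximateUnit A ×ˢ (atTop : Filter ℕ) with hl
  have hcr : ∀ᶠ k in l, ‖DoubleCentralizer.coe ℂ (c k : A)‖ ≤ r :=
    hcb.mono fun k hk => (norm_coe_le _).trans (hk.trans (le_max_left _ _))
  let c' : A × ℕ → N := fun k => ⟨(u i).snd (c k : A), hu.mul_mem i (c k)⟩
  have hc' : ∀ k, DoubleCentralizer.coe ℂ (c' k : A) = DoubleCentralizer.coe ℂ (c k : A) * u i :=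
    fun k => coe_snd_apply _ _
  let y : A × ℕ → calN Λ D ⊗[ℂ] D := fun k => inclCalN hNN (c' k ⊗ₜ d)
  have hcu : Tendsto (fun k => DoubleCentralizer.coe ℂ (c' k : A)) l
      (@nhds _ (strictTopology A) ((a : 𝓜(ℂ, A)) * u i)) := by
    simp only [hc']
    exact tendsto_strict_mul hc hcr (tendsto_strict_const _ _)
      (Eventually.of_forall fun _ => (hu.norm_u_le i).trans (le_max_right _ _))
  have hcur : ∀ᶠ k in l, ‖DoubleCentralizer.coe ℂ (c' k : A)‖ ≤ r := by
    filter_upwards [hcr] with k hk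
    rw [hc']
    exact hmulr _ i hk
  have h3 : ∀ᶠ k in l, ‖q ((a : 𝓜(ℂ, A)) - DoubleCentralizer.coe ℂ (c' k : A))‖ < ε :=
    ((extendG_continuous σ).tendsto_star_mul (tendsto_strict_sub (tendsto_strict_const _ _) hcu)
      (r := r + r) (hcur.mono fun k hk =>
        (norm_sub_le _ _).trans (add_le_add hra hk)) (d : B)).norm.eventually_lt_const hi2
  have h4 : Tendsto (fun k => q (DoubleCentralizer.coe ℂ (c' k : A))) l
      (𝓝 (q ((a : 𝓜(ℂ, A)) * u i))) :=
    (extendG_continuous σ).tendsto_star_mul hcu hcur (d : B)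
  have hφy : ∀ k, φ (y k) (y k) = rinner B (S i (Λ (c k) d)) (S i (Λ (c k) d)) := fun k => by
    rw [hu.S_apply]
    exact hu.limitForm_inclCalN hN hNd hd hNN (c' k ⊗ₜ d)
  -- By `hφy`, t φ(y_k, y_k) is the form of t ρ_i ∈ 𝓖 at c_k ⊗ d. It converges to the form at a ⊗ d,
  -- which is at most φ(x, x).
  have hσt : ∀ t : ℝ, 0 ≤ t → t < 1 → ∃ z, z ≤ φ x x ∧
      Tendsto (fun k => (t : ℂ) • φ (y k) (y k)) l (𝓝 z) := fun t ht0 ht1 => by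
    obtain ⟨τ, -, hτ⟩ := hu.exists_setG hNd i ht0 ht1
    refine ⟨_, formG_le_limitForm τ hG x, ?_⟩
    refine ((extendG_continuous τ).tendsto_star_mul hc hcr (d : B)).congr fun k => ?_
    rw [hφy]
    exact hτ (c k ⊗ₜ (d : B))
  -- ρ_i itself need not lie in 𝓖. Existence of the limit is read off at t = 1/2, and the bound by
  -- φ(x, x) comes from t ↑ 1.
  obtain ⟨ℓ, hℓ⟩ : ∃ ℓ, Tendsto (fun k => φ (y k) (y k)) l (𝓝 ℓ) := by
    obtain ⟨z, -, hz⟩ := hσt (1 / 2) (by norm_num) (by norm_num)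
    have hcs : Continuous fun b : B => (2 : ℂ) • b := continuous_const_smul _
    refine ⟨(2 : ℂ) • z, ((hcs.tendsto z).comp hz).congr fun k => ?_⟩
    simp only [Function.comp_apply, smul_smul]
    norm_num
  have hℓφ : ℓ ≤ φ x x := by
    refine le_of_tendsto (tendsto_real_smul_nhdsLT_one ℓ) ?_
    filter_upwards [eventually_nhdsLT_one] with t ht
    obtain ⟨z, hz, hzt⟩ := hσt t ht.1 ht.2
    have hcs : Continuous fun b : B => (t : ℂ) • b := continuous_const_smul _
    rwa [tendsto_nhds_unique ((hcs.tendsto ℓ).comp hℓ) hzt]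
  have hqy : ∀ k, tensorForm (extendG σ) (inclTensor Λ D (y k)) (inclTensor Λ D (y k)) =
      q (DoubleCentralizer.coe ℂ (c' k : A)) := fun k => rfl
  have h5 : Tendsto (fun k => φ (y k) (y k) - q (DoubleCentralizer.coe ℂ (c' k : A))) l
      (𝓝 (ℓ - q ((a : 𝓜(ℂ, A)) * u i))) := hℓ.sub h4
  have h6 : ‖ℓ - q ((a : 𝓜(ℂ, A)) * u i)‖ < ε := by
    refine (CStarAlgebra.norm_le_norm_of_nonneg_of_le (ge_of_tendsto' h5 fun k => ?_)
      (sub_le_sub_right hℓφ _)).trans_lt hi1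
    rw [← hqy]
    exact sub_nonneg.2 (formG_le_limitForm σ hG _)
  obtain ⟨k, hk3, hk5⟩ := (h3.and (h5.norm.eventually_lt_const h6)).exists
  refine ⟨c' k, ?_⟩
  -- The positive form φ - σ is below ε at x and at y_k, so at most 4ε at x - y_k; σ contributes
  -- less than ε there, whence 5ε.
  let s : calN Λ D ⊗[ℂ] D →ₗ⋆[ℂ] calN Λ D ⊗[ℂ] D →ₗ[ℂ] B :=
    φ - ((tensorForm (extendG σ)).compl₂ (inclTensor Λ D)) ∘ₛₗ inclTensor Λ D
  have hs : ∀ z, 0 ≤ s z z := fun z => sub_nonneg.2 (formG_le_limitForm σ hG z)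
  have h7 := norm_form_sub_le hs x (y k)
  have h8 : φ (x - y k) (x - y k) = s (x - y k) (x - y k) +
      q ((a : 𝓜(ℂ, A)) - DoubleCentralizer.coe ℂ (c' k : A)) := by
    have e1 : inclTensor Λ D (x - y k) =
        ((a : 𝓜(ℂ, A)) - DoubleCentralizer.coe ℂ (c' k : A)) ⊗ₜ (d : B) := by
      rw [map_sub, TensorProduct.sub_tmul]; rfl
    change _ = φ (x - y k) (x - y k) -
      tensorForm (extendG σ) (inclTensor Λ D (x - y k)) (inclTensor Λ D (x - y k)) + _
    rw [e1, tensorForm_tmul, sub_add_cancel]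
  have h9 : ‖s x x‖ < ε := hσ
  have h10 : ‖s (y k) (y k)‖ < ε := hk5
  change ‖φ (x - y k) (x - y k)‖ < 5 * ε
  rw [h8]
  refine (norm_add_le _ _).trans_lt ?_
  linarith

end Limit

/-! ### The unitary U. -/

section Unitary

variable {A B E : Type*} [NonUnitalCStarAlgebra A] [PartialOrder A] [StarOrderedRing A]
  [NonUnitalCStarAlgebra B] [PartialOrder B] [StarOrderedRing B]
  [NormedAddCommGroup E] [NormedSpace ℂ E] [SMul Bᵐᵒᵖ E] [CStarModule Bᵐᵒᵖ E] [CompleteSpace E]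
  {N : Submodule ℂ A} {Λ : N →ₗ[ℂ] B →ₗ[ℂ] E}
  {I : Type*} [Preorder I] [IsDirectedOrder I] [Nonempty I]
  {u : I → 𝓜(ℂ, A)} {S : I → E →L[ℂ] E} {ρ : I → A →CP 𝓜(ℂ, B)} {D : Submodule ℂ B}

/-- Continuity of each Λ(a) allows B to be replaced by its dense subspace D. -/
theorem IsTruncatingNet.denseRange_lam_comp (hu : IsTruncatingNet Λ u S ρ)
    (hd : DenseRange (lam Λ)) (hD : Dense (D : Set B)) :
    DenseRange (lam Λ ∘ₗ D.subtype.lTensor N) := by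
  have h : LinearMap.range (lam Λ) ≤
      (LinearMap.range (lam Λ ∘ₗ D.subtype.lTensor N)).topologicalClosure := by
    rintro _ ⟨x, rfl⟩
    induction x using TensorProduct.induction_on with
    | zero => rw [map_zero]; exact zero_mem _
    | add x y hx hy => rw [map_add]; exact add_mem hx hy
    | tmul a b =>
      refine map_mem_closure (f := Λ a) (hu.continuous_apply hd a) (hD b) fun d hdD => ?_
      exact ⟨a ⊗ₜ ⟨d, hdD⟩, rfl⟩
  exact Dense.of_closure (hd.mono h)

/-- The canonical map from `𝓝 ⊙ D` to its completion. -/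
noncomputable def mkₗ (Λ : N →ₗ[ℂ] B →ₗ[ℂ] E) (hD : ∀ d ∈ D, ∀ b, d * b ∈ D) :
    calN Λ D ⊗[ℂ] D →ₗ[ℂ] MultTensor Λ hD where
  toFun := SemiInnerModule.HilbertCompletion.mk (tensorModule Λ hD)
  map_add' := SemiInnerModule.HilbertCompletion.mk_add _
  map_smul' := SemiInnerModule.HilbertCompletion.mk_smul _

theorem denseRange_mkₗ (hD : ∀ d ∈ D, ∀ b, d * b ∈ D) : DenseRange (mkₗ Λ hD) :=
  SemiInnerModule.HilbertCompletion.denseRange_mk _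

theorem rinner_mkₗ (hD : ∀ d ∈ D, ∀ b, d * b ∈ D) (x y : calN Λ D ⊗[ℂ] D) :
    rinner B (mkₗ Λ hD x) (mkₗ Λ hD y) = limitForm Λ D y x :=
  congrArg unop (SemiInnerModule.HilbertCompletion.inner_mk (tensorModule Λ hD) y x)

variable (hu : IsTruncatingNet Λ u S ρ)
  (hN : ∀ x : A, ∀ a ∈ N, x * a ∈ N) (hNd : Dense (N : Set A)) (hd : DenseRange (lam Λ))
  (hNN : ∀ a : N, DoubleCentralizer.coe ℂ (a : A) ∈ calN Λ D)
  (hD : ∀ d ∈ D, ∀ b, d * b ∈ D) (hDd : Dense (D : Set B))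

include hu hN hNd hd

theorem IsTruncatingNet.rinner_mkₗ_inclCalN (x : N ⊗[ℂ] D) :
    rinner B (mkₗ Λ hD (inclCalN hNN x)) (mkₗ Λ hD (inclCalN hNN x)) =
      rinner B ((lam Λ ∘ₗ D.subtype.lTensor N) x) ((lam Λ ∘ₗ D.subtype.lTensor N) x) :=
  (rinner_mkₗ hD _ _).trans (hu.limitForm_inclCalN hN hNd hd hNN x)

theorem IsTruncatingNet.norm_mkₗ_inclCalN (x : N ⊗[ℂ] D) :
    ‖mkₗ Λ hD (inclCalN hNN x)‖ = ‖(lam Λ ∘ₗ D.subtype.lTensor N) x‖ := by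
  rw [← sq_eq_sq₀ (norm_nonneg _) (norm_nonneg _), ← norm_rinner_self (B := B),
    ← norm_rinner_self (B := B), hu.rinner_mkₗ_inclCalN hN hNd hd]

include hDd

theorem IsTruncatingNet.exists_isometry :
    ∃ U : E →ₗᵢ[ℂ] MultTensor Λ hD, ∀ x : N ⊗[ℂ] D,
      U ((lam Λ ∘ₗ D.subtype.lTensor N) x) = mkₗ Λ hD (inclCalN hNN x) := by
  have hde := hu.denseRange_lam_comp hd hDd
  have hn := hu.norm_mkₗ_inclCalN hN hNd hd hNN hD
  let f := mkₗ Λ hD ∘ₗ inclCalN hNN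
  have hU : ∀ x, f.extendOfNorm (lam Λ ∘ₗ D.subtype.lTensor N)
      ((lam Λ ∘ₗ D.subtype.lTensor N) x) = f x :=
    LinearMap.extendOfNorm_eq hde ⟨1, fun x => by rw [one_mul]; exact (hn x).le⟩
  refine ⟨⟨(f.extendOfNorm (lam Λ ∘ₗ D.subtype.lTensor N)).toLinearMap, fun v => ?_⟩, hU⟩
  refine hde.induction_on (p := fun v => ‖f.extendOfNorm (lam Λ ∘ₗ D.subtype.lTensor N) v‖ = ‖v‖)
    v (isClosed_eq (by fun_prop) (by fun_prop)) fun x => ?_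
  rw [hU]
  exact hn x

theorem IsTruncatingNet.isUnitary (U : E →ₗᵢ[ℂ] MultTensor Λ hD)
    (hU : ∀ x : N ⊗[ℂ] D,
      U ((lam Λ ∘ₗ D.subtype.lTensor N) x) = mkₗ Λ hD (inclCalN hNN x)) : IsUnitary B U := by
  have hde := hu.denseRange_lam_comp hd hDd
  have hdiag : ∀ v, rinner B (U v) (U v) = rinner B v v := fun v => by
    refine hde.induction_on (p := fun v => rinner B (U v) (U v) = rinner B v v) v
      (isClosed_eq (Continuous.rinner U.continuous U.continuous)
        (Continuous.rinner continuous_id continuous_id))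
      fun x => ?_
    rw [hU]
    exact hu.rinner_mkₗ_inclCalN hN hNd hd hNN hD x
  -- Polarisation of `hdiag`.
  have hin : ∀ v w, rinner B (U v) (U w) = rinner B v w := fun v w => by
    have := sesquilinear_eq_zero_of_diag (s := (((rinnerForm B (MultTensor Λ hD)).compl₂
      U.toLinearMap) ∘ₛₗ U.toLinearMap) - rinnerForm B E) (fun x => sub_eq_zero.2 (hdiag x)) w v
    exact sub_eq_zero.1 this
  have hcl : IsClosed (LinearMap.range U.toLinearMap : Set (MultTensor Λ hD)) := by
    rw [LinearMap.coe_range]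
    exact U.isometry.isClosedEmbedding.isClosed_range
  have hsurj : Function.Surjective U := by
    have hmk : ∀ x, mkₗ Λ hD x ∈ LinearMap.range U.toLinearMap := fun x => by
      induction x using TensorProduct.induction_on with
      | zero => rw [map_zero]; exact zero_mem _
      | add x y hx hy => rw [map_add]; exact add_mem hx hy
      | tmul a d =>
        refine hcl.closure_subset_iff.2 subset_rfl (Metric.mem_closure_iff.2 fun δ hδ => ?_)
        -- The form bounds the square of the norm, so 5ε = δ² gives distance < δ.
        obtain ⟨c, hc⟩ := hu.exists_limitForm_sub_lt hN hNd hd hNN a d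
          (ε := δ ^ 2 / 5) (by positivity)
        refine ⟨_, ⟨(lam Λ ∘ₗ D.subtype.lTensor N) (c ⊗ₜ d), hU _⟩, ?_⟩
        rw [dist_eq_norm, ← map_sub]
        refine lt_of_pow_lt_pow_left₀ 2 hδ.le ?_
        rw [← norm_rinner_self (B := B), rinner_mkₗ]
        exact hc.trans_eq (by ring)
    intro w
    refine (denseRange_mkₗ (Λ := Λ) hD).induction_on
      (p := fun w => w ∈ LinearMap.range U.toLinearMap) w hcl hmk
  -- Since U is bijective and preserves inner products, its inverse is its adjoint.
  refine ⟨Function.surjInv hsurj, fun v w => ?_, fun v => ?_, Function.surjInv_eq hsurj⟩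
  · rw [← hin v, Function.surjInv_eq hsurj]
  · exact U.injective (Function.surjInv_eq hsurj _)

end Unitary

end CStarWeight

open CStarWeight in
theorem proposition7p4 {A B E I : Type*}
    [NonUnitalCStarAlgebra A] [PartialOrder A] [StarOrderedRing A]
    [NonUnitalCStarAlgebra B] [PartialOrder B] [StarOrderedRing B]
    [NormedAddCommGroup E] [NormedSpace ℂ E] [SMul Bᵐᵒᵖ E] [CStarModule Bᵐᵒᵖ E] [CompleteSpace E]
    [Preorder I] [IsDirectedOrder I] [Nonempty I]
    (N : Submodule ℂ A) (hN : ∀ x : A, ∀ a ∈ N, x * a ∈ N) (hN_dense : Dense (N : Set A))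
    (Λ : N →ₗ[ℂ] B →ₗ[ℂ] E) (hΛ_closed : IsNormStronglyClosed Λ)
    (hΛ_dense : Dense (Submodule.span ℂ {v : E | ∃ (a : N) (b : B), v = Λ a b} : Set E))
    (u : I → 𝓜(ℂ, A)) (S : I → E →L[ℂ] E) (ρ : I → A →CP 𝓜(ℂ, B))
    (hu : IsTruncatingNet Λ u S ρ)
    (D : Submodule ℂ B) (hD : ∀ d ∈ D, ∀ b, d * b ∈ D) (hD_dense : Dense (D : Set B)) :
    ∃ hNN : ∀ a : N, DoubleCentralizer.coe ℂ (a : A) ∈ calN Λ D,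
      ∃ U : E →ₗᵢ[ℂ] MultTensor Λ hD,
        (∀ (a : N) (b : D), U (Λ a b) = dotTmul Λ hD ⟨DoubleCentralizer.coe ℂ (a : A), hNN a⟩ b) ∧
        (∀ V : E →ₗᵢ[ℂ] MultTensor Λ hD,
          (∀ (a : N) (b : D),
            V (Λ a b) = dotTmul Λ hD ⟨DoubleCentralizer.coe ℂ (a : A), hNN a⟩ b) → V = U) ∧
        IsUnitary B U := by
  have hd := denseRange_lam hΛ_dense
  have hNN := hu.coe_mem_calN hN_dense D
  obtain ⟨U, hU⟩ := hu.exists_isometry hN hN_dense hd hNN hD hD_dense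
  refine ⟨hNN, U, fun a b => hU (a ⊗ₜ b), fun V hV => ?_,
    hu.isUnitary hN hN_dense hd hNN hD hD_dense U hU⟩
  refine LinearIsometry.ext fun v => ?_
  -- Uniqueness: both isometries are continuous and agree on the dense span of the vectors Λ(a)b
  -- with b in D.
  refine congrFun ((hu.denseRange_lam_comp hd hD_dense).equalizer V.continuous U.continuous
    (funext fun x => ?_)) v
  change V _ = U _
  induction x using TensorProduct.induction_on with
  | zero => simp only [map_zero]
  | add x y hx hy => simp only [map_add, hx, hy]
  | tmul a b => exact (hV a b).trans (hU (a ⊗ₜ b)).symm
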